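/- **Setting.** Let $\mathbb U=[-1,1]^{\mathbb N}$ with the product topology. For $s>1$ put $\mathcal E_s=\{(w+w^{-1})/2:\ w\in\mathbb C,\ 1\le|w|\le s\}$ and $\mathcal O_s=\{w\in\mathbb C:\ \operatorname{dist}(w,[-1,1])\le s-1\}$; for a sequence $\rho=(\rho_j)_{j\ge1}$ of numbers $\rho_j>1$ put $\mathcal E_\rho=\prod_j\mathcal E_{\rho_j}$ and $\mathcal O_\rho=\prod_j\mathcal O_{\rho_j}$. Given a sequence $b=(b_j)_{j\ge 1}$ and $\varepsilon>0$, such a $\rho$ is *$(b,\varepsilon)$-admissible* if $\sum_j(\rho_j-1)b_j\le\varepsilon$. Let $p\in(0,1)$ and let $X$ be a complex Banach space. A map $u:\mathbb U\to X$ is *$(b,p,\varepsilon)$-holomorphic* if $b$ is a sequence of positive numbers in $\ell^p(\mathbb N)$, $u$ is bounded on $\mathbb U$, and there is a constant $C_\varepsilon$ such that for every $(b,\varepsilon)$-admissible $\rho$ the map $u$ has an extension $z\mapsto u_z\in X$ to $\mathcal O_\rho$ that is holomorphic with respect to each single variable $z_j\in\mathcal O_{\rho_j}$ and satisfies $\|u_z\|_X\le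 C_\varepsilon$ for all $z\in\mathcal E_\rho$. Let $\hat\Gamma\subset\mathbb R^3$ be the boundary of a bounded Lipschitz domain. Let $\mathcal G$ be a decomposition of $\hat\Gamma$ into finitely many disjoint, relatively open patches $\tau$ such that $\hat\Gamma=\bigcup_{\tau}\overline\tau$, the set $\hat\Gamma\setminus\bigcup_\tau\tau$ has surface measure zero, and $\tau=\chi_\tau(\tilde\tau)$ for an open set $\tilde\tau\subset\mathbb R^2$ and a bi-Lipschitz map $\chi_\tau$ on $\tilde\tau$. Let $\varphi_0,\varphi_1,\varphi_2,\dots:\hat\Gamma\to\mathbb R^3$ be Lipschitz, put $b_j=\|\varphi_j\|_{C^{0,1}(\hat\Gamma;\mathbb R^3)}$ for $j\ge1$ and assume $b=(b_j)_{j\ge1}\in\ell^p(\mathbb N)$. For $y\in\mathbb U$ let $r_y=\varphi_0+\sum_{j\ge1}y_j\varphi_j$, and assume that $r_y$ is a bi-Lipschitz bijection from $\hat\Gamma$ onto $\Gamma_y=r_y(\hat\Gamma)$ for every $y\in\mathbb U$; use the same formula to define $r_z:\hat\Gamma\to\mathbb C^3$ for complex parameters $z$. The surface integral on $\Gamma_y$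 is $$\int_{\Gamma_y}f\,ds=\sum_{\tau\in\mathcal G}\int_{\tilde\tau}f\bigl(r_y(\chi_\tau(u))\bigr)\sqrt{\det\bigl(J^\top J\bigr)(u)}\,du,\qquad J=D(r_y\circ\chi_\tau),$$ and similarly on $\hat\Gamma$ (with the identity in place of $r_y$). Let $\mathfrak U=\{\zeta\in\mathbb C^3:\ \operatorname{Re}(\zeta\cdot\zeta)>0\}$, where $\zeta\cdot\zeta=\sum_i\zeta_i^2$; it contains $\mathbb R^3\setminus\{0\}$. For $y\in\mathbb U$ let a kernel $\mathsf a:\Gamma_y\times\mathfrak U\to\mathbb C$ be given (it may depend on $y$), and let $\varepsilon>0$. Assume: 1. For every $\tau\in\mathcal G$, $u\in\tilde\tau$ and $\zeta\in\mathfrak U$, the map $\mathbb U\ni y\mapsto\mathsf a(r_y(\chi_\tau(u)),\zeta)\in\mathbb C$ is continuous and $(b,p,\varepsilon)$-holomorphic. For each $(b,\varepsilon)$-admissible $\rho$ fix an extension as in the definition of this notion, write $\mathsf a(r_z(\chi_\tau(u)),\zeta)$, $z\in\mathcal O_\rho$, for it, and let it be measurable in $u\in\tilde\tau$. 2. For every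 $(b,\varepsilon)$-admissible $\rho$ and all $z\in\mathcal O_\rho$, $\tau\in\mathcal G$, $u\in\tilde\tau$, the map $\mathfrak U\ni\zeta\mapsto\mathsf a(r_z(\chi_\tau(u)),\zeta)\in\mathbb C$ is holomorphic. 3. For every $(b,\varepsilon)$-admissible $\rho$ there are $C_{\mathsf a}>0$ and $\nu\in[0,2)$ such that for all $\tau\in\mathcal G$, $u\in\tilde\tau$, $z\in\mathcal O_\rho$ and $\hat x\in\hat\Gamma$ with $\hat x\ne\hat y:=\chi_\tau(u)$ and $r_z(\hat x)-r_z(\hat y)\in\mathfrak U$, $$\bigl|\mathsf a\bigl(r_z(\hat y),\,r_z(\hat x)-r_z(\hat y)\bigr)\bigr|\le\frac{C_{\mathsf a}}{\|r_z(\hat x)-r_z(\hat y)\|^{\nu}}.$$ **Conclusion.** For every $y\in\mathbb U$ the pullback $\tau_y f=f\circ r_y$ is an isomorphism from $L^2(\Gamma_y)$ onto $L^2(\hat\Gamma)$, and the boundary integral operator $$(\mathsf A_yf)(x)=\int_{\Gamma_y}\mathsf a(x',x-x')\,f(x')\,ds_{x'}$$ (the integral converging absolutely for almost every $x\in\Gamma_y$)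 is bounded on $L^2(\Gamma_y)$. With $\hat{\mathsf A}_y=\tau_y\mathsf A_y\tau_y^{-1}$, the map $$\mathbb U\ni y\mapsto\hat{\mathsf A}_y\in\mathscr L\bigl(L^2(\hat\Gamma),L^2(\hat\Gamma)\bigr)$$ is continuous, and it is $(b,p,\varepsilon')$-holomorphic for some $\varepsilon'\in(0,\varepsilon]$. -/

import Mathlib

open MeasureTheory Set Topology
open scoped NNReal ENNReal

namespace ShapeHolomorphy

noncomputable section

/-- The parameter plane `ℝ²` of the patches with its Euclidean norm. -/
abbrev E2 : Type := EuclideanSpace ℝ (Fin 2)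
/-- The ambient space `ℝ³` with its Euclidean norm. -/
abbrev E3 : Type := EuclideanSpace ℝ (Fin 3)
/-- The complexification `ℂ³` of `ℝ³` with its Hermitian norm. -/
abbrev C3 : Type := EuclideanSpace ℂ (Fin 3)

/-- The inclusion `ℝ³ ⊂ ℂ³`. -/
def toC3 (v : E3) : C3 := WithLp.toLp 2 fun i => (v i : ℂ)

/-! ### Parametric holomorphy -/

/-- The parameter domain `𝕌 = [-1,1]^ℕ`; as a subset of `ℕ → ℝ` it carries the product
topology. -/
def paramDomain : Set (ℕ → ℝ) := {y | ∀ j, y j ∈ Icc (-1 : ℝ) 1}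

/-- A real parameter, regarded as a complex one. -/
def toComplexParam (y : ℕ → ℝ) : ℕ → ℂ := fun j => (y j : ℂ)

/-- The filled Bernstein ellipse `{(w + w⁻¹)/2 : 1 ≤ |w| ≤ s}`. -/
def bernsteinEllipse (s : ℝ) : Set ℂ := {z | ∃ w : ℂ, 1 ≤ ‖w‖ ∧ ‖w‖ ≤ s ∧ z = (w + w⁻¹) / 2}

/-- The set `{z : dist(z, [-1,1]) ≤ s - 1}`. -/
def tube (s : ℝ) : Set ℂ :=
  {z | Metric.infDist z ((fun t : ℝ => (t : ℂ)) '' Icc (-1 : ℝ) 1) ≤ s - 1}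

/-- The tensorized Bernstein poly-ellipse. -/
def polyEllipse (ρ : ℕ → ℝ) : Set (ℕ → ℂ) := {z | ∀ j, z j ∈ bernsteinEllipse (ρ j)}

/-- The product of the sets `tube (ρ j)`. -/
def polyTube (ρ : ℕ → ℝ) : Set (ℕ → ℂ) := {z | ∀ j, z j ∈ tube (ρ j)}

/-- `ρ` is a `(b, ε)`-admissible sequence of numbers strictly larger than one. -/
def Admissible (b : ℕ → ℝ) (ε : ℝ) (ρ : ℕ → ℝ) : Prop :=
  (∀ j, 1 < ρ j) ∧ Summable (fun j => (ρ j - 1) * b j) ∧ ∑' j, (ρ j - 1) * b j ≤ ε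

/-- `F` extends `u` from the real parameter domain and is, on `polyTube ρ`, holomorphic with
respect to each single variable (the others being kept fixed). -/
def IsHolomorphicExtension {X : Type*} [NormedAddCommGroup X] [NormedSpace ℂ X]
    (ρ : ℕ → ℝ) (u : (ℕ → ℝ) → X) (F : (ℕ → ℂ) → X) : Prop :=
  (∀ y ∈ paramDomain, F (toComplexParam y) = u y) ∧
    ∀ z ∈ polyTube ρ, ∀ j, DifferentiableOn ℂ (fun w => F (Function.update z j w)) (tube (ρ j))

/-- `u` is `(b, p, ε)`-holomorphic, and for every admissible `ρ` the function `F ρ` is an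
extension of `u` as required in that notion. The bound `Cε` does not depend on `ρ`. -/
def BPEHolomorphicWith {X : Type*} [NormedAddCommGroup X] [NormedSpace ℂ X]
    (b : ℕ → ℝ) (p ε : ℝ) (u : (ℕ → ℝ) → X) (F : (ℕ → ℝ) → (ℕ → ℂ) → X) : Prop :=
  (0 < p ∧ p < 1) ∧ 0 < ε ∧
  (∀ j, 0 < b j) ∧ Summable (fun j => b j ^ p) ∧
  (∃ C₀ : ℝ, ∀ y ∈ paramDomain, ‖u y‖ ≤ C₀) ∧
  ∃ Cε : ℝ, ∀ ρ, Admissible b ε ρ →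
    IsHolomorphicExtension ρ u (F ρ) ∧ ∀ z ∈ polyEllipse ρ, ‖F ρ z‖ ≤ Cε

/-- `u : 𝕌 → X` is `(b, p, ε)`-holomorphic. -/
def BPEHolomorphic {X : Type*} [NormedAddCommGroup X] [NormedSpace ℂ X]
    (b : ℕ → ℝ) (p ε : ℝ) (u : (ℕ → ℝ) → X) : Prop :=
  ∃ F : (ℕ → ℝ) → (ℕ → ℂ) → X, BPEHolomorphicWith b p ε u F

/-! ### Lipschitz boundaries and their patches -/

/-- A bounded Lipschitz domain in `ℝ³`: near each boundary point it is, in suitable Cartesian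
coordinates, the region strictly above the graph of a Lipschitz function. -/
structure IsBoundedLipschitzDomain (Ω : Set E3) : Prop where
  isOpen : IsOpen Ω
  nonempty : Ω.Nonempty
  isBounded : Bornology.IsBounded Ω
  localGraph : ∀ x ∈ frontier Ω, ∃ (e : E3 ≃ₗᵢ[ℝ] E3) (γ : E2 → ℝ) (K : ℝ≥0) (r : ℝ),
    0 < r ∧ LipschitzWith K γ ∧
      ∀ v ∈ Metric.ball x r, v ∈ Ω ↔ γ !₂[e v 0, e v 1] < e v 2

/-- `f` is bi-Lipschitz on `s`, i.e. a bi-Lipschitz bijection from `s` onto `f '' s`. -/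
def BiLipschitzOn {X Y : Type*} [PseudoMetricSpace X] [PseudoMetricSpace Y]
    (f : X → Y) (s : Set X) : Prop :=
  (∃ K : ℝ≥0, LipschitzOnWith K f s) ∧
    ∃ K : ℝ≥0, ∀ x ∈ s, ∀ x' ∈ s, dist x x' ≤ K * dist (f x) (f x')

/-- A decomposition of the surface `Γ` into finitely many disjoint relatively open patches
`chart i '' dom i`, each the bi-Lipschitz image of an open subset of the plane, whose closures
cover `Γ` and whose union covers `Γ` up to a set of two-dimensional measure zero. -/
structure PatchDecomposition (Γ : Set E3) (ι : Type*) where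
  dom : ι → Set E2
  chart : ι → E2 → E3
  isOpen_dom : ∀ i, IsOpen (dom i)
  biLipschitz : ∀ i, BiLipschitzOn (chart i) (dom i)
  isOpen_patch : ∀ i, ∃ V : Set E3, IsOpen V ∧ chart i '' dom i = V ∩ Γ
  disjoint : Pairwise fun i j => Disjoint (chart i '' dom i) (chart j '' dom j)
  cover : ⋃ i, closure (chart i '' dom i) = Γ
  null : μH[2] (Γ \ ⋃ i, chart i '' dom i) = 0

/-- The Gramian determinant `det (Jᵀ J)` of the Jacobian `J` of a map `f : ℝ² → ℝ³`. -/
def gramDet (f : E2 → E3) (u : E2) : ℝ :=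
  (Matrix.gram ℝ fun i : Fin 2 => fderiv ℝ f u (EuclideanSpace.single i 1)).det

/-- The surface measure of the image `r '' Γ` of a surface `Γ` under a map `r` that is
bi-Lipschitz on `Γ`: by definition
`∫ f ds = ∑ i, ∫ u in dom i, f (r (chart i u)) * √(gramDet (r ∘ chart i) u)`.
For `r = id` it is the surface measure of `Γ`. -/
def PatchDecomposition.surfaceMeasure {Γ : Set E3} {ι : Type*} [Fintype ι]
    (G : PatchDecomposition Γ ι) (r : E3 → E3) : Measure E3 :=
  ∑ i, Measure.map (r ∘ G.chart i)
    ((volume.restrict (G.dom i)).withDensity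
      fun u => ENNReal.ofReal √(gramDet (r ∘ G.chart i) u))

/-! ### Affine-parametric boundaries -/

/-- The norm of `C^{0,1}(Γ; ℝ³)`: supremum norm plus best Lipschitz constant. -/
def lipNorm (Γ : Set E3) (f : E3 → E3) : ℝ :=
  (⨆ x : Γ, ‖f x‖) + ⨆ q : Γ × Γ, ‖f q.1 - f q.2‖ / ‖(q.1 : E3) - q.2‖

/-- The sequence `b` of the `C^{0,1}`-norms; `φ j` stands for the `(j+1)`-st function of the
expansion. -/
def normSeq (Γ : Set E3) (φ : ℕ → E3 → E3) : ℕ → ℝ := fun j => lipNorm Γ (φ j)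

/-- The boundary transformation `r_y = φ₀ + ∑ j, y_j φ_j`. -/
def transf (φ₀ : E3 → E3) (φ : ℕ → E3 → E3) (y : ℕ → ℝ) (x : E3) : E3 :=
  φ₀ x + ∑' j, y j • φ j x

/-- The boundary transformation `r_z = φ₀ + ∑ j, z_j φ_j` for complex parameters. -/
def transfC (φ₀ : E3 → E3) (φ : ℕ → E3 → E3) (z : ℕ → ℂ) (x : E3) : C3 :=
  toC3 (φ₀ x) + ∑' j, z j • toC3 (φ j x)

/-- The standing assumptions on the affine-parametric boundary transformations. -/
structure AffineParametric (Γ : Set E3) (φ₀ : E3 → E3) (φ : ℕ → E3 → E3) (p : ℝ) : Prop where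
  lipschitz_zero : ∃ K : ℝ≥0, LipschitzOnWith K φ₀ Γ
  lipschitz : ∀ j, ∃ K : ℝ≥0, LipschitzOnWith K (φ j) Γ
  biLipschitz : ∀ y ∈ paramDomain, BiLipschitzOn (transf φ₀ φ y) Γ
  p_pos : 0 < p
  p_lt_one : p < 1
  summable : Summable fun j => normSeq Γ φ j ^ p

/-! ### Boundary integral operators -/

/-- The set `𝔘 = {ζ ∈ ℂ³ : Re (ζ · ζ) > 0}`, with the bilinear product `ζ · ζ`. It contains
`ℝ³ \ {0}`. -/
def kernelDomain : Set C3 := {ζ | 0 < (∑ i, ζ i * ζ i).re}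

/-- `A` is the integral operator `(A f)(x) = ∫ k(y, x - y) f(y) dσ(y)` on `L²(σ)`; the integral
converges absolutely for almost every `x`. -/
def IsBoundaryIntegralOperator (σ : Measure E3) (k : E3 → C3 → ℂ)
    (A : Lp ℂ 2 σ →L[ℂ] Lp ℂ 2 σ) : Prop :=
  ∀ f : Lp ℂ 2 σ, ∀ᵐ x ∂σ,
    Integrable (fun y => k y (toC3 (x - y)) * f y) σ ∧
      A f x = ∫ y, k y (toC3 (x - y)) * f y ∂σ

/-- `T` is the pullback `f ↦ f ∘ r` from `L²(σ)` to `L²(σ')`. -/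
def IsPullback (σ σ' : Measure E3) (r : E3 → E3) (T : Lp ℂ 2 σ ≃L[ℂ] Lp ℂ 2 σ') : Prop :=
  ∀ f : Lp ℂ 2 σ, T f =ᵐ[σ'] fun x => f (r x)

/-- `B = T A T⁻¹` on `L²(Γ)`, where `A` is the (bounded) boundary integral operator with kernel
`k` on `L²(r '' Γ)` and `T : L²(r '' Γ) → L²(Γ)` is the pullback isomorphism `f ↦ f ∘ r`. -/
def IsTransportedOperator {Γ : Set E3} {ι : Type*} [Fintype ι] (G : PatchDecomposition Γ ι)
    (r : E3 → E3) (k : E3 → C3 → ℂ)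
    (B : Lp ℂ 2 (G.surfaceMeasure id) →L[ℂ] Lp ℂ 2 (G.surfaceMeasure id)) : Prop :=
  ∃ (T : Lp ℂ 2 (G.surfaceMeasure r) ≃L[ℂ] Lp ℂ 2 (G.surfaceMeasure id))
    (A : Lp ℂ 2 (G.surfaceMeasure r) →L[ℂ] Lp ℂ 2 (G.surfaceMeasure r)),
    IsPullback (G.surfaceMeasure r) (G.surfaceMeasure id) r T ∧
    IsBoundaryIntegralOperator (G.surfaceMeasure r) k A ∧
    ∀ f, B f = T (A (T.symm f))

/-- The assumptions on the kernel family `a y : Γ_y × 𝔘 → ℂ`, `y ∈ 𝕌` (a kernel that does not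
depend on `y` is the special case of a constant family). For an admissible `ρ`, a patch `i`,
`z ∈ polyTube ρ`, `u ∈ dom i` and `ζ ∈ 𝔘`, the number `aC ρ i z u ζ` is the value
`a(r_z(chart i u), ζ)` of the complex extension of `y ↦ a(r_y(chart i u), ζ)`. -/
structure SingularKernelAssumption {Γ : Set E3} {ι : Type*} (G : PatchDecomposition Γ ι)
    (φ₀ : E3 → E3) (φ : ℕ → E3 → E3) (p ε : ℝ) (a : (ℕ → ℝ) → E3 → C3 → ℂ)
    (aC : (ℕ → ℝ) → ι → (ℕ → ℂ) → E2 → C3 → ℂ) : Prop where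
  /-- Measurability of the extended kernel in the boundary point. -/
  aemeasurable : ∀ ρ, Admissible (normSeq Γ φ) ε ρ → ∀ i, ∀ z ∈ polyTube ρ, ∀ ζ ∈ kernelDomain,
    AEMeasurable (fun u => aC ρ i z u ζ) (volume.restrict (G.dom i))
  /-- Parametric holomorphy in the first argument. -/
  holomorphic_param : ∀ i, ∀ u ∈ G.dom i, ∀ ζ ∈ kernelDomain,
    BPEHolomorphicWith (normSeq Γ φ) p ε
      (fun y => a y (transf φ₀ φ y (G.chart i u)) ζ) (fun ρ z => aC ρ i z u ζ)
  /-- Continuity in the parameter. -/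
  continuous_param : ∀ i, ∀ u ∈ G.dom i, ∀ ζ ∈ kernelDomain,
    ContinuousOn (fun y => a y (transf φ₀ φ y (G.chart i u)) ζ) paramDomain
  /-- Holomorphy in the second argument. -/
  holomorphic_snd : ∀ ρ, Admissible (normSeq Γ φ) ε ρ → ∀ i, ∀ z ∈ polyTube ρ, ∀ u ∈ G.dom i,
    DifferentiableOn ℂ (fun ζ => aC ρ i z u ζ) kernelDomain
  /-- The bound on the singularity, wherever the second argument lies in `𝔘`. -/
  bound : ∀ ρ, Admissible (normSeq Γ φ) ε ρ → ∃ C ν : ℝ, 0 < C ∧ 0 ≤ ν ∧ ν < 2 ∧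
    ∀ i, ∀ z ∈ polyTube ρ, ∀ u ∈ G.dom i, ∀ x ∈ Γ, x ≠ G.chart i u →
      transfC φ₀ φ z x - transfC φ₀ φ z (G.chart i u) ∈ kernelDomain →
      ‖aC ρ i z u (transfC φ₀ φ z x - transfC φ₀ φ z (G.chart i u))‖ ≤
        C / ‖transfC φ₀ φ z x - transfC φ₀ φ z (G.chart i u)‖ ^ ν

end

end ShapeHolomorphy

open ShapeHolomorphy

/-!
On the patch with chart `χ`, the transported operator has the kernel
`a (r_y (χ u)) (r_y x - r_y (χ u)) * √(gramDet (r_y ∘ χ) u)` with respect to the Lebesgue measure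
in `u`. The proof continues this kernel to complex parameters, bounds it there by one integrable
singularity, and passes to operators by the Schur test.

**The domain.** The continuation lives on `paramNbhd b η`, a neighbourhood of the real parameter
domain in which the distances of the coordinates from `[-1,1]` are measured in the `ℓ¹`-norm with
weights `b`. By compactness of the parameter domain the maps `r_y` are bi-Lipschitz with a common
constant (`AffineParametric.exists_lower_const`), so for small `η` the differences
`r_z x - r_z (χ u)` stay in the domain of the kernel and have norm at least a multiple of
`‖x - χ u‖` (`AffineParametric.transfC_sub_mem`), and the bilinear Gram determinant keeps a
positive real part (`exists_gramC_bounds`), so that its principal square root is holomorphic.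

**Several extensions.** The extensions of the kernel belong to single radii `ρ`, and separate
holomorphy in infinitely many variables, without any continuity, does not make two of them agree.
They do agree at points with only finitely many coordinates outside `[-1,1]` (`EventuallyReal`),
by the identity theorem in one variable at a time (`extension_unique`). All estimates therefore
concern such points. Cauchy estimates in the single variables show that the values at the
truncations of `z` converge, and the limit `truncLimit` is separately holomorphic on the smaller
neighbourhood `paramNbhd b (η / 2)` and equals the given kernel at real parameters
(`IsFinitelyHolomorphic.truncLimit_eq_of_real`). Continuity in the real parameters, which this
last step needs, is first known on a small cylinder only, by Baire's theorem; it spreads by the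
identity theorem.

**Composition.** The kernel is holomorphic in each `z_j` for fixed `ζ` and in `ζ` for fixed `z`, but
not known to be locally bounded in both. The holomorphy of `z_j ↦ a (r_z (χ u), r_z x - r_z (χ u))`
is Hartogs' theorem on the diagonal, `differentiableAt_diagonal`.

**Uniform constants.** The constants `C` and `ν < 2` of the singularity may depend on `ρ`. If no
choice worked on any neighbourhood of the parameter domain, there would be points violating ever
weaker bounds and lying so close to the parameter domain that one admissible radius covers all of
them, a contradiction (`exists_uniform_singular_bound`).

**Operators.** Because `ν < 2` is less than the dimension of the surface, the majorant
`C * ‖x - χ u‖ ^ (-ν)` has bounded integrals in either variable (`exists_schurWeight`), so the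
kernels define bounded operators. Pointwise the Taylor remainder of the kernel in one parameter is
at most a quadratic multiple of the majorant, and the Schur test turns this into holomorphy in the
operator norm (`SchurWeight.differentiableAt_kernelOperator`). In the same way the Lipschitz bound
of the kernel in the real parameters gives continuity. At real parameters the operator is the
transport of the boundary integral operator (`isTransportedOperator_of_kernel`), because surface
measures of bi-Lipschitz images are comparable (`exists_isPullback`) and integrate as the parameter
formula says (`integral_surfaceMeasure`).
-/

namespace ShapeHolomorphy

open Metric Filter Function

/-! ### Cauchy estimates -/

theorem norm_deriv_le_of_bound_ball {f : ℂ → ℂ} {c : ℂ} {r M : ℝ} (hr : 0 < r)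
    (hf : DifferentiableOn ℂ f (ball c r)) (hM : ∀ z ∈ ball c r, ‖f z‖ ≤ M) :
    ∀ z ∈ ball c (r / 2), ‖deriv f z‖ ≤ 4 * M / r := by
  intro z hz
  have hsub : closedBall z (r / 4) ⊆ ball c r := by
    intro x hx
    rw [mem_closedBall] at hx
    rw [mem_ball] at hz ⊢
    linarith [dist_triangle x z c]
  have h := Complex.norm_deriv_le_of_forall_mem_sphere_norm_le (c := z) (R := r / 4) (C := M)
    (f := f) (by positivity) ((hf.mono hsub).diffContOnCl_ball subset_rfl)
    (fun x hx => hM x (hsub (sphere_subset_closedBall hx)))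
  calc _ ≤ _ := h
    _ = _ := by field_simp

theorem norm_sub_le_of_bound_ball {f : ℂ → ℂ} {c : ℂ} {r M : ℝ} (hr : 0 < r)
    (hf : DifferentiableOn ℂ f (ball c r)) (hM : ∀ z ∈ ball c r, ‖f z‖ ≤ M) :
    ∀ z ∈ ball c (r / 2), ∀ w ∈ ball c (r / 2), ‖f z - f w‖ ≤ 4 * M / r * ‖z - w‖ := by
  intro z hz w hw
  refine Convex.norm_image_sub_le_of_norm_deriv_le (s := ball c (r / 2)) (fun x hx => ?_)
    (norm_deriv_le_of_bound_ball hr hf hM) (convex_ball _ _) hw hz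
  exact hf.differentiableAt (isOpen_ball.mem_nhds (ball_subset_ball (by linarith) hx))

/-- The first-order Taylor remainder of a bounded holomorphic function is quadratic, with a
constant that depends only on the bound and the radius. -/
theorem norm_taylor_remainder_le {f : ℂ → ℂ} {c : ℂ} {r M : ℝ} (hr : 0 < r)
    (hf : DifferentiableOn ℂ f (ball c r)) (hM : ∀ z ∈ ball c r, ‖f z‖ ≤ M) :
    ∀ h : ℂ, ‖h‖ < r / 4 → ‖f (c + h) - f c - h * deriv f c‖ ≤ 32 * M / r ^ 2 * ‖h‖ ^ 2 := by
  intro h hh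
  have hM0 : 0 ≤ M := (norm_nonneg _).trans (hM c (mem_ball_self hr))
  have hd : DifferentiableOn ℂ (deriv f) (ball c (r / 2)) :=
    (hf.deriv isOpen_ball).mono (ball_subset_ball (by linarith))
  have h1 := norm_sub_le_of_bound_ball (half_pos hr) hd (norm_deriv_le_of_bound_ball hr hf hM)
  have hsub : closedBall c ‖h‖ ⊆ ball c (r / 2 / 2) := closedBall_subset_ball (by linarith)
  have key := Convex.norm_image_sub_le_of_norm_hasDerivWithin_le
    (f := fun z => f z - z * deriv f c) (f' := fun z => deriv f z - deriv f c)
    (s := closedBall c ‖h‖) (C := 32 * M / r ^ 2 * ‖h‖) (x := c) (y := c + h) ?_ ?_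
    (convex_closedBall _ _) (mem_closedBall_self (norm_nonneg _)) (by simp)
  · calc _ = ‖f (c + h) - (c + h) * deriv f c - (f c - c * deriv f c)‖ := by congr 1; ring
      _ ≤ _ := key
      _ = _ := by rw [add_sub_cancel_left]; ring
  · intro x hx
    have hx' : x ∈ ball c r := ball_subset_ball (by linarith) (hsub hx)
    have := ((hf.differentiableAt (isOpen_ball.mem_nhds hx')).hasDerivAt.sub
      ((hasDerivAt_id x).mul_const (deriv f c))).hasDerivWithinAt (s := closedBall c ‖h‖)
    rw [one_mul] at this
    exact this
  · intro x hx
    refine (h1 x (hsub hx) c (mem_ball_self (by positivity))).trans ?_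
    rw [mem_closedBall, dist_eq_norm] at hx
    have : 4 * (4 * M / r) / (r / 2) = 32 * M / r ^ 2 := by field_simp; ring
    rw [this]
    gcongr

/-! ### The two-constants estimate -/

/-- The logarithm of the modulus of a holomorphic function is subharmonic. -/
theorem log_norm_le_circleAverage {f : ℂ → ℂ} {c : ℂ} {R : ℝ} (hR : 0 < R)
    (hf : AnalyticOnNhd ℂ f (closedBall c R)) (h0 : f c ≠ 0) :
    Real.log ‖f c‖ ≤ Real.circleAverage (fun z => Real.log ‖f z‖) c R := by
  have hf' : AnalyticOnNhd ℂ f (closedBall c |R|) := by rwa [abs_of_pos hR]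
  rw [hf'.circleAverage_log_norm hR.ne' h0]
  refine le_add_of_nonneg_left (finsum_nonneg fun u => ?_)
  by_cases hu : u ∈ closedBall c |R|
  · refine mul_nonneg (mod_cast MeromorphicOn.AnalyticOnNhd.divisor_nonneg hf' u) ?_
    rcases eq_or_ne u c with rfl | hne
    · simp
    · have hpos : 0 < ‖c - u‖ := norm_pos_iff.2 (sub_ne_zero.2 hne.symm)
      apply Real.log_nonneg
      rw [abs_of_pos hR, mem_closedBall, dist_comm, dist_eq_norm] at hu
      rw [← div_eq_mul_inv, le_div_iff₀ hpos]
      linarith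
  · simp [hu]

/-- If `‖f‖ ≤ A` on a circle and `‖f‖ ≤ 1` on it outside a set of angles of measure at most `η`,
then the value at the centre is at most `A ^ (η / 2π)`. -/
theorem log_norm_le_of_bound_off {f : ℂ → ℂ} {c : ℂ} {R A η : ℝ} (hR : 0 < R) (hA : 1 ≤ A)
    (hf : AnalyticOnNhd ℂ f (closedBall c R)) (h0 : f c ≠ 0)
    (hfA : ∀ z ∈ sphere c R, ‖f z‖ ≤ A) (E : Set ℝ) (hE : MeasurableSet E)
    (hη : 0 ≤ η) (hEη : volume (E ∩ Ioo (-Real.pi) Real.pi) ≤ ENNReal.ofReal η)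
    (hoff : ∀ θ, θ ∉ E → ‖f (circleMap c R θ)‖ ≤ 1) :
    Real.log ‖f c‖ ≤ η / (2 * Real.pi) * Real.log A := by
  refine (log_norm_le_circleAverage hR hf h0).trans ?_
  have hlogA := Real.log_nonneg hA
  have hper : Function.Periodic (fun θ => Real.log ‖f (circleMap c R θ)‖) (2 * Real.pi) :=
    fun θ => by simp only [periodic_circleMap c R θ]
  have hint : CircleIntegrable (fun z => Real.log ‖f z‖) c R := by
    apply MeromorphicOn.circleIntegrable_log_norm
    rw [abs_of_pos hR]
    exact (hf.mono sphere_subset_closedBall).meromorphicOn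
  have hint' : IntervalIntegrable (fun θ => Real.log ‖f (circleMap c R θ)‖) volume
      (-Real.pi) Real.pi :=
    hper.intervalIntegrable (t := 0) (by positivity) (by rw [zero_add]; exact hint) _ _
  have hshift : ∫ θ in (0 : ℝ)..2 * Real.pi, Real.log ‖f (circleMap c R θ)‖
      = ∫ θ in -Real.pi..Real.pi, Real.log ‖f (circleMap c R θ)‖ := by
    have := hper.intervalIntegral_add_eq 0 (-Real.pi)
    rw [zero_add] at this
    rw [this]
    congr 1
    ring
  rw [Real.circleAverage_def, hshift, smul_eq_mul]
  have hpi := Real.pi_pos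
  have hle : ∫ θ in -Real.pi..Real.pi, Real.log ‖f (circleMap c R θ)‖ ≤ η * Real.log A := by
    rw [intervalIntegral.integral_of_le (by linarith), integral_Ioc_eq_integral_Ioo]
    have hbound : ∀ θ, Real.log ‖f (circleMap c R θ)‖ ≤ E.indicator (fun _ => Real.log A) θ := by
      intro θ
      by_cases hθ : θ ∈ E
      · rw [indicator_of_mem hθ]
        rcases eq_or_ne (f (circleMap c R θ)) 0 with h | h
        · simpa [h] using hlogA
        · exact Real.log_le_log (norm_pos_iff.2 h) (hfA _ (circleMap_mem_sphere c hR.le θ))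
      · rw [indicator_of_notMem hθ]
        exact Real.log_nonpos (norm_nonneg _) (hoff θ hθ)
    calc _ ≤ ∫ θ in Ioo (-Real.pi) Real.pi, E.indicator (fun _ => Real.log A) θ := by
          refine setIntegral_mono ?_ ?_ hbound
          · exact (intervalIntegrable_iff_integrableOn_Ioo_of_le (by linarith)).1 hint'
          · exact (integrable_const _).indicator hE
      _ = volume.real (E ∩ Ioo (-Real.pi) Real.pi) * Real.log A := by
          rw [integral_indicator hE, Measure.restrict_restrict hE, setIntegral_const, smul_eq_mul]
      _ ≤ _ := by
          gcongr
          exact ENNReal.toReal_le_of_le_ofReal hη hEη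
  calc (2 * Real.pi)⁻¹ * ∫ θ in -Real.pi..Real.pi, Real.log ‖f (circleMap c R θ)‖
      ≤ (2 * Real.pi)⁻¹ * (η * Real.log A) := by gcongr
    _ = _ := by ring

/-- A planar set of small area meets some circle about `w`, of radius comparable to `t`, in a set
of small angular measure. -/
theorem exists_radius_small_angle {S : Set ℂ} (hS : MeasurableSet S) (w : ℂ) {t η : ℝ}
    (ht : 0 < t) (hη : 0 < η) (hvol : volume S < ENNReal.ofReal (t / 2 * (t / 2) * η)) :
    ∃ τ ∈ Ioo (t / 2) t,
      volume ({θ | circleMap w τ θ ∈ S} ∩ Ioo (-Real.pi) Real.pi) ≤ ENNReal.ofReal η := by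
  by_contra! hcon
  refine absurd hvol (not_lt.2 ?_)
  have hmS : MeasurableSet ((fun z => w + z) ⁻¹' S) := hS.preimage (measurable_const_add w)
  have hvS : volume S = volume ((fun z => w + z) ⁻¹' S) := (measure_preimage_add _ _ _).symm
  have hmeas2 : Measurable fun p : ℝ × ℝ => Complex.polarCoord.symm p := by
    have : (fun p : ℝ × ℝ => Complex.polarCoord.symm p)
        = fun p : ℝ × ℝ => (p.1 : ℂ) * (Real.cos p.2 + Real.sin p.2 * Complex.I) :=
      funext Complex.polarCoord_symm_apply
    rw [this]
    fun_prop
  rw [hvS, ← lintegral_indicator_one hmS, ← Complex.lintegral_comp_polarCoord_symm,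
    polarCoord_target, Measure.volume_eq_prod, ← Measure.prod_restrict,
    lintegral_prod _ (by
      refine Measurable.aemeasurable ?_
      refine (ENNReal.measurable_ofReal.comp measurable_fst).smul ?_
      exact (measurable_one.indicator hmS).comp hmeas2)]
  calc ENNReal.ofReal (t / 2 * (t / 2) * η)
      = ∫⁻ τ in Ioo (t / 2) t, ENNReal.ofReal (t / 2 * η) := by
        rw [setLIntegral_const, Real.volume_Ioo, ← ENNReal.ofReal_mul (by positivity)]
        congr 1; ring
    _ ≤ ∫⁻ τ in Ioo (t / 2) t, ∫⁻ θ in Ioo (-Real.pi) Real.pi, ENNReal.ofReal τ •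
          ((fun z => w + z) ⁻¹' S).indicator 1 (Complex.polarCoord.symm (τ, θ)) := by
        refine setLIntegral_mono' measurableSet_Ioo fun τ hτ => ?_
        have hset : MeasurableSet {θ | circleMap w τ θ ∈ S} :=
          hS.preimage (continuous_circleMap w τ).measurable
        have : ∀ θ : ℝ, ENNReal.ofReal τ •
            ((fun z => w + z) ⁻¹' S).indicator (1 : ℂ → ℝ≥0∞) (Complex.polarCoord.symm (τ, θ))
            = ENNReal.ofReal τ * {θ | circleMap w τ θ ∈ S}.indicator 1 θ := by
          intro θ
          rw [smul_eq_mul]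
          congr 1
          have : w + Complex.polarCoord.symm (τ, θ) = circleMap w τ θ := by
            rw [Complex.polarCoord_symm_apply, circleMap, Complex.exp_mul_I]
            simp
          by_cases hh : circleMap w τ θ ∈ S
          · rw [indicator_of_mem (by rwa [mem_preimage, this]), indicator_of_mem (show θ ∈ {θ | circleMap w τ θ ∈ S} from hh)]
            rfl
          · rw [indicator_of_notMem (by rwa [mem_preimage, this]),
              indicator_of_notMem (show θ ∉ {θ | circleMap w τ θ ∈ S} from hh)]
        simp_rw [this]
        rw [lintegral_const_mul _ (measurable_one.indicator hset), lintegral_indicator_one hset,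
          Measure.restrict_apply hset, ENNReal.ofReal_mul (by positivity)]
        gcongr
        · exact hτ.1.le
        · exact (hcon τ hτ).le
    _ ≤ _ := lintegral_mono_set fun x hx => lt_trans (by positivity) hx.1

/-- **Hartogs' lemma** for powers of holomorphic functions: geometric growth together with
pointwise boundedness implies locally uniform growth of any exponential rate `q > 1`. -/
theorem exists_uniform_bound_of_pointwise {a : ℕ → ℂ → ℂ} {w₀ : ℂ} {R A q : ℝ} (hR : 0 < R)
    (hA : 1 ≤ A) (hq : 1 < q) (ha : ∀ k, DifferentiableOn ℂ (a k) (ball w₀ R))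
    (haA : ∀ k, ∀ w ∈ ball w₀ R, ‖a k w‖ ≤ A ^ k)
    (hpt : ∀ w ∈ ball w₀ R, ∃ m : ℝ, ∀ k, ‖a k w‖ ≤ m) :
    ∃ C : ℝ, ∀ w ∈ ball w₀ (R / 3), ∀ k, ‖a k w‖ ≤ C * q ^ k := by
  set t := R / 3 with ht
  have ht0 : 0 < t := by positivity
  have hpi := Real.pi_pos
  obtain ⟨η, hη, hηA⟩ : ∃ η : ℝ, 0 < η ∧ η / (2 * Real.pi) * Real.log A ≤ Real.log q := by
    have hlq := Real.log_pos hq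
    refine ⟨Real.log q * (2 * Real.pi) / (Real.log A + 1),
      by have := Real.log_nonneg hA; positivity, ?_⟩
    have h1 := Real.log_nonneg hA
    rw [div_div, div_mul_eq_mul_div, div_le_iff₀ (by positivity)]
    nlinarith [mul_pos hlq hpi]
  -- the points at which the sequence exceeds the bound `m + 1`
  set S : ℕ → Set ℂ := fun m => ⋃ k, (ball w₀ R ∩ {w | (m : ℝ) + 1 < ‖a k w‖}) with hSdef
  have hSo : ∀ m, IsOpen (S m) := fun m => isOpen_iUnion fun k =>
    (ha k).continuousOn.norm.isOpen_inter_preimage isOpen_ball isOpen_Ioi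
  have hSsub : ∀ m, S m ⊆ ball w₀ R := fun m => iUnion_subset fun k => inter_subset_left
  have hanti : Antitone S := by
    intro m n hmn
    refine iUnion_mono fun k => inter_subset_inter_right _ fun w hw => ?_
    have : (m : ℝ) ≤ n := by exact_mod_cast hmn
    rw [mem_ofPred_eq] at hw ⊢
    linarith
  have hempty : ⋂ m, S m = ∅ := by
    rw [eq_empty_iff_forall_notMem]
    intro w hw
    rw [mem_iInter] at hw
    obtain ⟨m, hm⟩ := hpt w (hSsub 0 (hw 0))
    obtain ⟨n, hn⟩ := exists_nat_ge m
    obtain ⟨k, hk⟩ := mem_iUnion.1 (hw n)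
    have h1 : (n : ℝ) + 1 < ‖a k w‖ := hk.2
    linarith [hm k]
  have hlim : Tendsto (fun m => volume (S m)) atTop (𝓝 0) := by
    have := tendsto_measure_iInter_atTop (μ := (volume : Measure ℂ))
      (fun m => (hSo m).measurableSet.nullMeasurableSet) hanti
      ⟨0, ne_top_of_le_ne_top measure_ball_lt_top.ne (measure_mono (hSsub 0))⟩
    rw [hempty, measure_empty] at this
    exact this
  obtain ⟨m, hm⟩ := (hlim.eventually_lt_const
    (show (0 : ℝ≥0∞) < ENNReal.ofReal (t / 2 * (t / 2) * η) by
      rw [ENNReal.ofReal_pos]; positivity)).exists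
  refine ⟨m + 1, fun w hw k => ?_⟩
  obtain ⟨τ, hτ, hτS⟩ := exists_radius_small_angle (hSo m).measurableSet w ht0 hη hm
  have hτ0 : 0 < τ := lt_trans (by positivity) hτ.1
  have hm1 : (1 : ℝ) ≤ m + 1 := by linarith [Nat.cast_nonneg (α := ℝ) m]
  have hm0 : (0 : ℝ) < m + 1 := by linarith
  have hsub : closedBall w τ ⊆ ball w₀ R := by
    intro x hx
    rw [mem_closedBall] at hx
    rw [mem_ball] at hw ⊢
    have := hτ.2
    linarith [dist_triangle x w w₀]
  rcases eq_or_ne (a k w) 0 with h0 | h0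
  · rw [h0, norm_zero]; positivity
  have hnm : ∀ z, ‖a k z / ((m : ℂ) + 1)‖ = ‖a k z‖ / (m + 1) := by
    intro z
    rw [norm_div]
    congr 1
    have : ((m : ℂ) + 1) = (((m : ℝ) + 1 : ℝ) : ℂ) := by push_cast; ring
    rw [this, Complex.norm_real, Real.norm_of_nonneg hm0.le]
  have hmC : ((m : ℂ) + 1) ≠ 0 := by exact_mod_cast Nat.succ_ne_zero m
  have key := log_norm_le_of_bound_off (f := fun z => a k z / ((m : ℂ) + 1)) (c := w) (R := τ)
    (A := A ^ k) (η := η) hτ0 (one_le_pow₀ hA)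
    (((ha k).analyticOnNhd isOpen_ball).mono hsub |>.div analyticOnNhd_const
      fun _ _ => hmC)
    (div_ne_zero h0 hmC)
    (fun z hz => by
      rw [hnm, div_le_iff₀ hm0]
      have := haA k z (hsub (sphere_subset_closedBall hz))
      have hp : 0 ≤ A ^ k := by positivity
      nlinarith)
    {θ | circleMap w τ θ ∈ S m} ((hSo m).measurableSet.preimage
      (continuous_circleMap w τ).measurable) hη.le hτS
    (fun θ hθ => by
      rw [hnm, div_le_one hm0]
      by_contra! hlt
      exact hθ (mem_iUnion.2 ⟨k, hsub (sphere_subset_closedBall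
        (circleMap_mem_sphere w hτ0.le θ)), hlt⟩))
  rw [hnm, Real.log_pow] at key
  have hpos : 0 < ‖a k w‖ / (m + 1) := div_pos (norm_pos_iff.2 h0) hm0
  have h2 : Real.log (‖a k w‖ / (m + 1)) ≤ Real.log (q ^ k) := by
    rw [Real.log_pow]
    calc _ ≤ _ := key
      _ = k * (η / (2 * Real.pi) * Real.log A) := by ring
      _ ≤ _ := by gcongr
  have h3 := (Real.log_le_log_iff hpos (by positivity)).1 h2
  rw [div_le_iff₀ hm0] at h3
  linarith

/-! ### Hartogs' theorem on the diagonal -/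

theorem differentiableOn_iteratedDeriv {f : ℂ → ℂ} {U : Set ℂ} (hU : IsOpen U)
    (hf : DifferentiableOn ℂ f U) (k : ℕ) : DifferentiableOn ℂ (iteratedDeriv k f) U := by
  induction k with
  | zero => simpa [iteratedDeriv_zero] using hf
  | succ k ih => rw [iteratedDeriv_succ]; exact ih.deriv hU

/-- If `H` is separately holomorphic and bounded, then the derivatives of `H` in the second
variable are holomorphic in the first one: they are uniform limits of difference quotients. -/
theorem differentiableOn_iteratedDeriv_param {H : ℂ → ℂ → ℂ} {W S : Set ℂ} {M : ℝ}
    (hW : IsOpen W) (hS : IsOpen S) (h1 : ∀ s ∈ S, DifferentiableOn ℂ (fun w => H w s) W)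
    (h2 : ∀ w ∈ W, DifferentiableOn ℂ (H w) S) (hM : ∀ w ∈ W, ∀ s ∈ S, ‖H w s‖ ≤ M) (k : ℕ) :
    ∀ s ∈ S, DifferentiableOn ℂ (fun w => iteratedDeriv k (H w) s) W ∧
      ∃ δ > 0, ∃ M' : ℝ, ball s δ ⊆ S ∧
        ∀ w ∈ W, ∀ s' ∈ ball s δ, ‖iteratedDeriv k (H w) s'‖ ≤ M' := by
  induction k with
  | zero =>
    intro s hs
    obtain ⟨δ, hδ, hsub⟩ := Metric.isOpen_iff.1 hS s hs
    refine ⟨by simpa using h1 s hs, δ, hδ, M, hsub, fun w hw s' hs' => ?_⟩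
    simpa using hM w hw s' (hsub hs')
  | succ k ih =>
    intro s hs
    obtain ⟨hd, δ, hδ, M', hsub, hM'⟩ := ih s hs
    have hdiff : ∀ w ∈ W, DifferentiableOn ℂ (iteratedDeriv k (H w)) (ball s δ) := fun w hw =>
      (differentiableOn_iteratedDeriv hS (h2 w hw) k).mono hsub
    simp only [iteratedDeriv_succ]
    refine ⟨?_, δ / 2, half_pos hδ, 4 * M' / δ, (ball_subset_ball (by linarith)).trans hsub,
      fun w hw => norm_deriv_le_of_bound_ball hδ (hdiff w hw) (hM' w hw)⟩
    set h : ℕ → ℂ := fun n => ((δ / 8 / (n + 1) : ℝ) : ℂ) with hh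
    have hnorm : ∀ n, ‖h n‖ = δ / 8 / (n + 1) := fun n => by
      rw [hh, Complex.norm_real, Real.norm_of_nonneg (by positivity)]
    have hlt : ∀ n, ‖h n‖ < δ / 4 := fun n => by
      rw [hnorm]
      calc δ / 8 / (n + 1 : ℝ) ≤ δ / 8 := div_le_self (by positivity) (by simp)
        _ < δ / 4 := by linarith
    have hne : ∀ n, h n ≠ 0 := fun n => by rw [← norm_pos_iff, hnorm]; positivity
    have hlim : Tendsto (fun n => 32 * M' / δ ^ 2 * ‖h n‖) atTop (𝓝 0) := by
      simp_rw [hnorm]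
      have := (tendsto_const_div_atTop_nhds_zero_nat (δ / 8)).comp (tendsto_add_atTop_nat 1)
      simpa [Function.comp_def] using this.const_mul (32 * M' / δ ^ 2)
    have hunif : TendstoUniformlyOn
        (fun n w => (iteratedDeriv k (H w) (s + h n) - iteratedDeriv k (H w) s) / h n)
        (fun w => deriv (iteratedDeriv k (H w)) s) atTop W := by
      rw [Metric.tendstoUniformlyOn_iff]
      intro e he
      filter_upwards [hlim.eventually_lt_const he] with n hn w hw
      refine lt_of_le_of_lt ?_ hn
      have := norm_taylor_remainder_le hδ (hdiff w hw) (hM' w hw) (h n) (hlt n)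
      rw [dist_comm, dist_eq_norm]
      have e1 : (iteratedDeriv k (H w) (s + h n) - iteratedDeriv k (H w) s) / h n
          - deriv (iteratedDeriv k (H w)) s = (iteratedDeriv k (H w) (s + h n)
          - iteratedDeriv k (H w) s - h n * deriv (iteratedDeriv k (H w)) s) / h n := by
        field_simp [hne n]
      rw [e1, norm_div, div_le_iff₀ (norm_pos_iff.2 (hne n))]
      calc _ ≤ _ := this
        _ = _ := by ring
    refine hunif.tendstoLocallyUniformlyOn.differentiableOn (Eventually.of_forall fun n => ?_) hW
    have hmem : s + h n ∈ S := hsub (by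
      rw [mem_ball, dist_eq_norm, add_sub_cancel_left]
      linarith [hlt n])
    exact ((ih _ hmem).1.sub hd).div_const _

/-- A separately continuous function is bounded on the product of a compact set with some small
disc, by Baire's theorem. -/
theorem exists_ball_bounded {H : ℂ → ℂ → ℂ} {K : Set ℂ} {w₀ : ℂ} {r : ℝ} (hr : 0 < r)
    (hK : IsCompact K) (h1 : ∀ s ∈ ball w₀ r, ContinuousOn (fun w => H w s) K)
    (h2 : ∀ w ∈ K, ContinuousOn (H w) (ball w₀ r)) :
    ∃ s₁ ∈ ball w₀ r, ∃ r₁ > 0, ∃ M : ℝ, ball s₁ r₁ ⊆ ball w₀ r ∧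
      ∀ w ∈ K, ∀ s ∈ ball s₁ r₁, ‖H w s‖ ≤ M := by
  set f : ℕ → Set ℂ := fun m => {s | s ∈ ball w₀ r → ∀ w ∈ K, ‖H w s‖ ≤ m} with hf
  have hclosed : ∀ m, IsClosed (f m) := by
    intro m
    rw [← isOpen_compl_iff]
    have : (f m)ᶜ = ⋃ w ∈ K, (ball w₀ r ∩ {s | (m : ℝ) < ‖H w s‖}) := by
      ext s
      simp only [hf, mem_compl_iff, mem_ofPred_eq, mem_iUnion, mem_inter_iff, exists_prop]
      push Not
      constructor
      · rintro ⟨a, w, hw, h⟩; exact ⟨w, hw, a, h⟩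
      · rintro ⟨w, hw, a, h⟩; exact ⟨a, w, hw, h⟩
    rw [this]
    exact isOpen_biUnion fun w hw =>
      (h2 w hw).norm.isOpen_inter_preimage isOpen_ball isOpen_Ioi
  have hunion : ⋃ m, f m = univ := by
    refine eq_univ_of_forall fun s => ?_
    by_cases hs : s ∈ ball w₀ r
    · obtain ⟨C, hC⟩ := hK.exists_bound_of_continuousOn (h1 s hs)
      obtain ⟨m, hm⟩ := exists_nat_ge C
      exact mem_iUnion.2 ⟨m, fun _ w hw => (hC w hw).trans hm⟩
    · exact mem_iUnion.2 ⟨0, fun h => absurd h hs⟩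
  obtain ⟨s₁, hs₁, hs₁'⟩ := (dense_iUnion_interior_of_closed hclosed hunion).inter_open_nonempty
    (ball w₀ r) isOpen_ball ⟨w₀, mem_ball_self hr⟩
  obtain ⟨m, hm⟩ := mem_iUnion.1 hs₁'
  obtain ⟨r₁, hr₁, hsub⟩ := Metric.isOpen_iff.1 (isOpen_ball.inter isOpen_interior) s₁ ⟨hs₁, hm⟩
  exact ⟨s₁, hs₁, r₁, hr₁, m, fun s hs => (hsub hs).1,
    fun w hw s hs => interior_subset (hsub hs).2 (hsub hs).1 w hw⟩

/-- **Hartogs' theorem**, restricted to the diagonal: no continuity or boundedness of the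
separately holomorphic function `H` is assumed. -/
theorem differentiableAt_diagonal {H : ℂ → ℂ → ℂ} {w₀ : ℂ} {r : ℝ} (hr : 0 < r)
    (h1 : ∀ s ∈ ball w₀ r, DifferentiableOn ℂ (fun w => H w s) (ball w₀ r))
    (h2 : ∀ w ∈ ball w₀ r, DifferentiableOn ℂ (H w) (ball w₀ r)) :
    DifferentiableAt ℂ (fun w => H w w) w₀ := by
  have hK : closedBall w₀ (r / 2) ⊆ ball w₀ r := closedBall_subset_ball (by linarith)
  have h8 : ball w₀ (r / 8) ⊆ ball w₀ r := ball_subset_ball (by linarith)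
  -- `H` is bounded for second arguments in some small ball near `w₀`; this gives the crude bound of
  -- the Taylor coefficients at its centre `s₁` that Hartogs' lemma improves
  obtain ⟨s₁, hs₁, r₁, hr₁, M, hsub, hM⟩ := exists_ball_bounded (H := H) (w₀ := w₀) (r := r / 8)
    (by positivity) (isCompact_closedBall w₀ (r / 2))
    (fun s hs => ((h1 s (h8 hs)).mono hK).continuousOn)
    (fun w hw => ((h2 w (hK hw)).mono h8).continuousOn)
  have hW : ball w₀ (r / 2) ⊆ closedBall w₀ (r / 2) := ball_subset_closedBall
  set ρ := r / 2 with hρ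
  have hρ0 : 0 < ρ := by positivity
  have hs₁' : closedBall s₁ ρ ⊆ ball w₀ r := by
    intro x hx
    rw [mem_closedBall] at hx
    rw [mem_ball] at hs₁ ⊢
    linarith [dist_triangle x s₁ w₀]
  have hr₁ρ : r₁ / 2 ≤ ρ := by
    by_contra! hlt
    have hx : s₁ + (r₁ / 2 : ℝ) ∈ ball w₀ (r / 8) := hsub (by
      rw [mem_ball, dist_eq_norm, add_sub_cancel_left, Complex.norm_real,
        Real.norm_of_nonneg (by positivity)]
      linarith)
    rw [mem_ball] at hx hs₁
    have h3 : dist (s₁ + (r₁ / 2 : ℝ)) s₁ = r₁ / 2 := by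
      rw [dist_eq_norm, add_sub_cancel_left, Complex.norm_real,
        Real.norm_of_nonneg (by positivity)]
    linarith [dist_triangle_right (s₁ + ((r₁ / 2 : ℝ) : ℂ)) s₁ w₀]
  set M₀ := max M 1 with hM₀
  have hM₀pos : 0 < M₀ := lt_of_lt_of_le one_pos (le_max_right _ _)
  set A := ρ / (r₁ / 2) with hA
  have hA1 : 1 ≤ A := (one_le_div (by positivity)).2 hr₁ρ
  -- the normalized Taylor coefficients in the second variable
  set β : ℕ → ℂ → ℂ := fun k w =>
    iteratedDeriv k (H w) s₁ * (((k.factorial : ℝ)⁻¹ * ρ ^ k / M₀ : ℝ) : ℂ) with hβ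
  have hβnorm : ∀ k w, ‖β k w‖ = ‖iteratedDeriv k (H w) s₁‖ * ((k.factorial : ℝ)⁻¹ * ρ ^ k / M₀) := by
    intro k w
    rw [hβ, norm_mul, Complex.norm_real, Real.norm_of_nonneg (by positivity)]
  have hcauchy : ∀ w ∈ ball w₀ r, ∀ R C : ℝ, 0 < R → closedBall s₁ R ⊆ ball w₀ r →
      (∀ z ∈ sphere s₁ R, ‖H w z‖ ≤ C) → ∀ k, ‖β k w‖ ≤ C / M₀ * (ρ / R) ^ k := by
    intro w hw R C hR hRsub hC k
    rw [hβnorm]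
    have := Complex.norm_iteratedDeriv_le_of_forall_mem_sphere_norm_le k hR
      (((h2 w hw).mono hRsub).diffContOnCl_ball subset_rfl) hC
    calc _ ≤ (k.factorial * C / R ^ k) * ((k.factorial : ℝ)⁻¹ * ρ ^ k / M₀) := by gcongr
      _ = _ := by
        have : (k.factorial : ℝ) ≠ 0 := by positivity
        rw [div_pow ρ R]
        field_simp
  obtain ⟨C, hC⟩ := exists_uniform_bound_of_pointwise (a := β) (w₀ := w₀) (R := ρ) (A := A)
    (q := 3 / 2) hρ0 hA1 (by norm_num)
    (fun k => ((differentiableOn_iteratedDeriv_param (S := ball s₁ r₁) isOpen_ball isOpen_ball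
      (fun s hs => (h1 s (h8 (hsub hs))).mono (hW.trans hK))
      (fun w hw => (h2 w (hK (hW hw))).mono (hsub.trans h8))
      (fun w hw s hs => hM w (hW hw) s hs) k) s₁ (mem_ball_self hr₁)).1.mul_const _)
    (fun k w hw => by
      have hle := hcauchy w (hK (hW hw)) (r₁ / 2) M₀ (by positivity)
        ((closedBall_subset_ball (by linarith)).trans (hsub.trans h8))
        (fun z hz => (hM w (hW hw) z (by
          rw [mem_sphere] at hz; rw [mem_ball]; linarith)).trans (le_max_left _ _)) k
      rwa [div_self hM₀pos.ne', one_mul] at hle)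
    (fun w hw => by
      obtain ⟨Cw, hCw⟩ := (isCompact_sphere s₁ ρ).exists_bound_of_continuousOn
        (((h2 w (hK (hW hw))).mono (sphere_subset_closedBall.trans hs₁')).continuousOn)
      refine ⟨Cw / M₀, fun k => ?_⟩
      have hle := hcauchy w (hK (hW hw)) ρ Cw hρ0 hs₁' hCw k
      rwa [div_self hρ0.ne', one_pow, mul_one] at hle)
  -- the coefficients grow at most like `(3 / 2) ^ k`, and `w` lies within `ρ / 2` of the centre `s₁`
  have hsum : Summable fun k : ℕ => M₀ * C * (3 / 4 : ℝ) ^ k :=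
    (summable_geometric_of_lt_one (by norm_num) (by norm_num)).mul_left _
  have hsm : ball w₀ (r / 8) ⊆ ball w₀ (ρ / 3) := ball_subset_ball (by linarith)
  have hwdist : ∀ w ∈ ball w₀ (r / 8), ‖w - s₁‖ < ρ / 2 := by
    intro w hw
    rw [← dist_eq_norm]
    rw [mem_ball] at hw hs₁
    linarith [dist_triangle_right w s₁ w₀]
  have hdiff := Complex.differentiableOn_tsum_of_summable_norm
    (F := fun k w => β k w * ((M₀ : ℂ) * ((w - s₁) / (ρ : ℂ)) ^ k)) (U := ball w₀ (r / 8)) hsum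
    (fun k => by
      refine DifferentiableOn.mul ?_ (by fun_prop)
      exact (((differentiableOn_iteratedDeriv_param (S := ball s₁ r₁) isOpen_ball isOpen_ball
        (fun s hs => (h1 s (h8 (hsub hs))).mono (hW.trans hK))
        (fun w hw => (h2 w (hK (hW hw))).mono (hsub.trans h8))
        (fun w hw s hs => hM w (hW hw) s hs) k) s₁ (mem_ball_self hr₁)).1.mul_const _).mono
          (ball_subset_ball (by linarith)))
    isOpen_ball
    (fun k w hw => by
      have h3 := hC w (hsm hw) k
      have h5 : ‖(M₀ : ℂ) * ((w - s₁) / (ρ : ℂ)) ^ k‖ = M₀ * (‖w - s₁‖ / ρ) ^ k := by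
        rw [norm_mul, norm_pow, norm_div, Complex.norm_real, Complex.norm_real,
          Real.norm_of_nonneg hM₀pos.le, Real.norm_of_nonneg hρ0.le]
      refine (norm_mul_le (β k w) _).trans ?_
      rw [h5]
      have h4 : ‖w - s₁‖ / ρ ≤ 1 / 2 := by
        rw [div_le_iff₀ hρ0]; linarith [hwdist w hw]
      have hC0 : 0 ≤ C * (3 / 2) ^ k := (norm_nonneg _).trans h3
      calc _ ≤ C * (3 / 2) ^ k * (M₀ * (1 / 2) ^ k) := by gcongr
        _ = M₀ * C * ((3 / 2) ^ k * (1 / 2) ^ k) := by ring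
        _ = _ := by rw [← mul_pow]; norm_num)
  have hmem : w₀ ∈ ball w₀ (r / 8) := mem_ball_self (by positivity)
  refine ((hdiff.congr fun w hw => ?_).differentiableAt (isOpen_ball.mem_nhds hmem))
  have hw' : w ∈ ball w₀ r := h8 hw
  have hts := Complex.hasSum_taylorSeries_on_ball (f := H w) (c := s₁) (r := ρ)
    ((h2 w hw').mono (ball_subset_closedBall.trans hs₁')) (z := w) (by
      rw [mem_ball, dist_eq_norm]; linarith [hwdist w hw])
  rw [← hts.tsum_eq]
  refine tsum_congr fun k => ?_
  have e1 : (M₀ : ℂ) ≠ 0 := by exact_mod_cast hM₀pos.ne'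
  have e2 : (ρ : ℂ) ≠ 0 := by exact_mod_cast hρ0.ne'
  have e3 : (k.factorial : ℂ) ≠ 0 := by exact_mod_cast k.factorial_ne_zero
  simp only [hβ, smul_eq_mul]
  push_cast
  rw [div_pow]
  field_simp

/-! ### Neighbourhoods of the parameter domain -/

/-- The interval `[-1,1]` as a subset of the complex plane. -/
def unitSegment : Set ℂ := (fun t : ℝ => (t : ℂ)) '' Icc (-1 : ℝ) 1

/-- The `b`-weighted `ℓ¹` neighbourhood of radius `η` of the parameter domain. It contains every
`polyTube ρ` for which `ρ` is `(b, ε)`-admissible with `ε < η`. -/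
def paramNbhd (b : ℕ → ℝ) (η : ℝ) : Set (ℕ → ℂ) :=
  {z | Summable (fun j => infDist (z j) unitSegment * b j) ∧
    ∑' j, infDist (z j) unitSegment * b j < η}

/-- All but finitely many coordinates of `z` lie in the real interval `[-1,1]`. On such parameters
separately holomorphic extensions from the parameter domain are unique. -/
def EventuallyReal (z : ℕ → ℂ) : Prop := ∃ n, ∀ j, n ≤ j → z j ∈ unitSegment

theorem zero_mem_unitSegment : (0 : ℂ) ∈ unitSegment := ⟨0, by norm_num, by simp⟩

theorem unitSegment_nonempty : unitSegment.Nonempty := ⟨0, zero_mem_unitSegment⟩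

theorem isCompact_unitSegment : IsCompact unitSegment :=
  isCompact_Icc.image Complex.continuous_ofReal

theorem convex_unitSegment : Convex ℝ unitSegment :=
  (convex_Icc (-1 : ℝ) 1).linear_image Complex.ofRealCLM.toLinearMap

theorem norm_le_of_mem_unitSegment {w : ℂ} (hw : w ∈ unitSegment) : ‖w‖ ≤ 1 := by
  obtain ⟨t, ht, rfl⟩ := hw
  rw [Complex.norm_real, Real.norm_eq_abs, abs_le]
  exact ht

theorem norm_le_one_add_infDist (w : ℂ) : ‖w‖ ≤ 1 + infDist w unitSegment := by
  obtain ⟨t, ht, h⟩ := isCompact_unitSegment.exists_infDist_eq_dist unitSegment_nonempty w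
  rw [h, dist_eq_norm]
  have := norm_le_of_mem_unitSegment ht
  calc ‖w‖ = ‖t + (w - t)‖ := by congr 1; ring
    _ ≤ ‖t‖ + ‖w - t‖ := norm_add_le _ _
    _ ≤ _ := by gcongr

theorem mem_tube_iff {s : ℝ} {w : ℂ} : w ∈ tube s ↔ infDist w unitSegment ≤ s - 1 := Iff.rfl

theorem toComplexParam_mem_unitSegment {y : ℕ → ℝ} (hy : y ∈ paramDomain) (j : ℕ) :
    toComplexParam y j ∈ unitSegment := ⟨y j, hy j, rfl⟩

theorem eventuallyReal_toComplexParam {y : ℕ → ℝ} (hy : y ∈ paramDomain) :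
    EventuallyReal (toComplexParam y) := ⟨0, fun j _ => toComplexParam_mem_unitSegment hy j⟩

theorem EventuallyReal.update {z : ℕ → ℂ} (hz : EventuallyReal z) (j : ℕ) (w : ℂ) :
    EventuallyReal (update z j w) := by
  obtain ⟨n, hn⟩ := hz
  refine ⟨max n (j + 1), fun k hk => ?_⟩
  rw [update_of_ne (by have := le_of_max_le_right hk; omega)]
  exact hn k (le_of_max_le_left hk)

theorem toComplexParam_update (y : ℕ → ℝ) (j : ℕ) (t : ℝ) :
    toComplexParam (update y j t) = update (toComplexParam y) j (t : ℂ) := by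
  funext k
  rcases eq_or_ne k j with rfl | h
  · simp [toComplexParam]
  · simp [toComplexParam, h]

theorem update_mem_paramDomain {y : ℕ → ℝ} (hy : y ∈ paramDomain) (j : ℕ) {t : ℝ}
    (ht : t ∈ Icc (-1 : ℝ) 1) : update y j t ∈ paramDomain := by
  intro k
  rcases eq_or_ne k j with rfl | h
  · simpa using ht
  · simpa [h] using hy k

theorem mem_paramNbhd_of_real {b : ℕ → ℝ} {η : ℝ} (hη : 0 < η) {z : ℕ → ℂ}
    (hz : ∀ j, z j ∈ unitSegment) : z ∈ paramNbhd b η := by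
  have : (fun j => infDist (z j) unitSegment * b j) = fun _ => 0 := by
    funext j; rw [infDist_zero_of_mem (hz j), zero_mul]
  refine ⟨by rw [this]; exact summable_zero, by rw [this]; simpa⟩

theorem paramNbhd_mono {b : ℕ → ℝ} {η η' : ℝ} (h : η ≤ η') : paramNbhd b η ⊆ paramNbhd b η' :=
  fun _ hz => ⟨hz.1, hz.2.trans_le h⟩

theorem mem_paramNbhd_of_le {b : ℕ → ℝ} (hb : ∀ j, 0 < b j) {η : ℝ} {z z' : ℕ → ℂ}
    (hz : z ∈ paramNbhd b η)
    (h : ∀ j, infDist (z' j) unitSegment ≤ infDist (z j) unitSegment) : z' ∈ paramNbhd b η := by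
  have hle : ∀ j, infDist (z' j) unitSegment * b j ≤ infDist (z j) unitSegment * b j :=
    fun j => mul_le_mul_of_nonneg_right (h j) (hb j).le
  have hs := Summable.of_nonneg_of_le (fun j => mul_nonneg infDist_nonneg (hb j).le) hle hz.1
  exact ⟨hs, (hs.tsum_le_tsum hle hz.1).trans_lt hz.2⟩

/-- The slice of `paramNbhd b η` in one coordinate direction is an open neighbourhood of `[-1,1]`
of constant width. -/
theorem exists_thickening_slice {b : ℕ → ℝ} (hb : ∀ j, 0 < b j) {η : ℝ} {z : ℕ → ℂ}
    (hz : z ∈ paramNbhd b η) (j : ℕ) :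
    ∃ δ > 0, {w | update z j w ∈ paramNbhd b η} = thickening δ unitSegment := by
  set S := ∑' j, infDist (z j) unitSegment * b j with hS
  have hterm : infDist (z j) unitSegment * b j ≤ S :=
    hz.1.le_tsum j fun k _ => mul_nonneg infDist_nonneg (hb k).le
  have hpos : 0 < η - S + infDist (z j) unitSegment * b j := by
    have := hz.2
    have h0 : 0 ≤ infDist (z j) unitSegment * b j := mul_nonneg infDist_nonneg (hb j).le
    linarith
  refine ⟨(η - S + infDist (z j) unitSegment * b j) / b j, div_pos hpos (hb j), ?_⟩
  ext w
  rw [mem_thickening_iff_infDist_lt unitSegment_nonempty, lt_div_iff₀ (hb j)]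
  have hup : (fun k => infDist (update z j w k) unitSegment * b k)
      = update (fun k => infDist (z k) unitSegment * b k) j (infDist w unitSegment * b j) := by
    funext k
    rcases eq_or_ne k j with rfl | h
    · simp
    · simp [h]
  have hsum := hz.1.hasSum.update j (infDist w unitSegment * b j)
  rw [← hup] at hsum
  constructor
  · intro h
    have h2 := h.2
    rw [hsum.tsum_eq] at h2
    linarith
  · intro h
    refine ⟨hsum.summable, ?_⟩
    rw [hsum.tsum_eq]
    linarith

theorem isOpen_slice {b : ℕ → ℝ} (hb : ∀ j, 0 < b j) {η : ℝ} {z : ℕ → ℂ}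
    (hz : z ∈ paramNbhd b η) (j : ℕ) : IsOpen {w | update z j w ∈ paramNbhd b η} := by
  obtain ⟨δ, _, h⟩ := exists_thickening_slice hb hz j
  rw [h]; exact isOpen_thickening

theorem convex_slice {b : ℕ → ℝ} (hb : ∀ j, 0 < b j) {η : ℝ} {z : ℕ → ℂ}
    (hz : z ∈ paramNbhd b η) (j : ℕ) : Convex ℝ {w | update z j w ∈ paramNbhd b η} := by
  obtain ⟨δ, _, h⟩ := exists_thickening_slice hb hz j
  rw [h]; exact convex_unitSegment.thickening δ

theorem unitSegment_subset_slice {b : ℕ → ℝ} (hb : ∀ j, 0 < b j) {η : ℝ} {z : ℕ → ℂ}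
    (hz : z ∈ paramNbhd b η) (j : ℕ) : unitSegment ⊆ {w | update z j w ∈ paramNbhd b η} := by
  obtain ⟨δ, hδ, h⟩ := exists_thickening_slice hb hz j
  rw [h]; exact self_subset_thickening hδ _

theorem update_mem_paramNbhd {b : ℕ → ℝ} (hb : ∀ j, 0 < b j) {η θ : ℝ} {z : ℕ → ℂ}
    (hz : z ∈ paramNbhd b η) (j : ℕ) {w : ℂ} (hw : ‖w - z j‖ * b j ≤ θ) :
    update z j w ∈ paramNbhd b (η + θ) := by
  have hup : (fun k => infDist (update z j w k) unitSegment * b k)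
      = update (fun k => infDist (z k) unitSegment * b k) j (infDist w unitSegment * b j) := by
    funext k
    rcases eq_or_ne k j with rfl | h
    · simp
    · simp [h]
  have hsum := hz.1.hasSum.update j (infDist w unitSegment * b j)
  rw [← hup] at hsum
  refine ⟨hsum.summable, ?_⟩
  rw [hsum.tsum_eq]
  have h1 : infDist w unitSegment ≤ infDist (z j) unitSegment + ‖w - z j‖ := by
    rw [← dist_eq_norm]; exact infDist_le_infDist_add_dist
  have h2 := mul_le_mul_of_nonneg_right h1 (hb j).le
  have := hz.2
  rw [add_mul] at h2
  linarith

/-- A holomorphic function on a connected neighbourhood of `[-1,1]` that vanishes on a piece of this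
interval vanishes identically. -/
theorem eqOn_of_eq_on_segment {U : Set ℂ} (hU : IsOpen U) (hc : IsPreconnected U)
    (hsub : unitSegment ⊆ U) {f : ℂ → ℂ} (hf : DifferentiableOn ℂ f U) {c δ : ℝ}
    (hcm : c ∈ Icc (-1 : ℝ) 1) (hδ : 0 < δ)
    (h0 : ∀ t ∈ Icc (-1 : ℝ) 1, |t - c| < δ → f t = 0) : ∀ w ∈ U, f w = 0 := by
  have hfr : ∃ᶠ z in 𝓝[≠] (c : ℂ), f z = 0 := by
    have hr : ∃ᶠ t in 𝓝[≠] c, t ∈ Icc (-1 : ℝ) 1 ∧ |t - c| < δ := by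
      rw [frequently_nhdsWithin_iff, Metric.nhds_basis_ball.frequently_iff]
      intro r hr
      rcases lt_or_ge c 0 with h | h
      · refine ⟨c + min (min (r / 2) (δ / 2)) 1, ?_, ⟨⟨?_, ?_⟩, ?_⟩, ?_⟩
        · rw [mem_ball, Real.dist_eq, add_sub_cancel_left, abs_of_pos (by positivity)]
          exact lt_of_le_of_lt ((min_le_left _ _).trans (min_le_left _ _)) (by linarith)
        · have : 0 < min (min (r / 2) (δ / 2)) 1 := by positivity
          linarith [hcm.1]
        · have : min (min (r / 2) (δ / 2)) 1 ≤ 1 := min_le_right _ _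
          linarith
        · rw [add_sub_cancel_left, abs_of_pos (by positivity)]
          exact lt_of_le_of_lt ((min_le_left _ _).trans (min_le_right _ _)) (by linarith)
        · have : 0 < min (min (r / 2) (δ / 2)) 1 := by positivity
          simp only [mem_compl_iff, mem_singleton_iff]
          linarith
      · refine ⟨c - min (min (r / 2) (δ / 2)) 1, ?_, ⟨⟨?_, ?_⟩, ?_⟩, ?_⟩
        · rw [mem_ball, Real.dist_eq, sub_sub_cancel_left, abs_neg, abs_of_pos (by positivity)]
          exact lt_of_le_of_lt ((min_le_left _ _).trans (min_le_left _ _)) (by linarith)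
        · have : min (min (r / 2) (δ / 2)) 1 ≤ 1 := min_le_right _ _
          linarith
        · have : 0 < min (min (r / 2) (δ / 2)) 1 := by positivity
          linarith [hcm.2]
        · rw [sub_sub_cancel_left, abs_neg, abs_of_pos (by positivity)]
          exact lt_of_le_of_lt ((min_le_left _ _).trans (min_le_right _ _)) (by linarith)
        · have : 0 < min (min (r / 2) (δ / 2)) 1 := by positivity
          simp only [mem_compl_iff, mem_singleton_iff]
          linarith
    have ht : Tendsto (fun t : ℝ => (t : ℂ)) (𝓝[≠] c) (𝓝[≠] (c : ℂ)) := by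
      refine tendsto_nhdsWithin_of_tendsto_nhds_of_eventually_within _
        (Complex.continuous_ofReal.continuousAt.tendsto.mono_left nhdsWithin_le_nhds) ?_
      filter_upwards [self_mem_nhdsWithin] with t ht h
      exact ht (by simpa using h)
    exact ht.frequently (hr.mono fun t ht => h0 t ht.1 ht.2)
  exact (hf.analyticOnNhd hU).eqOn_zero_of_preconnected_of_frequently_eq_zero hc
    (hsub ⟨c, hcm, rfl⟩) hfr

theorem thickening_subset_tube {s : ℝ} : thickening (s - 1) unitSegment ⊆ tube s := by
  intro w hw
  rw [mem_thickening_iff_infDist_lt unitSegment_nonempty] at hw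
  exact hw.le

/-- Separately holomorphic extensions of a function on the parameter domain agree wherever only
finitely many coordinates have left `[-1,1]`. -/
theorem extension_unique {ρ ρ' : ℕ → ℝ} {u : (ℕ → ℝ) → ℂ} {F F' : (ℕ → ℂ) → ℂ}
    (hρ : ∀ j, 1 < ρ j) (hρ' : ∀ j, 1 < ρ' j)
    (hF : IsHolomorphicExtension ρ u F) (hF' : IsHolomorphicExtension ρ' u F')
    {z : ℕ → ℂ} (hr : EventuallyReal z) (hz : ∀ j, infDist (z j) unitSegment < ρ j - 1)
    (hz' : ∀ j, infDist (z j) unitSegment < ρ' j - 1) : F z = F' z := by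
  obtain ⟨n, hn⟩ := hr
  induction n generalizing z with
  | zero =>
    choose y hy hyz using fun j => hn j (Nat.zero_le j)
    have : z = toComplexParam y := funext fun j => (hyz j).symm
    rw [this, hF.1 y hy, hF'.1 y hy]
  | succ n ih =>
    set δ := min (ρ n) (ρ' n) - 1 with hδ
    have hδ0 : 0 < δ := by have := lt_min (hρ n) (hρ' n); linarith
    have hmem : ∀ {σ : ℕ → ℝ}, (∀ j, infDist (z j) unitSegment < σ j - 1) → z ∈ polyTube σ :=
      fun h j => (h j).le
    have hsub1 : thickening δ unitSegment ⊆ tube (ρ n) :=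
      (thickening_mono (by rw [hδ]; linarith [min_le_left (ρ n) (ρ' n)]) _).trans
        thickening_subset_tube
    have hsub2 : thickening δ unitSegment ⊆ tube (ρ' n) :=
      (thickening_mono (by rw [hδ]; linarith [min_le_right (ρ n) (ρ' n)]) _).trans
        thickening_subset_tube
    have key := eqOn_of_eq_on_segment (U := thickening δ unitSegment)
      (f := fun w => F (update z n w) - F' (update z n w)) isOpen_thickening
      (convex_unitSegment.thickening δ).isPreconnected (self_subset_thickening hδ0 _)
      (((hF.2 z (hmem hz) n).mono hsub1).sub ((hF'.2 z (hmem hz') n).mono hsub2))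
      (c := 0) (δ := 2) (by norm_num) two_pos
      (fun t ht _ => by
        rw [sub_eq_zero]
        have hu : ∀ {σ : ℕ → ℝ}, (∀ j, 1 < σ j) → (∀ j, infDist (z j) unitSegment < σ j - 1) →
            ∀ j, infDist (update z n (t : ℂ) j) unitSegment < σ j - 1 := by
          intro σ hσ h j
          rcases eq_or_ne j n with rfl | hj
          · rw [update_self, infDist_zero_of_mem (show (t : ℂ) ∈ unitSegment from ⟨t, ht, rfl⟩)]; linarith [hσ j]
          · rw [update_of_ne hj]; exact h j
        refine ih (hu hρ hz) (hu hρ' hz') fun j hj => ?_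
        rcases eq_or_ne j n with rfl | hj'
        · rw [update_self]; exact ⟨t, ht, rfl⟩
        · rw [update_of_ne hj']; exact hn j (by omega))
    have h := key (z n) (by
      rw [mem_thickening_iff_infDist_lt unitSegment_nonempty, hδ]
      have := lt_min (show infDist (z n) unitSegment + 1 < ρ n by linarith [hz n])
        (show infDist (z n) unitSegment + 1 < ρ' n by linarith [hz' n])
      linarith)
    simp only [update_eq_self] at h
    exact sub_eq_zero.1 h

/-! ### Separately holomorphic functions of infinitely many variables -/

/-- `κ` is bounded by `M` and separately holomorphic on those points of `paramNbhd b η` that have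
only finitely many coordinates off `[-1,1]`, and it is continuous on some nonempty relatively open
cylinder of the real parameter domain. -/
structure IsFinitelyHolomorphic (b : ℕ → ℝ) (η M : ℝ) (κ : (ℕ → ℂ) → ℂ) : Prop where
  bound : ∀ z ∈ paramNbhd b η, EventuallyReal z → ‖κ z‖ ≤ M
  differentiableAt : ∀ z ∈ paramNbhd b η, EventuallyReal z → ∀ j,
    DifferentiableAt ℂ (fun w => κ (update z j w)) (z j)
  continuous : ∃ c ∈ paramDomain, ∃ n : ℕ, ∃ δ > 0, ∀ y ∈ paramDomain,
    (∀ j < n, |y j - c j| < δ) →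
      ContinuousWithinAt (fun y => κ (toComplexParam y)) paramDomain y

/-- The point `z` with the coordinates from the `N`-th one on replaced by zero. -/
def truncate (N : ℕ) (z : ℕ → ℂ) : ℕ → ℂ := fun j => if j < N then z j else 0

/-- The limit of the values of `κ` at the truncations of `z`. -/
noncomputable def truncLimit (κ : (ℕ → ℂ) → ℂ) (z : ℕ → ℂ) : ℂ :=
  limUnder atTop fun N => κ (truncate N z)

theorem eventuallyReal_truncate (N : ℕ) (z : ℕ → ℂ) : EventuallyReal (truncate N z) :=
  ⟨N, fun j hj => by rw [truncate, if_neg (by omega)]; exact zero_mem_unitSegment⟩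

theorem truncate_succ (N : ℕ) (z : ℕ → ℂ) : truncate (N + 1) z = update (truncate N z) N (z N) := by
  funext j
  rcases eq_or_ne j N with rfl | h
  · simp [truncate]
  · rw [update_of_ne h, truncate, truncate]
    have : j < N + 1 ↔ j < N := by omega
    simp [this]

theorem update_truncate_zero (N : ℕ) (z : ℕ → ℂ) : update (truncate N z) N 0 = truncate N z := by
  rw [update_eq_self_iff, truncate, if_neg (lt_irrefl N)]

theorem truncate_update {N j : ℕ} (h : j < N) (z : ℕ → ℂ) (w : ℂ) :
    truncate N (update z j w) = update (truncate N z) j w := by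
  funext k
  rcases eq_or_ne k j with rfl | hk
  · simp [truncate, h]
  · simp [truncate, hk]

section

variable {b : ℕ → ℝ}

theorem truncate_mem_paramNbhd (hb : ∀ j, 0 < b j) {η : ℝ} {z : ℕ → ℂ} (hz : z ∈ paramNbhd b η)
    (N : ℕ) : truncate N z ∈ paramNbhd b η := by
  refine mem_paramNbhd_of_le hb hz fun j => ?_
  unfold truncate
  split_ifs
  · exact le_rfl
  · rw [infDist_zero_of_mem zero_mem_unitSegment]; exact infDist_nonneg

theorem summable_norm_mul (hbs : Summable b) (hb : ∀ j, 0 < b j) {η : ℝ} {z : ℕ → ℂ}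
    (hz : z ∈ paramNbhd b η) : Summable fun j => ‖z j‖ * b j := by
  refine Summable.of_nonneg_of_le (fun j => mul_nonneg (norm_nonneg _) (hb j).le) (fun j => ?_)
    (hbs.add hz.1)
  calc ‖z j‖ * b j ≤ (1 + infDist (z j) unitSegment) * b j :=
        mul_le_mul_of_nonneg_right (norm_le_one_add_infDist _) (hb j).le
    _ = _ := by ring

variable {η M : ℝ} {κ : (ℕ → ℂ) → ℂ}

/-- The discs of radius `θ / b j` in the `j`-th coordinate, around the points of
`paramNbhd b η`, stay in `paramNbhd b (η + θ)`. -/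
theorem update_mem_of_ball (hb : ∀ j, 0 < b j) {θ : ℝ} {z : ℕ → ℂ} (hz : z ∈ paramNbhd b η)
    (j : ℕ) {w : ℂ} (hw : w ∈ ball (z j) (θ / b j)) : update z j w ∈ paramNbhd b (η + θ) := by
  rw [mem_ball, dist_eq_norm, lt_div_iff₀ (hb j)] at hw
  exact update_mem_paramNbhd hb hz j hw.le

namespace IsFinitelyHolomorphic

theorem differentiableOn_slice (hκ : IsFinitelyHolomorphic b η M κ) {z : ℕ → ℂ}
    (hr : EventuallyReal z) (j : ℕ) :
    DifferentiableOn ℂ (fun w => κ (update z j w)) {w | update z j w ∈ paramNbhd b η} := by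
  intro w hw
  have := hκ.differentiableAt _ hw (hr.update j w) j
  simp only [update_idem, update_self] at this
  exact this.differentiableWithinAt

/-- The weighted Lipschitz estimate in one coordinate; its constant does not depend on the
coordinate. -/
theorem norm_sub_le_coord (hb : ∀ j, 0 < b j) (hη : 0 < η) (hκ : IsFinitelyHolomorphic b η M κ)
    {z : ℕ → ℂ} (hr : EventuallyReal z) (hz : z ∈ paramNbhd b (η / 2)) (j : ℕ) {w w' : ℂ}
    (hw : update z j w ∈ paramNbhd b (η / 2)) (hw' : update z j w' ∈ paramNbhd b (η / 2)) :
    ‖κ (update z j w) - κ (update z j w')‖ ≤ 8 * M / η * (b j * ‖w - w'‖) := by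
  have h2 : η / 2 + η / 2 = η := by ring
  have hball : ∀ x, update z j x ∈ paramNbhd b (η / 2) →
      ball x (η / 2 / b j) ⊆ {w | update z j w ∈ paramNbhd b η} := by
    intro x hx v hv
    have := update_mem_of_ball hb hx j (θ := η / 2) (w := v) (by simpa using hv)
    rwa [update_idem, h2] at this
  have hrad : 0 < η / 2 / b j := div_pos (half_pos hη) (hb j)
  have key := Convex.norm_image_sub_le_of_norm_deriv_le (f := fun w => κ (update z j w))
    (s := {w | update z j w ∈ paramNbhd b (η / 2)}) (C := 4 * M / (η / 2 / b j)) (x := w')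
    (y := w)
    (fun x hx => (hκ.differentiableOn_slice hr j).differentiableAt
      (mem_of_superset (ball_mem_nhds x hrad) (hball x hx)))
    (fun x hx => norm_deriv_le_of_bound_ball hrad
      ((hκ.differentiableOn_slice hr j).mono (hball x hx))
      (fun v hv => hκ.bound _ (hball x hx hv) (hr.update j v)) x
      (mem_ball_self (by positivity)))
    (convex_slice hb hz j) hw' hw
  refine key.trans (le_of_eq ?_)
  have := (hb j).ne'
  field_simp
  ring

theorem dist_truncate_succ_le (hb : ∀ j, 0 < b j) (hη : 0 < η)
    (hκ : IsFinitelyHolomorphic b η M κ) {z : ℕ → ℂ} (hz : z ∈ paramNbhd b (η / 2)) (N : ℕ) :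
    dist (κ (truncate N z)) (κ (truncate (N + 1) z)) ≤ 8 * M / η * (‖z N‖ * b N) := by
  have h1 := truncate_mem_paramNbhd hb hz N
  have h2 := truncate_mem_paramNbhd hb hz (N + 1)
  rw [truncate_succ] at h2
  have h3 : update (truncate N z) N 0 ∈ paramNbhd b (η / 2) := by rwa [update_truncate_zero]
  have := hκ.norm_sub_le_coord hb hη (eventuallyReal_truncate N z) h1 N h2 h3
  rw [sub_zero, ← truncate_succ, update_truncate_zero] at this
  rw [dist_comm, dist_eq_norm]
  refine this.trans (le_of_eq ?_)
  ring

theorem nonneg (hη : 0 < η) (hκ : IsFinitelyHolomorphic b η M κ) : 0 ≤ M :=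
  (norm_nonneg _).trans (hκ.bound (fun _ => 0) (mem_paramNbhd_of_real hη fun _ =>
    zero_mem_unitSegment) ⟨0, fun _ _ => zero_mem_unitSegment⟩)

theorem tendsto_truncLimit (hb : ∀ j, 0 < b j) (hbs : Summable b) (hη : 0 < η)
    (hκ : IsFinitelyHolomorphic b η M κ) {z : ℕ → ℂ} (hz : z ∈ paramNbhd b (η / 2)) :
    Tendsto (fun N => κ (truncate N z)) atTop (𝓝 (truncLimit κ z)) :=
  (cauchySeq_of_dist_le_of_summable _ (hκ.dist_truncate_succ_le hb hη hz)
    ((summable_norm_mul hbs hb hz).mul_left _)).tendsto_limUnder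

theorem norm_truncLimit_le (hb : ∀ j, 0 < b j) (hbs : Summable b) (hη : 0 < η)
    (hκ : IsFinitelyHolomorphic b η M κ) {z : ℕ → ℂ} (hz : z ∈ paramNbhd b (η / 2)) :
    ‖truncLimit κ z‖ ≤ M :=
  le_of_tendsto (hκ.tendsto_truncLimit hb hbs hη hz).norm (Eventually.of_forall fun N =>
    hκ.bound _ (paramNbhd_mono (by linarith) (truncate_mem_paramNbhd hb hz N))
      (eventuallyReal_truncate N z))

/-- The values at the truncations converge uniformly in each single coordinate, so that the limit
inherits holomorphy. -/
theorem differentiableAt_truncLimit (hb : ∀ j, 0 < b j) (hbs : Summable b) (hη : 0 < η)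
    (hκ : IsFinitelyHolomorphic b η M κ) {z : ℕ → ℂ} (hz : z ∈ paramNbhd b (η / 2)) (j : ℕ) :
    DifferentiableAt ℂ (fun w => truncLimit κ (update z j w)) (z j) := by
  set U := {w | update z j w ∈ paramNbhd b (η / 2)} with hUdef
  have hU : IsOpen U := isOpen_slice hb hz j
  have hmem : z j ∈ U := by rw [hUdef, mem_ofPred_eq, update_eq_self]; exact hz
  have hsum := (summable_norm_mul hbs hb hz).mul_left (8 * M / η)
  have htail := tendsto_sum_nat_add fun m => 8 * M / η * (‖z m‖ * b m)
  have hunif : TendstoUniformlyOn (fun N w => κ (truncate N (update z j w)))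
      (fun w => truncLimit κ (update z j w)) atTop U := by
    rw [Metric.tendstoUniformlyOn_iff]
    intro e he
    filter_upwards [htail.eventually_lt_const he, eventually_gt_atTop j] with N hN hjN w hw
    refine lt_of_le_of_lt ?_ hN
    rw [dist_comm]
    refine (dist_le_tsum_of_dist_le_of_tendsto _ (hκ.dist_truncate_succ_le hb hη hw)
      ((summable_norm_mul hbs hb hw).mul_left _)
      (hκ.tendsto_truncLimit hb hbs hη hw) N).trans (le_of_eq ?_)
    refine tsum_congr fun m => ?_
    rw [update_of_ne (by omega), add_comm N m]
  have hd := hunif.tendstoLocallyUniformlyOn.differentiableOn (by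
    filter_upwards [eventually_gt_atTop j] with N hjN w hw
    simp only [truncate_update hjN]
    refine ((hκ.differentiableOn_slice (eventuallyReal_truncate N z) j).differentiableAt ?_
      ).differentiableWithinAt
    have hN : truncate N z ∈ paramNbhd b η :=
      paramNbhd_mono (by linarith) (truncate_mem_paramNbhd hb hz N)
    refine (isOpen_slice hb hN j).mem_nhds ?_
    rw [mem_ofPred_eq, ← truncate_update hjN]
    exact paramNbhd_mono (by linarith) (truncate_mem_paramNbhd hb hw N)) hU
  exact hd.differentiableAt (hU.mem_nhds hmem)

/-- The real truncations of `y`. -/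
theorem truncate_toComplexParam (N : ℕ) (y : ℕ → ℝ) :
    truncate N (toComplexParam y) = toComplexParam fun j => if j < N then y j else 0 := by
  funext j
  by_cases h : j < N <;> simp [truncate, toComplexParam, h]

theorem truncate_real_mem {y : ℕ → ℝ} (hy : y ∈ paramDomain) (N : ℕ) :
    (fun j => if j < N then y j else 0) ∈ paramDomain := by
  intro j
  by_cases h : j < N
  · simpa [h] using hy j
  · simp [h]

theorem tendsto_truncate_real (y : ℕ → ℝ) :
    Tendsto (fun N : ℕ => fun j => if j < N then y j else 0) atTop (𝓝 y) := by
  rw [tendsto_pi_nhds]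
  intro j
  refine tendsto_const_nhds.congr' ?_
  filter_upwards [eventually_gt_atTop j] with N hN
  rw [if_pos hN]

/-- The limit of the truncations recovers `κ` on the real parameter domain. By continuity this holds
on a cylinder, and from there it spreads by the identity theorem, one coordinate at a time. -/
theorem truncLimit_eq_of_real (hb : ∀ j, 0 < b j) (hbs : Summable b) (hη : 0 < η)
    (hκ : IsFinitelyHolomorphic b η M κ) {y : ℕ → ℝ} (hy : y ∈ paramDomain) :
    truncLimit κ (toComplexParam y) = κ (toComplexParam y) := by
  obtain ⟨c, hc, n, δ, hδ, hcont⟩ := hκ.continuous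
  have hV : ∀ {y : ℕ → ℝ}, y ∈ paramDomain → toComplexParam y ∈ paramNbhd b (η / 2) :=
    fun hy => mem_paramNbhd_of_real (half_pos hη) (toComplexParam_mem_unitSegment hy)
  suffices H : ∀ k, ∀ y ∈ paramDomain, (∀ j, k ≤ j → j < n → |y j - c j| < δ) →
      truncLimit κ (toComplexParam y) = κ (toComplexParam y) from
    H n y hy fun j h1 h2 => by omega
  intro k
  induction k with
  | zero =>
    intro y hy hyc
    have h1 := hκ.tendsto_truncLimit hb hbs hη (hV hy)
    refine tendsto_nhds_unique h1 ?_
    have h2 : Tendsto (fun N : ℕ => fun j => if j < N then y j else 0) atTop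
        (𝓝[paramDomain] y) :=
      tendsto_nhdsWithin_of_tendsto_nhds_of_eventually_within _ (tendsto_truncate_real y)
        (Eventually.of_forall fun N => truncate_real_mem hy N)
    have h3 := (hcont y hy fun j hj => hyc j (Nat.zero_le j) hj).tendsto.comp h2
    refine h3.congr fun N => ?_
    rw [comp_apply, truncate_toComplexParam]
  | succ k ih =>
    intro y hy hyc
    set U := {w | update (toComplexParam y) k w ∈ paramNbhd b (η / 2)} with hUdef
    have hr := eventuallyReal_toComplexParam hy
    have key := eqOn_of_eq_on_segment (U := U)
      (f := fun w => truncLimit κ (update (toComplexParam y) k w)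
        - κ (update (toComplexParam y) k w)) (isOpen_slice hb (hV hy) k)
      (convex_slice hb (hV hy) k).isPreconnected (unitSegment_subset_slice hb (hV hy) k)
      (fun w hw => by
        have h1 := hκ.differentiableAt_truncLimit hb hbs hη hw k
        have h2 := hκ.differentiableAt _ (paramNbhd_mono (show η / 2 ≤ η by linarith) hw)
          (hr.update k w) k
        simp only [update_idem, update_self] at h1 h2
        exact (h1.sub h2).differentiableWithinAt)
      (hc k) hδ
      (fun t ht htc => by
        rw [← toComplexParam_update, sub_eq_zero]
        refine ih _ (update_mem_paramDomain hy k ht) fun j hj hjn => ?_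
        rcases eq_or_ne j k with rfl | hjk
        · simpa using htc
        · rw [update_of_ne hjk]; exact hyc j (by omega) hjn)
    have h := key (y k) (by
      have : update (toComplexParam y) k (y k : ℂ) = toComplexParam y := update_eq_self k _
      rw [hUdef, mem_ofPred_eq, this]
      exact hV hy)
    have h' : update (toComplexParam y) k (y k : ℂ) = toComplexParam y := update_eq_self k _
    simp only [h'] at h
    exact sub_eq_zero.1 h

/-- On the real parameter domain, `κ` is Lipschitz for the `b`-weighted `ℓ¹` distance. -/
theorem norm_sub_le_of_real (hb : ∀ j, 0 < b j) (hbs : Summable b) (hη : 0 < η)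
    (hκ : IsFinitelyHolomorphic b η M κ) {y y' : ℕ → ℝ} (hy : y ∈ paramDomain)
    (hy' : y' ∈ paramDomain) :
    ‖κ (toComplexParam y) - κ (toComplexParam y')‖ ≤ 8 * M / η * ∑' j, b j * |y j - y' j| := by
  have hV : ∀ {y : ℕ → ℝ}, y ∈ paramDomain → toComplexParam y ∈ paramNbhd b (η / 2) :=
    fun hy => mem_paramNbhd_of_real (half_pos hη) (toComplexParam_mem_unitSegment hy)
  have hL : 0 ≤ 8 * M / η := div_nonneg (mul_nonneg (by norm_num) (hκ.nonneg hη)) hη.le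
  have hsum : Summable fun j => b j * |y j - y' j| := by
    refine Summable.of_nonneg_of_le (fun j => mul_nonneg (hb j).le (abs_nonneg _)) (fun j => ?_)
      (hbs.mul_right 2)
    refine mul_le_mul_of_nonneg_left ?_ (hb j).le
    have h1 := hy j; have h2 := hy' j
    rw [abs_le]; constructor <;> linarith [h1.1, h1.2, h2.1, h2.2]
  have hfin : ∀ N, ∀ x ∈ paramDomain, ∀ x' ∈ paramDomain, (∀ j, N ≤ j → x j = x' j) →
      ‖κ (toComplexParam x) - κ (toComplexParam x')‖
        ≤ 8 * M / η * ∑ j ∈ Finset.range N, b j * |x j - x' j| := by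
    intro N
    induction N with
    | zero =>
      intro x _ x' _ h
      have : x = x' := funext fun j => h j (Nat.zero_le j)
      simp [this]
    | succ N ih =>
      intro x hx x' hx' h
      have hm := update_mem_paramDomain hx' N (hx N)
      have h1 := ih x hx _ hm fun j hj => by
        rcases eq_or_ne j N with rfl | hjN
        · simp
        · rw [update_of_ne hjN]; exact h j (by omega)
      have e1 : update (toComplexParam x') N (x' N : ℂ) = toComplexParam x' := update_eq_self N _
      have h2 := hκ.norm_sub_le_coord hb hη (eventuallyReal_toComplexParam hx') (hV hx') N
        (w := (x N : ℂ)) (w' := (x' N : ℂ)) (by rw [← toComplexParam_update]; exact hV hm)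
        (by rw [e1]; exact hV hx')
      rw [e1, ← toComplexParam_update, ← Complex.ofReal_sub, Complex.norm_real,
        Real.norm_eq_abs] at h2
      have e2 : ∑ j ∈ Finset.range N, b j * |x j - update x' N (x N) j|
          = ∑ j ∈ Finset.range N, b j * |x j - x' j| :=
        Finset.sum_congr rfl fun j hj => by
          rw [update_of_ne (Finset.mem_range.1 hj).ne]
      rw [e2] at h1
      rw [Finset.sum_range_succ, mul_add]
      calc _ = ‖(κ (toComplexParam x) - κ (toComplexParam (update x' N (x N))))
            + (κ (toComplexParam (update x' N (x N))) - κ (toComplexParam x'))‖ := by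
            congr 1; ring
        _ ≤ _ := norm_add_le _ _
        _ ≤ _ := add_le_add h1 h2
  have ht := hκ.tendsto_truncLimit hb hbs hη (hV hy)
  have ht' := hκ.tendsto_truncLimit hb hbs hη (hV hy')
  rw [hκ.truncLimit_eq_of_real hb hbs hη hy] at ht
  rw [hκ.truncLimit_eq_of_real hb hbs hη hy'] at ht'
  refine le_of_tendsto (ht.sub ht').norm (Eventually.of_forall fun N => ?_)
  rw [truncate_toComplexParam, truncate_toComplexParam]
  refine (hfin N _ (truncate_real_mem hy N) _ (truncate_real_mem hy' N) fun j hj => by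
    simp only [if_neg (not_lt.2 hj)]).trans ?_
  refine mul_le_mul_of_nonneg_left ?_ hL
  refine le_trans (le_of_eq (Finset.sum_congr rfl fun j hj => ?_)) (hsum.sum_le_tsum
    (Finset.range N) fun j _ => mul_nonneg (hb j).le (abs_nonneg _))
  simp only [if_pos (Finset.mem_range.1 hj)]

end IsFinitelyHolomorphic

end

/-! ### Kernels at a fixed pair of points -/

/-- A bounded holomorphic function on a ball is Lipschitz near the centre. -/
theorem norm_sub_le_of_bound_ball_space {E : Type*} [NormedAddCommGroup E] [NormedSpace ℂ E]
    {f : E → ℂ} {c : E} {r M : ℝ} (hr : 0 < r) (hf : DifferentiableOn ℂ f (ball c r))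
    (hM : ∀ z ∈ ball c r, ‖f z‖ ≤ M) {x : E} (hx : ‖x - c‖ < r / 2) :
    ‖f x - f c‖ ≤ 4 * M / r * ‖x - c‖ := by
  rcases eq_or_ne x c with rfl | hne
  · simp
  have hv : 0 < ‖x - c‖ := norm_pos_iff.2 (sub_ne_zero.2 hne)
  have hmaps : ∀ s ∈ ball (0 : ℂ) (r / ‖x - c‖), c + s • (x - c) ∈ ball c r := by
    intro s hs
    rw [mem_ball_zero_iff, lt_div_iff₀ hv] at hs
    rw [mem_ball, dist_eq_norm, add_sub_cancel_left, norm_smul]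
    exact hs
  have key := norm_sub_le_of_bound_ball (f := fun s : ℂ => f (c + s • (x - c))) (c := 0)
    (r := r / ‖x - c‖) (M := M) (div_pos hr hv)
    (hf.comp (by fun_prop) hmaps) (fun s hs => hM _ (hmaps s hs)) 1
    (by rw [mem_ball_zero_iff, norm_one, div_div, lt_div_iff₀ (by positivity)]; linarith) 0
    (by rw [mem_ball_zero_iff, norm_zero]; positivity)
  simp only [one_smul, zero_smul, add_zero, sub_zero, norm_one, mul_one, add_sub_cancel] at key
  refine key.trans (le_of_eq ?_)
  field_simp

/-- An admissible sequence whose tubes contain the given point in their interior. -/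
noncomputable def canonicalRadius (b : ℕ → ℝ) (ε : ℝ) (z : ℕ → ℂ) : ℕ → ℝ :=
  fun j => 1 + infDist (z j) unitSegment + ε / 2 * (1 / 2) ^ (j + 1) / b j

section

variable {b : ℕ → ℝ} {ε : ℝ}

theorem infDist_lt_canonicalRadius (hb : ∀ j, 0 < b j) (hε : 0 < ε) (z : ℕ → ℂ) (j : ℕ) :
    infDist (z j) unitSegment < canonicalRadius b ε z j - 1 := by
  have : 0 < ε / 2 * (1 / 2) ^ (j + 1) / b j := div_pos (by positivity) (hb j)
  rw [canonicalRadius]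
  linarith

theorem one_lt_canonicalRadius (hb : ∀ j, 0 < b j) (hε : 0 < ε) (z : ℕ → ℂ) (j : ℕ) :
    1 < canonicalRadius b ε z j := by
  have := infDist_lt_canonicalRadius hb hε z j
  have h0 : 0 ≤ infDist (z j) unitSegment := infDist_nonneg
  linarith

theorem hasSum_half_pow : HasSum (fun j : ℕ => (1 / 2 : ℝ) ^ (j + 1)) 1 := by
  have := (hasSum_geometric_of_lt_one (r := (1 / 2 : ℝ)) (by norm_num) (by norm_num)).mul_left
    (1 / 2)
  norm_num at this
  simpa [pow_succ, mul_comm] using this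

theorem admissible_of_infDist (hb : ∀ j, 0 < b j) (hε : 0 < ε) {D : ℕ → ℝ} (hD0 : ∀ j, 0 ≤ D j)
    (hD : Summable fun j => D j * b j) (hDle : ∑' j, D j * b j ≤ ε / 2) :
    Admissible b ε fun j => 1 + D j + ε / 2 * (1 / 2) ^ (j + 1) / b j := by
  have e : (fun j => (1 + D j + ε / 2 * (1 / 2) ^ (j + 1) / b j - 1) * b j)
      = fun j => D j * b j + ε / 2 * (1 / 2) ^ (j + 1) := by
    funext j
    have := (hb j).ne'
    field_simp
    ring
  have hs := hD.hasSum.add (hasSum_half_pow.mul_left (ε / 2))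
  refine ⟨fun j => ?_, ?_, ?_⟩
  · have : 0 < ε / 2 * (1 / 2) ^ (j + 1) / b j := div_pos (by positivity) (hb j)
    linarith [hD0 j]
  · rw [e]; exact hs.summable
  · rw [e, hs.tsum_eq]; linarith

theorem admissible_canonicalRadius (hb : ∀ j, 0 < b j) (hε : 0 < ε) {z : ℕ → ℂ}
    (hz : z ∈ paramNbhd b (ε / 2)) : Admissible b ε (canonicalRadius b ε z) :=
  admissible_of_infDist hb hε (fun _ => infDist_nonneg) hz.1 hz.2.le

/-- The data that determine the pulled-back kernel at a fixed pair of points: the kernel `u`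
as a function of the real parameter and of its second argument, its extensions `F ρ`, the
difference `Z` of the two boundary points and the surface density `D`. -/
structure KernelPoint (b : ℕ → ℝ) (ε η : ℝ) (u : (ℕ → ℝ) → C3 → ℂ)
    (F : (ℕ → ℝ) → (ℕ → ℂ) → C3 → ℂ) (Z : (ℕ → ℂ) → C3) (D : (ℕ → ℂ) → ℂ) : Prop where
  extension : ∀ ρ, Admissible b ε ρ → ∀ ζ ∈ kernelDomain,
    IsHolomorphicExtension ρ (fun y => u y ζ) (fun z => F ρ z ζ)
  continuous_param : ∀ ζ ∈ kernelDomain, ContinuousOn (fun y => u y ζ) paramDomain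
  differentiable_snd : ∀ ρ, Admissible b ε ρ → ∀ z ∈ polyTube ρ,
    DifferentiableOn ℂ (fun ζ => F ρ z ζ) kernelDomain
  mem_kernelDomain : ∀ z ∈ paramNbhd b η, Z z ∈ kernelDomain
  affine : ∀ z ∈ paramNbhd b η, ∀ j, ∃ d : C3, ∀ w, Z (update z j w) = Z z + (w - z j) • d
  ball_subset : ∃ δ > 0, ∀ y ∈ paramDomain, closedBall (Z (toComplexParam y)) δ ⊆ kernelDomain
  continuous_diff : ContinuousOn (fun y => Z (toComplexParam y)) paramDomain
  differentiable_density : ∀ z ∈ paramNbhd b η, ∀ j,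
    DifferentiableAt ℂ (fun w => D (update z j w)) (z j)
  continuous_density : ContinuousOn (fun y => D (toComplexParam y)) paramDomain

/-- The value of the kernel built from the extension that belongs to the canonical radius. -/
noncomputable def kernelValue (b : ℕ → ℝ) (ε : ℝ) (F : (ℕ → ℝ) → (ℕ → ℂ) → C3 → ℂ)
    (Z : (ℕ → ℂ) → C3) (D : (ℕ → ℂ) → ℂ) (z : ℕ → ℂ) : ℂ :=
  F (canonicalRadius b ε z) z (Z z) * D z

namespace KernelPoint

variable {η : ℝ} {u : (ℕ → ℝ) → C3 → ℂ} {F : (ℕ → ℝ) → (ℕ → ℂ) → C3 → ℂ} {Z : (ℕ → ℂ) → C3}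
  {D : (ℕ → ℂ) → ℂ}

/-- The kernel value may be computed with any admissible radius. -/
theorem kernelValue_eq (hb : ∀ j, 0 < b j) (hε : 0 < ε) (hη : η ≤ ε / 2)
    (h : KernelPoint b ε η u F Z D) {z : ℕ → ℂ} (hz : z ∈ paramNbhd b η) (hr : EventuallyReal z)
    {ρ : ℕ → ℝ} (hρ : Admissible b ε ρ) (hzρ : ∀ j, infDist (z j) unitSegment < ρ j - 1) :
    kernelValue b ε F Z D z = F ρ z (Z z) * D z := by
  rw [kernelValue]
  congr 1
  exact extension_unique (one_lt_canonicalRadius hb hε z) hρ.1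
    (h.extension _ (admissible_canonicalRadius hb hε (paramNbhd_mono hη hz)) _
      (h.mem_kernelDomain z hz))
    (h.extension _ hρ _ (h.mem_kernelDomain z hz)) hr (infDist_lt_canonicalRadius hb hε z) hzρ

theorem kernelValue_real (hb : ∀ j, 0 < b j) (hε : 0 < ε) (hη0 : 0 < η)
    (h : KernelPoint b ε η u F Z D) {y : ℕ → ℝ} (hy : y ∈ paramDomain) :
    kernelValue b ε F Z D (toComplexParam y)
      = u y (Z (toComplexParam y)) * D (toComplexParam y) := by
  have hV : ∀ {η}, 0 < η → toComplexParam y ∈ paramNbhd b η :=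
    fun h => mem_paramNbhd_of_real h (toComplexParam_mem_unitSegment hy)
  rw [kernelValue]
  congr 1
  exact (h.extension _ (admissible_canonicalRadius hb hε (hV (half_pos hε))) _
    (h.mem_kernelDomain _ (hV hη0))).1 y hy

/-- Both arguments of the kernel depend on the parameter; separate holomorphy in them implies
holomorphy of the composition by Hartogs' theorem. -/
theorem differentiableAt_kernelValue (hb : ∀ j, 0 < b j) (hε : 0 < ε) (hη : η ≤ ε / 2)
    (h : KernelPoint b ε η u F Z D) {z : ℕ → ℂ} (hz : z ∈ paramNbhd b η) (hr : EventuallyReal z)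
    (j : ℕ) : DifferentiableAt ℂ (fun w => kernelValue b ε F Z D (update z j w)) (z j) := by
  set ρ := canonicalRadius b ε z with hρdef
  have hρ : Admissible b ε ρ := admissible_canonicalRadius hb hε (paramNbhd_mono hη hz)
  have hlt := infDist_lt_canonicalRadius hb hε z
  have hzρ : z ∈ polyTube ρ := fun k => (hlt k).le
  obtain ⟨d, hd⟩ := h.affine z hz j
  obtain ⟨r, hr0, hrsub⟩ := Metric.mem_nhds_iff.1
    ((isOpen_slice hb hz j).mem_nhds (show z j ∈ {w | update z j w ∈ paramNbhd b η} by
      rw [mem_ofPred_eq, update_eq_self]; exact hz))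
  set r' := min r (ρ j - 1 - infDist (z j) unitSegment) with hr'
  have hr'0 : 0 < r' := lt_min hr0 (by have := hlt j; linarith)
  have hslice : ∀ w ∈ ball (z j) r', update z j w ∈ paramNbhd b η := fun w hw =>
    hrsub (ball_subset_ball (min_le_left _ _) hw)
  have hstrict : ∀ w ∈ ball (z j) r', ∀ k, infDist (update z j w k) unitSegment < ρ k - 1 := by
    intro w hw k
    rcases eq_or_ne k j with rfl | hk
    · rw [update_self]
      have h1 : infDist w unitSegment ≤ infDist (z k) unitSegment + dist w (z k) :=
        infDist_le_infDist_add_dist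
      have h2 := mem_ball.1 (ball_subset_ball (min_le_right _ _) hw)
      linarith
    · rw [update_of_ne hk]; exact hlt k
  have hdiag := differentiableAt_diagonal
    (H := fun w s => F ρ (update z j w) (Z (update z j s))) hr'0
    (fun s hs => ((h.extension ρ hρ _ (h.mem_kernelDomain _ (hslice s hs))).2 z hzρ j).mono
      (fun w hw => by have := hstrict w hw j; rw [update_self] at this; exact this.le))
    (fun w hw => (h.differentiable_snd ρ hρ (update z j w) fun k => (hstrict w hw k).le).comp
      (by simp only [hd]; fun_prop) (fun s hs => h.mem_kernelDomain _ (hslice s hs)))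
  refine (hdiag.mul (h.differentiable_density z hz j)).congr_of_eventuallyEq ?_
  filter_upwards [ball_mem_nhds (z j) hr'0] with w hw
  exact h.kernelValue_eq hb hε hη (hslice w hw) (hr.update j w) hρ (hstrict w hw)

theorem isCompact_paramDomain : IsCompact paramDomain := by
  have : paramDomain = Set.pi univ fun _ : ℕ => Icc (-1 : ℝ) 1 := by
    ext y; simp only [paramDomain, mem_ofPred_eq, Set.mem_pi, mem_univ, true_imp_iff]
  rw [this]
  exact isCompact_univ_pi fun _ => isCompact_Icc

theorem zero_mem_paramDomain : (0 : ℕ → ℝ) ∈ paramDomain := fun _ => by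
  simp

/-- By Baire's theorem the kernel is bounded, uniformly for parameters in some cylinder, on balls
of its second argument; hence it is jointly continuous there. -/
theorem exists_continuousWithinAt_kernelValue (hb : ∀ j, 0 < b j) (hε : 0 < ε) (hη0 : 0 < η)
    (h : KernelPoint b ε η u F Z D) :
    ∃ c ∈ paramDomain, ∃ n : ℕ, ∃ δ > 0, ∀ y ∈ paramDomain, (∀ j < n, |y j - c j| < δ) →
      ContinuousWithinAt (fun y => kernelValue b ε F Z D (toComplexParam y)) paramDomain y := by
  obtain ⟨r, hr, hball⟩ := h.ball_subset
  have hV : ∀ {y η}, y ∈ paramDomain → 0 < η → toComplexParam y ∈ paramNbhd b η :=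
    fun hy h => mem_paramNbhd_of_real h (toComplexParam_mem_unitSegment hy)
  have hdiff : ∀ y ∈ paramDomain, DifferentiableOn ℂ (u y) kernelDomain := by
    intro y hy
    have hadm := admissible_canonicalRadius hb hε (hV hy (half_pos hε))
    refine (h.differentiable_snd _ hadm (toComplexParam y) fun k =>
      (infDist_lt_canonicalRadius hb hε _ k).le).congr fun ζ hζ => ?_
    exact ((h.extension _ hadm ζ hζ).1 y hy).symm
  have : CompactSpace paramDomain := isCompact_iff_compactSpace.1 isCompact_paramDomain
  have : Nonempty paramDomain := ⟨⟨0, zero_mem_paramDomain⟩⟩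
  set f : ℕ → Set paramDomain := fun m =>
    {y | ∀ ζ ∈ ball (Z (toComplexParam y)) r, ‖u y ζ‖ ≤ m} with hf
  have hZ : Continuous fun y : paramDomain => Z (toComplexParam y) :=
    continuousOn_iff_continuous_domRestrict.1 h.continuous_diff
  have hclosed : ∀ m, IsClosed (f m) := by
    intro m
    rw [← isOpen_compl_iff, isOpen_iff_mem_nhds]
    intro y hy
    rw [mem_compl_iff, hf, mem_ofPred_eq] at hy
    push Not at hy
    obtain ⟨ζ, hζ, hlt⟩ := hy
    have hu : Continuous fun y : paramDomain => u y ζ := continuousOn_iff_continuous_domRestrict.1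
      (h.continuous_param ζ (hball y y.2 (ball_subset_closedBall hζ)))
    have h1 : ∀ᶠ y' : paramDomain in 𝓝 y, ζ ∈ ball (Z (toComplexParam y')) r := by
      have : Tendsto (fun y' : paramDomain => dist ζ (Z (toComplexParam y'))) (𝓝 y)
          (𝓝 (dist ζ (Z (toComplexParam y)))) := (continuous_const.dist hZ).continuousAt
      exact this.eventually_lt_const hζ
    have h2 : ∀ᶠ y' : paramDomain in 𝓝 y, (m : ℝ) < ‖u y' ζ‖ :=
      hu.norm.continuousAt.tendsto.eventually_const_lt hlt
    filter_upwards [h1, h2] with y' h1 h2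
    rw [mem_compl_iff, hf, mem_ofPred_eq]
    push Not
    exact ⟨ζ, h1, h2⟩
  have hunion : ⋃ m, f m = univ := by
    refine eq_univ_of_forall fun y => ?_
    obtain ⟨C, hC⟩ := (isCompact_closedBall (Z (toComplexParam y)) r).exists_bound_of_continuousOn
      ((hdiff y y.2).mono (hball y y.2)).continuousOn
    obtain ⟨m, hm⟩ := exists_nat_ge C
    exact mem_iUnion.2 ⟨m, fun ζ hζ => (hC ζ (ball_subset_closedBall hζ)).trans hm⟩
  obtain ⟨m, c, hc⟩ := nonempty_interior_of_iUnion_of_closed hclosed hunion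
  obtain ⟨O, hO, hOf⟩ := isOpen_induced_iff.1 (isOpen_interior (s := f m))
  have hcO : (c : ℕ → ℝ) ∈ O := by
    have : c ∈ Subtype.val ⁻¹' O := by rw [hOf]; exact hc
    exact this
  have hOm : ∀ y (hy : y ∈ paramDomain), y ∈ O → ∀ ζ ∈ ball (Z (toComplexParam y)) r,
      ‖u y ζ‖ ≤ m := by
    intro y hy hyO
    have : (⟨y, hy⟩ : paramDomain) ∈ Subtype.val ⁻¹' O := hyO
    rw [hOf] at this
    exact interior_subset this
  -- a cylinder around `c` inside `O`
  obtain ⟨I, v, hv, hIv⟩ := isOpen_pi_iff.1 hO c hcO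
  have hδ : ∃ δ > 0, ∀ j ∈ I, ball ((c : ℕ → ℝ) j) δ ⊆ v j := by
    have : ∀ᶠ δ : ℝ in 𝓝[>] 0, ∀ j ∈ I, ball ((c : ℕ → ℝ) j) δ ⊆ v j := by
      rw [Finset.eventually_all]
      intro j hj
      obtain ⟨e, he, hsub⟩ := Metric.isOpen_iff.1 (hv j hj).1 _ (hv j hj).2
      filter_upwards [Ioo_mem_nhdsGT he] with δ hδ
      exact (ball_subset_ball hδ.2.le).trans hsub
    obtain ⟨δ, hδ⟩ := (this.and self_mem_nhdsWithin).exists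
    exact ⟨δ, hδ.2, hδ.1⟩
  obtain ⟨δ, hδ, hsub⟩ := hδ
  refine ⟨c, c.2, I.sup id + 1, δ, hδ, fun y hy hyc => ?_⟩
  have hyO : y ∈ O := hIv fun j hj => hsub j hj (by
    rw [mem_ball, Real.dist_eq]
    exact hyc j (Nat.lt_succ_of_le (Finset.le_sup (f := id) hj)))
  -- continuity of the first factor at `y`
  have hcont : ContinuousWithinAt (fun y => u y (Z (toComplexParam y))) paramDomain y := by
    have hZy : Tendsto (fun y' => Z (toComplexParam y')) (𝓝[paramDomain] y)
        (𝓝 (Z (toComplexParam y))) := h.continuous_diff y hy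
    have h1 : Tendsto (fun y' => 4 * m / r * ‖Z (toComplexParam y) - Z (toComplexParam y')‖)
        (𝓝[paramDomain] y) (𝓝 0) := by
      have := ((tendsto_const_nhds (x := Z (toComplexParam y))).sub hZy).norm.const_mul (4 * m / r)
      simpa using this
    have hζ : Z (toComplexParam y) ∈ kernelDomain := h.mem_kernelDomain _ (hV hy hη0)
    have h2 := h.continuous_param _ hζ y hy
    have h3 : Tendsto (fun y' => u y' (Z (toComplexParam y)) - u y' (Z (toComplexParam y')))
        (𝓝[paramDomain] y) (𝓝 0) := by
      refine squeeze_zero_norm' ?_ h1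
      have hs : ∀ᶠ y' in 𝓝[paramDomain] y,
          ‖Z (toComplexParam y) - Z (toComplexParam y')‖ < r / 2 := by
        have := ((tendsto_const_nhds (x := Z (toComplexParam y))).sub hZy).norm
        rw [sub_self, norm_zero] at this
        exact this.eventually_lt_const (half_pos hr)
      filter_upwards [hs, self_mem_nhdsWithin, mem_nhdsWithin_of_mem_nhds (hO.mem_nhds hyO)]
        with y' hs hy' hy'O
      exact norm_sub_le_of_bound_ball_space hr
        ((hdiff y' hy').mono (ball_subset_closedBall.trans (hball y' hy'))) (hOm y' hy' hy'O) hs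
    have h4 := (h2.tendsto.sub h3)
    simp only [sub_sub_cancel, sub_zero] at h4
    exact h4
  refine (hcont.mul (h.continuous_density y hy)).congr (fun y' hy' => ?_) ?_
  · exact h.kernelValue_real hb hε hη0 hy'
  · exact h.kernelValue_real hb hε hη0 hy

theorem isFinitelyHolomorphic (hb : ∀ j, 0 < b j) (hε : 0 < ε) (hη0 : 0 < η) (hη : η ≤ ε / 2)
    (h : KernelPoint b ε η u F Z D) {η' M : ℝ} (hη' : η' ≤ η)
    (hM : ∀ z ∈ paramNbhd b η', EventuallyReal z → ‖kernelValue b ε F Z D z‖ ≤ M) :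
    IsFinitelyHolomorphic b η' M (kernelValue b ε F Z D) :=
  ⟨hM, fun _ hz hr j => h.differentiableAt_kernelValue hb hε hη (paramNbhd_mono hη' hz) hr j,
    h.exists_continuousWithinAt_kernelValue hb hε hη0⟩

end KernelPoint

/-- A uniform boundedness principle. Suppose that a family of functions is bounded, with a weak
singularity, on the interior of every admissible polytube, with constants that depend on the
radii. Then constants can be chosen uniformly on some neighbourhood of the parameter domain:
otherwise there are points that violate the bounds, and they can be chosen so close to the
parameter domain that a single admissible polytube contains all of them. -/
theorem exists_uniform_singular_bound {Q : Type*} (hb : ∀ j, 0 < b j) (hε : 0 < ε)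
    {κ : Q → (ℕ → ℂ) → ℂ} {d : Q → ℝ} {d₀ : ℝ} (hd : ∀ q, 0 < d q) (hd₀ : ∀ q, d q ≤ d₀)
    {η : ℝ} (hη : 0 < η)
    (h : ∀ ρ, Admissible b ε ρ → ∃ C ν : ℝ, 0 ≤ ν ∧ ν < 2 ∧ ∀ q, ∀ z ∈ paramNbhd b η,
      EventuallyReal z → (∀ j, infDist (z j) unitSegment < ρ j - 1) →
        ‖κ q z‖ ≤ C * d q ^ (-ν)) :
    ∃ η' > 0, η' ≤ η ∧ ∃ C ν : ℝ, 0 ≤ C ∧ 0 ≤ ν ∧ ν < 2 ∧ ∀ q, ∀ z ∈ paramNbhd b η',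
      EventuallyReal z → ‖κ q z‖ ≤ C * d q ^ (-ν) := by
  by_contra! hcon
  have hstep : ∀ n : ℕ, ∃ q, ∃ z ∈ paramNbhd b (min η (ε / 2 * (1 / 2) ^ (n + 1))),
      EventuallyReal z ∧ (n : ℝ) * d q ^ (-(2 - 1 / ((n : ℝ) + 1))) < ‖κ q z‖ := by
    intro n
    have h1 : 1 / ((n : ℝ) + 1) ≤ 1 := (div_le_one (by positivity)).2 (by simp)
    have h2 : 0 < 1 / ((n : ℝ) + 1) := by positivity
    exact hcon _ (lt_min hη (by positivity)) (min_le_left _ _) n (2 - 1 / ((n : ℝ) + 1))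
      (Nat.cast_nonneg n) (by linarith) (by linarith)
  choose q z hz hr hlt using hstep
  have hzle : ∀ n, ∑' j, infDist (z n j) unitSegment * b j ≤ ε / 2 * (1 / 2) ^ (n + 1) :=
    fun n => (hz n).2.le.trans (min_le_right _ _)
  have hnn : ∀ p : ℕ × ℕ, 0 ≤ infDist (z p.1 p.2) unitSegment * b p.2 :=
    fun p => mul_nonneg infDist_nonneg (hb _).le
  have hgeo := hasSum_half_pow.mul_left (ε / 2)
  have hrow : Summable fun n => ∑' j, infDist (z n j) unitSegment * b j :=
    Summable.of_nonneg_of_le (fun n => tsum_nonneg fun j => hnn (n, j)) hzle hgeo.summable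
  have hprod : Summable fun p : ℕ × ℕ => infDist (z p.1 p.2) unitSegment * b p.2 :=
    (summable_prod_of_nonneg hnn).2 ⟨fun n => (hz n).1, hrow⟩
  have hcol : ∀ j, Summable fun n => infDist (z n j) unitSegment := by
    intro j
    have := (hprod.prod_symm.prod_factor j).mul_right (b j)⁻¹
    refine this.congr fun n => ?_
    simp only [Prod.swap_prod_mk]
    rw [mul_assoc, mul_inv_cancel₀ (hb j).ne', mul_one]
  have hcolsum : ∀ j, (∑' n, infDist (z n j) unitSegment) * b j
      = ∑' n, infDist (z n j) unitSegment * b j := fun j => tsum_mul_right.symm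
  -- the radii exceed the sums of the distances of all the points
  have hadm := admissible_of_infDist (D := fun j => ∑' n, infDist (z n j) unitSegment) hb hε
    (fun j => tsum_nonneg fun n => infDist_nonneg)
    (by simp only [hcolsum]; exact hprod.prod_symm.prod)
    (by
      simp only [hcolsum]
      have e := Summable.tsum_comm (f := fun n j => infDist (z n j) unitSegment * b j) hprod
      rw [e]
      refine (hrow.tsum_le_tsum hzle hgeo.summable).trans (le_of_eq ?_)
      rw [hgeo.tsum_eq, mul_one])
  obtain ⟨C, ν, hν0, hν2, hC⟩ := h _ hadm
  set m := max 1 d₀ with hm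
  have hm1 : 1 ≤ m := le_max_left _ _
  obtain ⟨n, hn⟩ := exists_nat_ge (max (|C| * m ^ (2 : ℝ)) (1 / (2 - ν)))
  have hn1 : |C| * m ^ (2 : ℝ) ≤ n := (le_max_left _ _).trans hn
  have hn2 : 1 / (2 - ν) ≤ n := (le_max_right _ _).trans hn
  have hν' : 0 < 2 - ν := by linarith
  have hnν : ν ≤ 2 - 1 / ((n : ℝ) + 1) := by
    have h1 : 1 / ((n : ℝ) + 1) ≤ 2 - ν := by
      rw [div_le_iff₀ (by positivity)]
      rw [div_le_iff₀ hν'] at hn2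
      nlinarith
    linarith
  have h1 := hC (q n) (z n) (paramNbhd_mono (min_le_left _ _) (hz n)) (hr n) (fun j => by
    have h1 : infDist (z n j) unitSegment ≤ ∑' n, infDist (z n j) unitSegment :=
      (hcol j).le_tsum n fun _ _ => infDist_nonneg
    have h2 : 0 < ε / 2 * (1 / 2) ^ (j + 1) / b j := div_pos (by positivity) (hb j)
    linarith)
  have hdq := hd (q n)
  have h2 : d (q n) ^ (-ν) ≤ d (q n) ^ (-(2 - 1 / ((n : ℝ) + 1))) * m ^ (2 : ℝ) := by
    have e : -ν = -(2 - 1 / ((n : ℝ) + 1)) + (2 - 1 / ((n : ℝ) + 1) - ν) := by ring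
    rw [e, Real.rpow_add hdq]
    gcongr
    have h0 : 0 < 1 / ((n : ℝ) + 1) := by positivity
    calc d (q n) ^ (2 - 1 / ((n : ℝ) + 1) - ν) ≤ m ^ (2 - 1 / ((n : ℝ) + 1) - ν) :=
          Real.rpow_le_rpow hdq.le ((hd₀ _).trans (le_max_right _ _)) (by linarith)
      _ ≤ m ^ (2 : ℝ) := Real.rpow_le_rpow_of_exponent_le hm1 (by linarith)
  have hpos : 0 ≤ d (q n) ^ (-(2 - 1 / ((n : ℝ) + 1))) := Real.rpow_nonneg hdq.le _
  have h3 : ‖κ (q n) (z n)‖ ≤ n * d (q n) ^ (-(2 - 1 / ((n : ℝ) + 1))) :=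
    calc _ ≤ C * d (q n) ^ (-ν) := h1
      _ ≤ |C| * d (q n) ^ (-ν) := by gcongr; exact le_abs_self C
      _ ≤ |C| * (d (q n) ^ (-(2 - 1 / ((n : ℝ) + 1))) * m ^ (2 : ℝ)) := by gcongr
      _ = |C| * m ^ (2 : ℝ) * d (q n) ^ (-(2 - 1 / ((n : ℝ) + 1))) := by ring
      _ ≤ _ := by gcongr
  exact absurd (hlt n) (not_lt.2 h3)

end

/-! ### Integral operators on `L²` -/

section

variable {E P : Type*} [MeasurableSpace E] [MeasurableSpace P] {σ : Measure E} {μ : Measure P}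

/-- `A` is the integral operator from `L²(μ)` to `L²(σ)` with kernel `k`. -/
def IsKernelOperator (σ : Measure E) (μ : Measure P) (k : E → P → ℂ)
    (A : Lp ℂ 2 μ →L[ℂ] Lp ℂ 2 σ) : Prop :=
  ∀ f : Lp ℂ 2 μ, ∀ᵐ x ∂σ,
    Integrable (fun q => k x q * f q) μ ∧ A f x = ∫ q, k x q * f q ∂μ

/-- A kernel whose integrals over each of its two variables are bounded by `S`. -/
structure SchurWeight (σ : Measure E) (μ : Measure P) (m : E → P → ℝ) (S : ℝ≥0) : Prop where
  measurable : AEMeasurable (uncurry m) (σ.prod μ)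
  lintegral_snd : ∀ᵐ x ∂σ, ∫⁻ q, ENNReal.ofReal (m x q) ∂μ ≤ S
  lintegral_fst : ∀ᵐ q ∂μ, ∫⁻ x, ENNReal.ofReal (m x q) ∂σ ≤ S

theorem lintegral_sq_le (w g : P → ℝ≥0∞) (hw : AEMeasurable w μ) (hg : AEMeasurable g μ) :
    (∫⁻ q, w q * g q ∂μ) ^ 2 ≤ (∫⁻ q, w q ∂μ) * ∫⁻ q, w q * g q ^ 2 ∂μ := by
  have h := ENNReal.lintegral_mul_le_Lp_mul_Lq μ Real.HolderConjugate.two_two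
    (f := fun q => w q ^ (1 / 2 : ℝ)) (g := fun q => w q ^ (1 / 2 : ℝ) * g q)
    (hw.pow_const _) ((hw.pow_const _).mul hg)
  have e : ∀ x : ℝ≥0∞, x ^ (1 / 2 : ℝ) * x ^ (1 / 2 : ℝ) = x := fun x => by
    rw [← ENNReal.rpow_add_of_nonneg _ _ (by norm_num) (by norm_num)]; norm_num
  have e2 : ∀ x : ℝ≥0∞, (x ^ (1 / 2 : ℝ)) ^ (2 : ℝ) = x := fun x => by
    rw [← ENNReal.rpow_mul]; norm_num
  have e3 : ∀ x : ℝ≥0∞, (x ^ (1 / 2 : ℝ)) ^ 2 = x := fun x => by rw [sq, e]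
  simp only [Pi.mul_apply, ← mul_assoc, e, e2, ENNReal.mul_rpow_of_nonneg _ _ zero_le_two,
    ENNReal.rpow_two] at h
  calc _ ≤ _ := pow_le_pow_left₀ (zero_le) h 2
    _ = _ := by rw [mul_pow, e3, e3]

theorem SchurWeight.lintegral_le [SFinite σ] [SFinite μ] {m : E → P → ℝ} {S : ℝ≥0}
    (hm : SchurWeight σ μ m S) {g : P → ℝ≥0∞} (hg : AEMeasurable g μ) :
    ∫⁻ x, (∫⁻ q, ENNReal.ofReal (m x q) * g q ∂μ) ^ 2 ∂σ ≤ S ^ 2 * ∫⁻ q, g q ^ 2 ∂μ := by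
  have hmm : AEMeasurable (fun p : E × P => ENNReal.ofReal (m p.1 p.2)) (σ.prod μ) :=
    hm.measurable.ennreal_ofReal
  have hg2 : AEMeasurable (fun p : E × P => g p.2 ^ 2) (σ.prod μ) :=
    (hg.comp_quasiMeasurePreserving Measure.quasiMeasurePreserving_snd).pow_const 2
  have hfst : ∀ᵐ x ∂σ, AEMeasurable (fun q => ENNReal.ofReal (m x q)) μ := by
    obtain ⟨F, hF, hFe⟩ := hmm
    filter_upwards [Measure.ae_ae_of_ae_prod hFe] with x hx
    exact ⟨fun q => F (x, q), hF.comp measurable_prodMk_left, hx⟩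
  calc _ ≤ ∫⁻ x, S * ∫⁻ q, ENNReal.ofReal (m x q) * g q ^ 2 ∂μ ∂σ := by
        refine lintegral_mono_ae ?_
        filter_upwards [hfst, hm.lintegral_snd] with x hx hS
        exact (lintegral_sq_le _ g hx hg).trans (by gcongr)
    _ = S * ∫⁻ x, ∫⁻ q, ENNReal.ofReal (m x q) * g q ^ 2 ∂μ ∂σ :=
        lintegral_const_mul' _ _ ENNReal.coe_ne_top
    _ = S * ∫⁻ q, ∫⁻ x, ENNReal.ofReal (m x q) * g q ^ 2 ∂σ ∂μ := by
        rw [lintegral_lintegral_swap]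
        exact hmm.mul hg2
    _ ≤ S * ∫⁻ q, S * g q ^ 2 ∂μ := by
        refine mul_le_mul_right (lintegral_mono_ae ?_) _
        have hsnd : ∀ᵐ q ∂μ, AEMeasurable (fun x => ENNReal.ofReal (m x q)) σ := by
          obtain ⟨F, hF, hFe⟩ := hmm
          have hsw := (Measure.measurePreserving_swap (μ := μ) (ν := σ)).quasiMeasurePreserving.ae
            hFe
          filter_upwards [Measure.ae_ae_of_ae_prod hsw] with q hq
          exact ⟨fun x => F (x, q), hF.comp measurable_prodMk_right, hq⟩
        filter_upwards [hm.lintegral_fst, hsnd] with q hq hq'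
        rw [lintegral_mul_const'' _ hq']
        gcongr
    _ = _ := by
        rw [lintegral_const_mul' _ _ ENNReal.coe_ne_top, ← mul_assoc, sq]

/-- The Schur test, at the level of functions. -/
theorem SchurWeight.kernel_bound [SFinite σ] [SFinite μ] {m : E → P → ℝ} {S : ℝ≥0}
    (hm : SchurWeight σ μ m S) {k : E → P → ℂ}
    (hk : AEStronglyMeasurable (uncurry k) (σ.prod μ)) {c : ℝ≥0}
    (hkm : ∀ᵐ p ∂σ.prod μ, ‖k p.1 p.2‖ ≤ c * m p.1 p.2) {f : P → ℂ} (hf : MemLp f 2 μ) :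
    (∀ᵐ x ∂σ, Integrable (fun q => k x q * f q) μ) ∧
      MemLp (fun x => ∫ q, k x q * f q ∂μ) 2 σ ∧
      eLpNorm (fun x => ∫ q, k x q * f q ∂μ) 2 σ ≤ ((c * S : ℝ≥0) : ℝ≥0∞) * eLpNorm f 2 μ := by
  have hkf : AEStronglyMeasurable (fun p : E × P => k p.1 p.2 * f p.2) (σ.prod μ) :=
    hk.mul (hf.aestronglyMeasurable.comp_quasiMeasurePreserving
      Measure.quasiMeasurePreserving_snd)
  have hfn : ∀ (ν : Measure E) (g : E → ℂ), eLpNorm g 2 ν = (∫⁻ x, ‖g x‖ₑ ^ 2 ∂ν) ^ (1 / 2 : ℝ) :=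
    fun ν g => by
      rw [eLpNorm_eq_lintegral_rpow_enorm_toReal two_ne_zero ENNReal.ofNat_ne_top]
      simp
  have hfn' : ∀ (ν : Measure P) (g : P → ℂ),
      eLpNorm g 2 ν = (∫⁻ x, ‖g x‖ₑ ^ 2 ∂ν) ^ (1 / 2 : ℝ) :=
    fun ν g => by
      rw [eLpNorm_eq_lintegral_rpow_enorm_toReal two_ne_zero ENNReal.ofNat_ne_top]
      simp
  have hmain : ∫⁻ x, (∫⁻ q, ‖k x q * f q‖ₑ ∂μ) ^ 2 ∂σ
      ≤ (((c * S : ℝ≥0) : ℝ≥0∞) * eLpNorm f 2 μ) ^ 2 := by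
    calc _ ≤ ∫⁻ x, (c * ∫⁻ q, ENNReal.ofReal (m x q) * ‖f q‖ₑ ∂μ) ^ 2 ∂σ := by
          refine lintegral_mono_ae ?_
          filter_upwards [Measure.ae_ae_of_ae_prod hkm] with x hx
          refine pow_le_pow_left₀ zero_le ?_ 2
          rw [← lintegral_const_mul' _ _ ENNReal.coe_ne_top]
          refine lintegral_mono_ae ?_
          filter_upwards [hx] with q hq
          rw [enorm_mul, ← mul_assoc]
          gcongr
          rw [← ofReal_norm, ← ENNReal.ofReal_coe_nnreal,
            ← ENNReal.ofReal_mul c.coe_nonneg]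
          exact ENNReal.ofReal_le_ofReal hq
      _ = c ^ 2 * ∫⁻ x, (∫⁻ q, ENNReal.ofReal (m x q) * ‖f q‖ₑ ∂μ) ^ 2 ∂σ := by
          simp_rw [mul_pow]
          rw [lintegral_const_mul' _ _ (ENNReal.pow_ne_top ENNReal.coe_ne_top)]
      _ ≤ c ^ 2 * (S ^ 2 * ∫⁻ q, ‖f q‖ₑ ^ 2 ∂μ) := by
          gcongr
          exact hm.lintegral_le hf.aestronglyMeasurable.enorm
      _ = _ := by
          rw [hfn', mul_pow, ← ENNReal.rpow_natCast (_ ^ (1 / 2 : ℝ)), ← ENNReal.rpow_mul,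
            ENNReal.coe_mul, mul_pow, mul_assoc]
          norm_num
  have hfin : (((c * S : ℝ≥0) : ℝ≥0∞) * eLpNorm f 2 μ) ^ 2 ≠ ∞ :=
    ENNReal.pow_ne_top (ENNReal.mul_ne_top ENNReal.coe_ne_top hf.2.ne)
  have hmeas : AEMeasurable (fun x => (∫⁻ q, ‖k x q * f q‖ₑ ∂μ) ^ 2) σ :=
    (hkf.enorm.lintegral_prod_right').pow_const 2
  have hle : eLpNorm (fun x => ∫ q, k x q * f q ∂μ) 2 σ
      ≤ ((c * S : ℝ≥0) : ℝ≥0∞) * eLpNorm f 2 μ := by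
    rw [hfn]
    calc _ ≤ ((((c * S : ℝ≥0) : ℝ≥0∞) * eLpNorm f 2 μ) ^ 2) ^ (1 / 2 : ℝ) := by
          refine ENNReal.rpow_le_rpow (le_trans (lintegral_mono fun x => ?_) hmain) (by norm_num)
          exact pow_le_pow_left₀ zero_le (enorm_integral_le_lintegral_enorm _) 2
      _ = _ := by
          rw [← ENNReal.rpow_natCast, ← ENNReal.rpow_mul]
          norm_num
  refine ⟨?_, ⟨hkf.integral_prod_right', hle.trans_lt (ENNReal.mul_lt_top ENNReal.coe_lt_top hf.2)⟩,
    hle⟩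
  filter_upwards [ae_lt_top' hmeas (ne_top_of_le_ne_top hfin hmain), hkf.prodMk_left] with x hx hx'
  refine ⟨hx', ?_⟩
  by_contra hcon
  have htop : ∫⁻ q, ‖k x q * f q‖ₑ ∂μ = ∞ := not_lt_top_iff.1 hcon
  rw [htop] at hx
  simp at hx

/-- The Schur test. -/
theorem SchurWeight.exists_isKernelOperator [SFinite σ] [SFinite μ] {m : E → P → ℝ} {S : ℝ≥0}
    (hm : SchurWeight σ μ m S) {k : E → P → ℂ}
    (hk : AEStronglyMeasurable (uncurry k) (σ.prod μ)) {c : ℝ≥0}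
    (hkm : ∀ᵐ p ∂σ.prod μ, ‖k p.1 p.2‖ ≤ c * m p.1 p.2) :
    ∃ A : Lp ℂ 2 μ →L[ℂ] Lp ℂ 2 σ, IsKernelOperator σ μ k A ∧ ‖A‖ ≤ c * S := by
  have hb := fun f : Lp ℂ 2 μ => hm.kernel_bound hk hkm (Lp.memLp f)
  let L : Lp ℂ 2 μ →ₗ[ℂ] Lp ℂ 2 σ :=
    { toFun := fun f => (hb f).2.1.toLp _
      map_add' := fun f g => by
        rw [← MemLp.toLp_add]
        refine (MemLp.toLp_eq_toLp_iff _ _).2 ?_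
        filter_upwards [(hb f).1, (hb g).1] with x hx hx'
        rw [Pi.add_apply, ← integral_add hx hx']
        refine integral_congr_ae ?_
        filter_upwards [Lp.coeFn_add f g] with q hq
        rw [hq, Pi.add_apply, mul_add]
      map_smul' := fun a f => by
        rw [RingHom.id_apply, ← MemLp.toLp_const_smul]
        refine (MemLp.toLp_eq_toLp_iff _ _).2 (Eventually.of_forall fun x => ?_)
        simp only [Pi.smul_apply]
        rw [← integral_smul]
        refine integral_congr_ae ?_
        filter_upwards [Lp.coeFn_smul a f] with q hq
        rw [hq, Pi.smul_apply, smul_eq_mul, smul_eq_mul]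
        ring }
  have hL : ∀ f, ‖L f‖ ≤ c * S * ‖f‖ := by
    intro f
    change ‖(hb f).2.1.toLp _‖ ≤ _
    rw [Lp.norm_toLp, Lp.norm_def]
    have := ENNReal.toReal_mono (ENNReal.mul_ne_top ENNReal.coe_ne_top (Lp.memLp f).2.ne)
      (hb f).2.2
    rw [ENNReal.toReal_mul, ENNReal.coe_toReal, NNReal.coe_mul] at this
    exact this
  refine ⟨L.mkContinuous _ hL, fun f => ?_, L.mkContinuous_norm_le (by positivity) hL⟩
  filter_upwards [(hb f).1, (hb f).2.1.coeFn_toLp] with x hx hx'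
  exact ⟨hx, hx'⟩

theorem IsKernelOperator.unique {k : E → P → ℂ} {A B : Lp ℂ 2 μ →L[ℂ] Lp ℂ 2 σ}
    (hA : IsKernelOperator σ μ k A) (hB : IsKernelOperator σ μ k B) : A = B := by
  ext1 f
  refine Lp.ext ?_
  filter_upwards [hA f, hB f] with x h1 h2
  rw [h1.2, h2.2]

theorem IsKernelOperator.sub {k k' : E → P → ℂ} {A B : Lp ℂ 2 μ →L[ℂ] Lp ℂ 2 σ}
    (hA : IsKernelOperator σ μ k A) (hB : IsKernelOperator σ μ k' B) :
    IsKernelOperator σ μ (fun x q => k x q - k' x q) (A - B) := by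
  intro f
  filter_upwards [hA f, hB f, Lp.coeFn_sub (A f) (B f)] with x h1 h2 h3
  simp only [sub_mul]
  refine ⟨h1.1.sub h2.1, ?_⟩
  rw [integral_sub h1.1 h2.1, ← h1.2, ← h2.2]
  exact h3

theorem IsKernelOperator.smul {k : E → P → ℂ} {A : Lp ℂ 2 μ →L[ℂ] Lp ℂ 2 σ}
    (hA : IsKernelOperator σ μ k A) (a : ℂ) :
    IsKernelOperator σ μ (fun x q => a * k x q) (a • A) := by
  intro f
  filter_upwards [hA f, Lp.coeFn_smul a (A f)] with x h1 h3
  simp only [mul_assoc]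
  refine ⟨h1.1.const_mul a, ?_⟩
  rw [integral_const_mul, ← h1.2]
  exact h3

theorem SchurWeight.norm_le [SFinite σ] [SFinite μ] {m : E → P → ℝ} {S : ℝ≥0}
    (hm : SchurWeight σ μ m S) {k : E → P → ℂ}
    (hk : AEStronglyMeasurable (uncurry k) (σ.prod μ)) {c : ℝ≥0}
    (hkm : ∀ᵐ p ∂σ.prod μ, ‖k p.1 p.2‖ ≤ c * m p.1 p.2) {A : Lp ℂ 2 μ →L[ℂ] Lp ℂ 2 σ}
    (hA : IsKernelOperator σ μ k A) : ‖A‖ ≤ c * S := by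
  obtain ⟨B, hB, hBn⟩ := hm.exists_isKernelOperator hk hkm
  rwa [hA.unique hB]

open Classical in
/-- The integral operator with kernel `k`, or zero if there is no such bounded operator. -/
noncomputable def kernelOperator (σ : Measure E) (μ : Measure P) (k : E → P → ℂ) :
    Lp ℂ 2 μ →L[ℂ] Lp ℂ 2 σ :=
  if h : ∃ A, IsKernelOperator σ μ k A then h.choose else 0

theorem SchurWeight.isKernelOperator [SFinite σ] [SFinite μ] {m : E → P → ℝ} {S : ℝ≥0}
    (hm : SchurWeight σ μ m S) {k : E → P → ℂ}
    (hk : AEStronglyMeasurable (uncurry k) (σ.prod μ)) {c : ℝ≥0}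
    (hkm : ∀ᵐ p ∂σ.prod μ, ‖k p.1 p.2‖ ≤ c * m p.1 p.2) :
    IsKernelOperator σ μ k (kernelOperator σ μ k) := by
  have h : ∃ A, IsKernelOperator σ μ k A :=
    let ⟨A, hA, _⟩ := hm.exists_isKernelOperator hk hkm
    ⟨A, hA⟩
  rw [kernelOperator, dif_pos h]
  exact h.choose_spec

theorem SchurWeight.norm_kernelOperator_sub_le [SFinite σ] [SFinite μ] {m : E → P → ℝ} {S : ℝ≥0}
    (hm : SchurWeight σ μ m S) {k k' : E → P → ℂ}
    (hk : AEStronglyMeasurable (uncurry k) (σ.prod μ))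
    (hk' : AEStronglyMeasurable (uncurry k') (σ.prod μ)) {c c' : ℝ≥0}
    (hkm : ∀ᵐ p ∂σ.prod μ, ‖k p.1 p.2‖ ≤ c * m p.1 p.2)
    (hkm' : ∀ᵐ p ∂σ.prod μ, ‖k' p.1 p.2‖ ≤ c * m p.1 p.2)
    (hsub : ∀ᵐ p ∂σ.prod μ, ‖k p.1 p.2 - k' p.1 p.2‖ ≤ c' * m p.1 p.2) :
    ‖kernelOperator σ μ k - kernelOperator σ μ k'‖ ≤ c' * S :=
  hm.norm_le (k := fun x q => k x q - k' x q) (hk.sub hk') hsub ((hm.isKernelOperator hk hkm).sub (hm.isKernelOperator hk' hkm'))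

/-- An integral operator whose kernel depends holomorphically on a parameter, pointwise and with a
common Schur bound, depends holomorphically on it in the operator norm. The point is that the
Taylor remainders of the kernels are quadratic with constants controlled by the same bound. -/
theorem SchurWeight.differentiableAt_kernelOperator [SFinite σ] [SFinite μ] {m : E → P → ℝ}
    {S : ℝ≥0} (hm : SchurWeight σ μ m S) {k : ℂ → E → P → ℂ} {w₀ : ℂ} {r : ℝ} (hr : 0 < r)
    {c : ℝ≥0} (hk : ∀ w ∈ ball w₀ r, AEStronglyMeasurable (uncurry (k w)) (σ.prod μ))
    (hkm : ∀ᵐ p ∂σ.prod μ, DifferentiableOn ℂ (fun w => k w p.1 p.2) (ball w₀ r) ∧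
      ∀ w ∈ ball w₀ r, ‖k w p.1 p.2‖ ≤ c * m p.1 p.2) :
    DifferentiableAt ℂ (fun w => kernelOperator σ μ (k w)) w₀ := by
  lift r to ℝ≥0 using hr.le
  set k' : E → P → ℂ := fun x q => deriv (fun w => k w x q) w₀ with hk'def
  have hw₀ : w₀ ∈ ball w₀ r := mem_ball_self hr
  have hop : ∀ w ∈ ball w₀ r, IsKernelOperator σ μ (k w) (kernelOperator σ μ (k w)) :=
    fun w hw => hm.isKernelOperator (hk w hw) (hkm.mono fun p hp => hp.2 w hw)
  have hk' : AEStronglyMeasurable (uncurry k') (σ.prod μ) := by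
    set h : ℕ → ℂ := fun n => ((r / 2 / (n + 1) : ℝ) : ℂ) with hh
    have hnorm : ∀ n, ‖h n‖ = r / 2 / (n + 1) := fun n => by
      rw [hh, Complex.norm_real, Real.norm_of_nonneg (by positivity)]
    have hne : ∀ n, h n ≠ 0 := fun n => by rw [← norm_pos_iff, hnorm]; positivity
    have hmem : ∀ n, w₀ + h n ∈ ball w₀ r := fun n => by
      rw [mem_ball, dist_eq_norm, add_sub_cancel_left, hnorm]
      calc r / 2 / (n + 1 : ℝ) ≤ r / 2 := div_le_self (by positivity) (by simp)
        _ < r := by linarith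
    have hlim : Tendsto h atTop (𝓝[≠] 0) := by
      refine tendsto_nhdsWithin_of_tendsto_nhds_of_eventually_within _ ?_
        (Eventually.of_forall hne)
      rw [tendsto_zero_iff_norm_tendsto_zero]
      simp_rw [hnorm]
      have := (tendsto_const_div_atTop_nhds_zero_nat ((r : ℝ) / 2)).comp (tendsto_add_atTop_nat 1)
      simpa [Function.comp_def] using this
    refine aestronglyMeasurable_of_tendsto_ae atTop
      (f := fun n p => (h n)⁻¹ • (uncurry (k (w₀ + h n)) p - uncurry (k w₀) p))
      (fun n => ((hk _ (hmem n)).sub (hk w₀ hw₀)).const_smul (h n)⁻¹) ?_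
    filter_upwards [hkm] with p hp
    have hd := (hp.1.differentiableAt (isOpen_ball.mem_nhds hw₀)).hasDerivAt
    exact hd.tendsto_slope_zero.comp hlim
  have hk'm : ∀ᵐ p ∂σ.prod μ, ‖k' p.1 p.2‖ ≤ (4 * c / r : ℝ≥0) * m p.1 p.2 := by
    filter_upwards [hkm] with p hp
    refine (norm_deriv_le_of_bound_ball hr hp.1 hp.2 w₀ (mem_ball_self (by positivity))).trans
      (le_of_eq ?_)
    rw [NNReal.coe_div, NNReal.coe_mul, NNReal.coe_ofNat]
    ring
  have hop' := hm.isKernelOperator hk' hk'm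
  have hrem : ∀ h : ℂ, ‖h‖ < r / 4 →
      ‖kernelOperator σ μ (k (w₀ + h)) - kernelOperator σ μ (k w₀) - h • kernelOperator σ μ k'‖
        ≤ 32 * c * S / r ^ 2 * ‖h‖ ^ 2 := by
    intro h hh
    have hmem : w₀ + h ∈ ball w₀ r := by
      rw [mem_ball, dist_eq_norm, add_sub_cancel_left]; linarith
    have hop3 := ((hop _ hmem).sub (hop _ hw₀)).sub (hop'.smul h)
    refine (hm.norm_le (k := fun x q => k (w₀ + h) x q - k w₀ x q - h * k' x q)
      (c := 32 * c / r ^ 2 * ‖h‖₊ ^ 2)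
      (((hk _ hmem).sub (hk _ hw₀)).sub (hk'.const_mul h)) ?_ hop3).trans (le_of_eq ?_)
    · filter_upwards [hkm] with p hp
      refine (norm_taylor_remainder_le hr hp.1 hp.2 h hh).trans (le_of_eq ?_)
      simp only [NNReal.coe_div, NNReal.coe_mul, NNReal.coe_ofNat, NNReal.coe_pow,
        coe_nnnorm]
      ring
    · simp only [NNReal.coe_div, NNReal.coe_mul, NNReal.coe_ofNat, NNReal.coe_pow,
        coe_nnnorm]
      ring
  refine HasDerivAt.differentiableAt (f' := kernelOperator σ μ k') ?_
  rw [hasDerivAt_iff_isLittleO_nhds_zero]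
  refine Asymptotics.IsBigO.trans_isLittleO (g := fun h : ℂ => ‖h‖ ^ 2) ?_ ?_
  · refine Asymptotics.IsBigO.of_bound (32 * c * S / r ^ 2) ?_
    filter_upwards [ball_mem_nhds (0 : ℂ) (show 0 < (r : ℝ) / 4 by linarith)] with h hh
    rw [mem_ball_zero_iff] at hh
    refine (hrem h hh).trans (le_of_eq ?_)
    rw [Real.norm_of_nonneg (by positivity)]
  · have := Asymptotics.isLittleO_norm_pow_id (E' := ℂ) (one_lt_two)
    exact this

/-- Composition with a map that does not concentrate measure is bounded on `L²`. -/
theorem exists_pullback {σ : Measure E} {μ : Measure P} {X : P → E} (hX : AEMeasurable X μ)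
    {C : ℝ≥0} (hC : μ.map X ≤ C • σ) :
    ∃ T : Lp ℂ 2 σ →L[ℂ] Lp ℂ 2 μ, ∀ f : Lp ℂ 2 σ, T f =ᵐ[μ] fun q => f (X q) := by
  have hqmp : μ.map X ≪ σ := (Measure.absolutelyContinuous_of_le hC).trans
    (Measure.AbsolutelyContinuous.rfl.smul_left _)
  have hle : ∀ f : Lp ℂ 2 σ, eLpNorm (fun q => f (X q)) 2 μ
      ≤ (C : ℝ≥0∞) ^ (1 / 2 : ℝ) * eLpNorm f 2 σ := by
    intro f
    have h1 : eLpNorm (fun q => f (X q)) 2 μ = eLpNorm f 2 (μ.map X) :=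
      (eLpNorm_map_measure ((Lp.aestronglyMeasurable f).mono_ac hqmp) hX).symm
    rw [h1]
    refine (eLpNorm_mono_measure f hC).trans (le_of_eq ?_)
    have h2 : (C • σ) = (C : ℝ≥0∞) • σ := rfl
    rw [h2, eLpNorm_smul_measure_of_ne_top ENNReal.ofNat_ne_top]
    simp
  have hCfin : (C : ℝ≥0∞) ^ (1 / 2 : ℝ) ≠ ∞ :=
    ENNReal.rpow_ne_top_of_nonneg (by norm_num) ENNReal.coe_ne_top
  have hb : ∀ f : Lp ℂ 2 σ, MemLp (fun q => f (X q)) 2 μ := fun f =>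
    ⟨((Lp.aestronglyMeasurable f).mono_ac hqmp).comp_aemeasurable hX,
      (hle f).trans_lt (ENNReal.mul_lt_top hCfin.lt_top (Lp.memLp f).2)⟩
  let L : Lp ℂ 2 σ →ₗ[ℂ] Lp ℂ 2 μ :=
    { toFun := fun f => (hb f).toLp _
      map_add' := fun f g => by
        rw [← MemLp.toLp_add]
        refine (MemLp.toLp_eq_toLp_iff _ _).2 ?_
        exact ae_of_ae_map hX (hqmp (Lp.coeFn_add f g))
      map_smul' := fun a f => by
        rw [RingHom.id_apply, ← MemLp.toLp_const_smul]
        refine (MemLp.toLp_eq_toLp_iff _ _).2 ?_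
        exact ae_of_ae_map hX (hqmp (Lp.coeFn_smul a f)) }
  refine ⟨L.mkContinuous ((C : ℝ≥0∞) ^ (1 / 2 : ℝ)).toReal fun f => ?_, fun f =>
    (hb f).coeFn_toLp⟩
  change ‖(hb f).toLp _‖ ≤ _
  rw [Lp.norm_toLp, Lp.norm_def, ← ENNReal.toReal_mul]
  exact ENNReal.toReal_mono (ENNReal.mul_ne_top hCfin (Lp.memLp f).2.ne) (hle f)

end

/-! ### The complexified Euclidean space -/

theorem toC3_apply (v : E3) (i : Fin 3) : toC3 v i = (v i : ℂ) := rfl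

theorem toC3_add (v w : E3) : toC3 (v + w) = toC3 v + toC3 w := by
  ext i; simp [toC3_apply]

theorem toC3_sub (v w : E3) : toC3 (v - w) = toC3 v - toC3 w := by
  ext i; simp [toC3_apply]

theorem toC3_smul (t : ℝ) (v : E3) : toC3 (t • v) = (t : ℂ) • toC3 v := by
  ext i; simp [toC3_apply]

theorem norm_toC3 (v : E3) : ‖toC3 v‖ = ‖v‖ := by
  rw [EuclideanSpace.norm_eq, EuclideanSpace.norm_eq]
  simp [toC3_apply]

/-- The inclusion `ℝ³ ⊂ ℂ³` as a continuous additive map. -/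
noncomputable def toC3L : E3 →L[ℝ] C3 :=
  LinearMap.mkContinuous
    { toFun := toC3
      map_add' := toC3_add
      map_smul' := fun t v => by
        rw [toC3_smul]; rfl } 1 fun v => by
    rw [one_mul]; exact (norm_toC3 v).le

theorem toC3L_apply (v : E3) : toC3L v = toC3 v := rfl

theorem continuous_toC3 : Continuous toC3 := toC3L.continuous

/-- The bilinear (not sesquilinear) product on `ℂ³`. -/
def dotC (ζ ξ : C3) : ℂ := ∑ i, ζ i * ξ i

theorem mem_kernelDomain_iff {ζ : C3} : ζ ∈ kernelDomain ↔ 0 < (dotC ζ ζ).re := Iff.rfl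

theorem dotC_toC3 (v w : E3) : dotC (toC3 v) (toC3 w) = ((inner ℝ v w : ℝ) : ℂ) := by
  simp [dotC, toC3_apply, PiLp.inner_apply, Fin.sum_univ_three]
  ring

theorem norm_dotC_le (ζ ξ : C3) : ‖dotC ζ ξ‖ ≤ ‖ζ‖ * ‖ξ‖ := by
  calc ‖dotC ζ ξ‖ ≤ ∑ i, ‖ζ i‖ * ‖ξ i‖ := by
        refine (norm_sum_le _ _).trans (le_of_eq ?_)
        simp
    _ ≤ _ := by
        rw [EuclideanSpace.norm_eq, EuclideanSpace.norm_eq]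
        exact Real.sum_mul_le_sqrt_mul_sqrt _ _ _

theorem dotC_add_left (a b c : C3) : dotC (a + b) c = dotC a c + dotC b c := by
  simp [dotC, add_mul, Finset.sum_add_distrib]

theorem dotC_add_right (a b c : C3) : dotC a (b + c) = dotC a b + dotC a c := by
  simp [dotC, mul_add, Finset.sum_add_distrib]

theorem differentiable_dotC {f g : ℂ → C3} (hf : Differentiable ℂ f) (hg : Differentiable ℂ g) :
    Differentiable ℂ fun w => dotC (f w) (g w) := by
  unfold dotC
  have hp : ∀ {f : ℂ → C3}, Differentiable ℂ f → ∀ i, Differentiable ℂ fun w => f w i :=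
    fun hf i => (EuclideanSpace.proj (𝕜 := ℂ) i).differentiable.comp hf
  exact Differentiable.fun_sum fun i _ => (hp hf i).mul (hp hg i)

theorem continuous_dotC : Continuous fun p : C3 × C3 => dotC p.1 p.2 := by
  unfold dotC
  fun_prop

theorem isOpen_kernelDomain : IsOpen kernelDomain := by
  have : Continuous fun ζ : C3 => (dotC ζ ζ).re :=
    Complex.continuous_re.comp (continuous_dotC.comp (continuous_id.prodMk continuous_id))
  exact isOpen_lt continuous_const this

/-- The difference of the bilinear products of a pair of real vectors and of a complex
perturbation of it. -/
theorem norm_dotC_add_sub_le {v w : E3} {δ δ' : C3} {Λ θ : ℝ} (hv : ‖v‖ ≤ Λ) (hw : ‖w‖ ≤ Λ)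
    (hδ : ‖δ‖ ≤ θ) (hδ' : ‖δ'‖ ≤ θ) :
    ‖dotC (toC3 v + δ) (toC3 w + δ') - (inner ℝ v w : ℝ)‖ ≤ 2 * Λ * θ + θ ^ 2 := by
  rw [← dotC_toC3, dotC_add_left, dotC_add_right, dotC_add_right]
  have e : dotC (toC3 v) (toC3 w) + dotC (toC3 v) δ' + (dotC δ (toC3 w) + dotC δ δ')
      - dotC (toC3 v) (toC3 w) = dotC (toC3 v) δ' + (dotC δ (toC3 w) + dotC δ δ') := by ring
  rw [e]
  have h1 := norm_dotC_le (toC3 v) δ'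
  have h2 := norm_dotC_le δ (toC3 w)
  have h3 := norm_dotC_le δ δ'
  rw [norm_toC3] at h1 h2
  have h0 : 0 ≤ Λ := (norm_nonneg _).trans hv
  have h0' : 0 ≤ θ := (norm_nonneg _).trans hδ
  have g1 : ‖v‖ * ‖δ'‖ ≤ Λ * θ := mul_le_mul hv hδ' (norm_nonneg _) h0
  have g2 : ‖δ‖ * ‖w‖ ≤ θ * Λ := mul_le_mul hδ hw (norm_nonneg _) h0'
  have g3 : ‖δ‖ * ‖δ'‖ ≤ θ * θ := mul_le_mul hδ hδ' (norm_nonneg _) h0'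
  refine (norm_add_le _ _).trans ?_
  have := norm_add_le (dotC δ (toC3 w)) (dotC δ δ')
  nlinarith

/-- Small complex perturbations of a nonzero real vector stay in the domain of the kernel. -/
theorem toC3_add_mem_kernelDomain {v : E3} (hv : v ≠ 0) {δ : C3} (hδ : ‖δ‖ ≤ ‖v‖ / 4) :
    toC3 v + δ ∈ kernelDomain := by
  rw [mem_kernelDomain_iff]
  have h := norm_dotC_add_sub_le (le_refl ‖v‖) (le_refl ‖v‖) hδ hδ
  have h2 := (Complex.abs_re_le_norm _).trans h
  rw [Complex.sub_re, Complex.ofReal_re, real_inner_self_eq_norm_sq] at h2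
  have h3 := (abs_le.1 h2).1
  have : 0 < ‖v‖ := norm_pos_iff.2 hv
  nlinarith

theorem toC3_mem_kernelDomain {v : E3} (hv : v ≠ 0) : toC3 v ∈ kernelDomain := by
  simpa using toC3_add_mem_kernelDomain hv (δ := 0) (by rw [norm_zero]; positivity)

/-- The determinant of the bilinear Gram matrix of two vectors of `ℂ³`. -/
def gramC (ζ ξ : C3) : ℂ := dotC ζ ζ * dotC ξ ξ - dotC ζ ξ * dotC ζ ξ

/-- The Gram determinant of two real vectors. -/
noncomputable def gramR (v w : E3) : ℝ := inner ℝ v v * inner ℝ w w - inner ℝ v w * inner ℝ v w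

theorem gramC_toC3 (v w : E3) : gramC (toC3 v) (toC3 w) = (gramR v w : ℂ) := by
  simp only [gramC, gramR, dotC_toC3]
  push_cast
  ring

theorem norm_gramC_add_sub_le {v w : E3} {δ δ' : C3} {Λ θ : ℝ} (hv : ‖v‖ ≤ Λ) (hw : ‖w‖ ≤ Λ)
    (hδ : ‖δ‖ ≤ θ) (hδ' : ‖δ'‖ ≤ θ) (hθ : θ ≤ Λ) :
    ‖gramC (toC3 v + δ) (toC3 w + δ') - (gramR v w : ℝ)‖ ≤ 30 * Λ ^ 3 * θ := by
  have hΛ : 0 ≤ Λ := (norm_nonneg _).trans hv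
  have hθ0 : 0 ≤ θ := (norm_nonneg _).trans hδ
  have hin : ∀ {a b : E3}, ‖a‖ ≤ Λ → ‖b‖ ≤ Λ → ‖((inner ℝ a b : ℝ) : ℂ)‖ ≤ Λ ^ 2 := by
    intro a b ha hb
    rw [Complex.norm_real]
    refine (norm_inner_le_norm a b).trans ?_
    rw [sq]
    exact mul_le_mul ha hb (norm_nonneg _) hΛ
  have hd : ∀ {a b : E3} {α β : C3}, ‖a‖ ≤ Λ → ‖b‖ ≤ Λ → ‖α‖ ≤ θ → ‖β‖ ≤ θ →
      ‖dotC (toC3 a + α) (toC3 b + β) - (inner ℝ a b : ℝ)‖ ≤ 3 * Λ * θ := by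
    intro a b α β ha hb hα hβ
    refine (norm_dotC_add_sub_le ha hb hα hβ).trans ?_
    nlinarith
  have hprod : ∀ {A B A' B' : ℂ}, ‖A - A'‖ ≤ 3 * Λ * θ → ‖B - B'‖ ≤ 3 * Λ * θ → ‖A'‖ ≤ Λ ^ 2 →
      ‖B'‖ ≤ Λ ^ 2 → ‖A * B - A' * B'‖ ≤ 15 * Λ ^ 3 * θ := by
    intro A B A' B' hA hB hA' hB'
    have e : A * B - A' * B' = (A - A') * (B - B') + (A - A') * B' + A' * (B - B') := by ring
    rw [e]
    refine (norm_add₃_le).trans ?_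
    rw [norm_mul, norm_mul, norm_mul]
    have g1 := mul_le_mul hA hB (norm_nonneg _) (by positivity)
    have g2 := mul_le_mul hA hB' (norm_nonneg _) (by positivity)
    have g3 := mul_le_mul hA' hB (norm_nonneg _) (by positivity)
    have g4 : 3 * Λ * θ * (3 * Λ * θ) ≤ 9 * Λ ^ 3 * θ := by
      have : Λ ^ 2 * θ * θ ≤ Λ ^ 2 * θ * Λ := by gcongr
      nlinarith
    nlinarith
  have h1 := hprod (hd hv hv hδ hδ) (hd hw hw hδ' hδ') (hin hv hv) (hin hw hw)
  have h2 := hprod (hd hv hw hδ hδ') (hd hv hw hδ hδ') (hin hv hw) (hin hv hw)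
  have e : gramC (toC3 v + δ) (toC3 w + δ') - (gramR v w : ℝ)
      = (dotC (toC3 v + δ) (toC3 v + δ) * dotC (toC3 w + δ') (toC3 w + δ')
          - (inner ℝ v v : ℝ) * (inner ℝ w w : ℝ))
        - (dotC (toC3 v + δ) (toC3 w + δ') * dotC (toC3 v + δ) (toC3 w + δ')
          - (inner ℝ v w : ℝ) * (inner ℝ v w : ℝ)) := by
    simp only [gramC, gramR]
    push_cast
    ring
  rw [e]
  refine (norm_sub_le _ _).trans ?_
  linarith

/-- A lower bound for the Gram determinant of an injective linear map of the plane. -/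
theorem le_gramR {v w : E3} {c : ℝ} (hc : 0 < c)
    (h : ∀ s t : ℝ, c ^ 2 * (s ^ 2 + t ^ 2) ≤ ‖s • v + t • w‖ ^ 2) : c ^ 4 ≤ gramR v w := by
  have hv : c ^ 2 ≤ inner ℝ v v := by
    have := h 1 0
    rw [real_inner_self_eq_norm_sq]
    simpa using this
  have hv0 : 0 < inner ℝ v v := lt_of_lt_of_le (by positivity) hv
  set t := inner ℝ v w / inner ℝ v v with ht
  have h2 := h (-t) 1
  have e : ‖(-t) • v + (1 : ℝ) • w‖ ^ 2 = inner ℝ w w - inner ℝ v w * inner ℝ v w / inner ℝ v v := by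
    rw [← real_inner_self_eq_norm_sq]
    simp only [inner_add_left, inner_add_right, real_inner_smul_left, real_inner_smul_right,
      real_inner_comm v w]
    rw [ht, real_inner_comm w v]
    field_simp
    ring
  rw [e] at h2
  have h3 : c ^ 2 ≤ inner ℝ w w - inner ℝ v w * inner ℝ v w / inner ℝ v v := by
    nlinarith [sq_nonneg t, mul_nonneg (sq_nonneg c) (sq_nonneg t)]
  have e2 : gramR v w = inner ℝ v v * (inner ℝ w w - inner ℝ v w * inner ℝ v w / inner ℝ v v) := by
    rw [gramR]
    field_simp
  rw [e2]
  calc c ^ 4 = c ^ 2 * c ^ 2 := by ring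
    _ ≤ _ := mul_le_mul hv h3 (by positivity) hv0.le

theorem gramR_le {v w : E3} {L : ℝ} (hv : ‖v‖ ≤ L) (hw : ‖w‖ ≤ L) : gramR v w ≤ L ^ 4 := by
  have hL : 0 ≤ L := (norm_nonneg _).trans hv
  rw [gramR, real_inner_self_eq_norm_sq, real_inner_self_eq_norm_sq]
  have h1 : ‖v‖ ^ 2 ≤ L ^ 2 := by gcongr
  have h2 : ‖w‖ ^ 2 ≤ L ^ 2 := by gcongr
  have := mul_le_mul h1 h2 (by positivity) (by positivity)
  nlinarith [mul_self_nonneg (inner ℝ v w)]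

theorem gramDet_eq (f : E2 → E3) (u : E2) :
    gramDet f u = gramR (fderiv ℝ f u (EuclideanSpace.single 0 1))
      (fderiv ℝ f u (EuclideanSpace.single 1 1)) := by
  rw [gramDet, Matrix.det_fin_two, gramR]
  simp only [Matrix.gram_apply]
  rw [real_inner_comm (fderiv ℝ f u (EuclideanSpace.single 0 1))
    (fderiv ℝ f u (EuclideanSpace.single 1 1))]

/-- The derivative of a map with a lower Lipschitz bound is bounded below. -/
theorem le_norm_of_hasFDerivAt {f : E2 → E3} {D : E2 →L[ℝ] E3} {u : E2} {s : Set E2}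
    (hs : s ∈ 𝓝 u) {c : ℝ} (hD : HasFDerivAt f D u)
    (hc : ∀ u' ∈ s, c * ‖u' - u‖ ≤ ‖f u' - f u‖) (v : E2) : c * ‖v‖ ≤ ‖D v‖ := by
  have hlim := hD.lim_real v
  refine ge_of_tendsto hlim.norm ?_
  have hev : ∀ᶠ t : ℝ in atTop, u + t⁻¹ • v ∈ s := by
    have : Tendsto (fun t : ℝ => u + t⁻¹ • v) atTop (𝓝 u) := by
      have := (tendsto_inv_atTop_zero (𝕜 := ℝ)).smul_const v
      simpa using this.const_add u
    exact this.eventually hs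
  filter_upwards [hev, eventually_gt_atTop 0] with t ht ht0
  have := hc _ ht
  rw [add_sub_cancel_left, norm_smul, norm_inv, Real.norm_of_nonneg ht0.le] at this
  rw [norm_smul, Real.norm_of_nonneg ht0.le]
  calc c * ‖v‖ = t * (c * (t⁻¹ * ‖v‖)) := by field_simp
    _ ≤ _ := by gcongr

theorem gramDet_bounds {f : E2 → E3} {s : Set E2} (hs : IsOpen s) {u : E2} (hu : u ∈ s)
    (hd : DifferentiableAt ℝ f u) {c : ℝ} (hc0 : 0 < c)
    (hc : ∀ x ∈ s, ∀ x' ∈ s, c * ‖x - x'‖ ≤ ‖f x - f x'‖) {L : ℝ≥0} (hL : LipschitzOnWith L f s) :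
    c ^ 4 ≤ gramDet f u ∧ gramDet f u ≤ (L : ℝ) ^ 4 := by
  have hD := hd.hasFDerivAt
  set D := fderiv ℝ f u
  have hn : ∀ i, ‖D (EuclideanSpace.single i 1)‖ ≤ L := by
    intro i
    have h1 : ‖D‖ ≤ L := hD.le_of_lipschitzOn (hs.mem_nhds hu) hL
    calc _ ≤ ‖D‖ * ‖EuclideanSpace.single i (1 : ℝ)‖ := D.le_opNorm _
      _ ≤ L * 1 := by
        rw [PiLp.norm_single, norm_one]; gcongr
      _ = L := mul_one _
  rw [gramDet_eq]
  refine ⟨le_gramR hc0 fun a b => ?_, gramR_le (hn 0) (hn 1)⟩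
  have h1 := le_norm_of_hasFDerivAt (hs.mem_nhds hu) hD (fun u' hu' => hc u' hu' u hu)
    (a • EuclideanSpace.single 0 1 + b • EuclideanSpace.single 1 1)
  rw [map_add, map_smul, map_smul] at h1
  have h2 : ‖(a • EuclideanSpace.single 0 1 + b • EuclideanSpace.single 1 1 : E2)‖ ^ 2
      = a ^ 2 + b ^ 2 := by
    rw [EuclideanSpace.norm_sq_eq]
    simp [Fin.sum_univ_two]
  calc c ^ 2 * (a ^ 2 + b ^ 2)
      = (c * ‖(a • EuclideanSpace.single 0 1 + b • EuclideanSpace.single 1 1 : E2)‖) ^ 2 := by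
        rw [mul_pow, h2]
    _ ≤ _ := by gcongr

/-! ### Affine functions of infinitely many parameters -/

/-- The affine function `z ↦ v₀ + ∑ j, z_j v_j` with values in `ℂ³`. -/
noncomputable def affineC (v₀ : E3) (v : ℕ → E3) (z : ℕ → ℂ) : C3 :=
  toC3 v₀ + ∑' j, z j • toC3 (v j)

theorem transfC_eq (φ₀ : E3 → E3) (φ : ℕ → E3 → E3) (z : ℕ → ℂ) (x : E3) :
    transfC φ₀ φ z x = affineC (φ₀ x) (fun j => φ j x) z := rfl

section

variable {b : ℕ → ℝ} {v₀ v₀' : E3} {v v' : ℕ → E3} {z : ℕ → ℂ} {K : ℝ}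

theorem summable_affine (hv : ∀ j, ‖v j‖ ≤ K * b j) (hz : Summable fun j => ‖z j‖ * b j) :
    Summable fun j => z j • toC3 (v j) := by
  refine Summable.of_norm_bounded (hz.mul_left K) fun j => ?_
  rw [norm_smul, norm_toC3]
  calc ‖z j‖ * ‖v j‖ ≤ ‖z j‖ * (K * b j) := by gcongr; exact hv j
    _ = _ := by ring

theorem affineC_sub (hv : ∀ j, ‖v j‖ ≤ K * b j) (hv' : ∀ j, ‖v' j‖ ≤ K * b j)
    (hz : Summable fun j => ‖z j‖ * b j) :
    affineC v₀ v z - affineC v₀' v' z = affineC (v₀ - v₀') (fun j => v j - v' j) z := by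
  rw [affineC, affineC, affineC, toC3_sub, add_sub_add_comm,
    ← (summable_affine hv hz).tsum_sub (summable_affine hv' hz)]
  simp only [toC3_sub, smul_sub]

theorem affineC_update (hv : ∀ j, ‖v j‖ ≤ K * b j) (hz : Summable fun j => ‖z j‖ * b j) (j : ℕ)
    (w : ℂ) : affineC v₀ v (update z j w) = affineC v₀ v z + (w - z j) • toC3 (v j) := by
  have h := (summable_affine hv hz).hasSum.update j (w • toC3 (v j))
  have e : (fun k => update z j w k • toC3 (v k))
      = update (fun k => z k • toC3 (v k)) j (w • toC3 (v j)) := by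
    funext k
    rcases eq_or_ne k j with rfl | hk
    · simp
    · simp [hk]
  rw [← e] at h
  rw [affineC, affineC, h.tsum_eq, sub_smul]
  abel

theorem summable_of_param (hb : ∀ j, 0 < b j) (hbs : Summable b) {y : ℕ → ℝ}
    (hy : y ∈ paramDomain) : Summable fun j => ‖toComplexParam y j‖ * b j :=
  summable_norm_mul hbs hb (mem_paramNbhd_of_real one_pos (toComplexParam_mem_unitSegment hy))

theorem summable_real_smul (hb : ∀ j, 0 < b j) (hbs : Summable b) {F : Type*}
    [NormedAddCommGroup F] [NormedSpace ℝ F] [CompleteSpace F] {v : ℕ → F}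
    (hv : ∀ j, ‖v j‖ ≤ K * b j) {y : ℕ → ℝ} (hy : y ∈ paramDomain) :
    Summable fun j => y j • v j := by
  refine Summable.of_norm_bounded ((summable_of_param hb hbs hy).mul_left K) fun j => ?_
  rw [norm_smul, toComplexParam, Complex.norm_real]
  calc ‖y j‖ * ‖v j‖ ≤ ‖y j‖ * (K * b j) := by gcongr; exact hv j
    _ = _ := by ring

theorem affineC_real (hb : ∀ j, 0 < b j) (hbs : Summable b) (hv : ∀ j, ‖v j‖ ≤ K * b j)
    {y : ℕ → ℝ} (hy : y ∈ paramDomain) :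
    affineC v₀ v (toComplexParam y) = toC3 (v₀ + ∑' j, y j • v j) := by
  rw [affineC, toC3_add, ← toC3L_apply (∑' j, y j • v j),
    toC3L.map_tsum (summable_real_smul hb hbs hv hy)]
  congr 1
  refine tsum_congr fun j => ?_
  rw [toC3L_apply, toC3_smul]
  rfl

/-- Near a point of the complex parameter neighbourhood there is a real parameter, and affine
functions take close values at the two points. -/
theorem exists_real_near (hb : ∀ j, 0 < b j) (hbs : Summable b) {η : ℝ} (hz : z ∈ paramNbhd b η) :
    ∃ y ∈ paramDomain, ∀ (v₀ : E3) (v : ℕ → E3) (K : ℝ), 0 ≤ K → (∀ j, ‖v j‖ ≤ K * b j) →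
      ‖affineC v₀ v z - affineC v₀ v (toComplexParam y)‖ ≤ K * η := by
  choose t ht htd using fun j =>
    isCompact_unitSegment.exists_infDist_eq_dist unitSegment_nonempty (z j)
  choose y hy hyt using ht
  refine ⟨y, hy, fun v₀ v K hK hv => ?_⟩
  have hs := summable_norm_mul hbs hb hz
  rw [affineC, affineC, add_sub_add_left_eq_sub,
    ← (summable_affine hv hs).tsum_sub (summable_affine hv (summable_of_param hb hbs hy))]
  have hle : ∀ j, ‖z j • toC3 (v j) - toComplexParam y j • toC3 (v j)‖
      ≤ K * (infDist (z j) unitSegment * b j) := by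
    intro j
    have e : toComplexParam y j = t j := hyt j
    rw [← sub_smul, norm_smul, norm_toC3, e, htd, dist_eq_norm]
    calc ‖z j - t j‖ * ‖v j‖ ≤ ‖z j - t j‖ * (K * b j) := by gcongr; exact hv j
      _ = _ := by ring
  calc _ ≤ ∑' j, K * (infDist (z j) unitSegment * b j) :=
        tsum_of_norm_bounded (hz.1.mul_left K).hasSum hle
    _ = K * ∑' j, infDist (z j) unitSegment * b j := tsum_mul_left
    _ ≤ K * η := mul_le_mul_of_nonneg_left hz.2.le hK

theorem abs_le_one_of_mem {y : ℕ → ℝ} (hy : y ∈ paramDomain) (j : ℕ) : |y j| ≤ 1 :=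
  abs_le.2 (hy j)

theorem continuousOn_affineC (hbs : Summable b) (hv : ∀ j, ‖v j‖ ≤ K * b j) :
    ContinuousOn (fun y => affineC v₀ v (toComplexParam y)) paramDomain := by
  refine continuousOn_const.add (continuousOn_tsum (u := fun j => K * b j) (fun j => ?_)
    (hbs.mul_left K) fun j y hy => ?_)
  · refine Continuous.continuousOn ?_
    exact (Complex.continuous_ofReal.comp (continuous_apply j)).smul continuous_const
  · rw [norm_smul, norm_toC3, toComplexParam, Complex.norm_real, Real.norm_eq_abs]
    calc |y j| * ‖v j‖ ≤ 1 * ‖v j‖ := by gcongr; exact abs_le_one_of_mem hy j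
      _ ≤ _ := by rw [one_mul]; exact hv j

end

/-! ### Boundaries, charts and the Lipschitz norm -/

theorem IsBoundedLipschitzDomain.isCompact_frontier {Ω : Set E3}
    (hΩ : IsBoundedLipschitzDomain Ω) : IsCompact (frontier Ω) :=
  Metric.isCompact_of_isClosed_isBounded isClosed_frontier
    (hΩ.isBounded.closure.subset frontier_subset_closure)

theorem IsBoundedLipschitzDomain.nonempty_frontier {Ω : Set E3}
    (hΩ : IsBoundedLipschitzDomain Ω) : (frontier Ω).Nonempty := by
  rw [nonempty_iff_ne_empty]
  intro h
  rcases isClopen_iff.1 (isClopen_iff_frontier_eq_empty.2 h) with h1 | h1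
  · exact hΩ.nonempty.ne_empty h1
  · have := hΩ.isBounded
    rw [h1] at this
    exact NormedSpace.unbounded_univ ℝ E3 this

section

variable {Γ : Set E3} {f : E3 → E3} {K : ℝ≥0}

theorem norm_le_lipNorm (hΓ : IsCompact Γ) (hf : LipschitzOnWith K f Γ) {x : E3} (hx : x ∈ Γ) :
    ‖f x‖ ≤ lipNorm Γ f := by
  obtain ⟨C, hC⟩ := hΓ.exists_bound_of_continuousOn hf.continuousOn
  have h1 : ‖f x‖ ≤ ⨆ x : Γ, ‖f x‖ :=
    le_ciSup (f := fun x : Γ => ‖f x‖) ⟨C, by rintro _ ⟨x, rfl⟩; exact hC x x.2⟩ ⟨x, hx⟩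
  have h2 : 0 ≤ ⨆ q : Γ × Γ, ‖f q.1 - f q.2‖ / ‖(q.1 : E3) - q.2‖ :=
    Real.iSup_nonneg fun q => by positivity
  rw [lipNorm]
  linarith

theorem norm_sub_le_lipNorm (hf : LipschitzOnWith K f Γ) {x x' : E3} (hx : x ∈ Γ) (hx' : x' ∈ Γ) :
    ‖f x - f x'‖ ≤ lipNorm Γ f * ‖x - x'‖ := by
  rcases eq_or_ne x x' with rfl | hne
  · simp
  have hpos : 0 < ‖x - x'‖ := norm_pos_iff.2 (sub_ne_zero.2 hne)
  rw [← div_le_iff₀ hpos]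
  have h1 : ‖f x - f x'‖ / ‖x - x'‖ ≤ ⨆ q : Γ × Γ, ‖f q.1 - f q.2‖ / ‖(q.1 : E3) - q.2‖ :=
    le_ciSup (f := fun q : Γ × Γ => ‖f q.1 - f q.2‖ / ‖(q.1 : E3) - q.2‖) ⟨K, by
      rintro _ ⟨q, rfl⟩
      refine div_le_of_le_mul₀ (norm_nonneg _) K.coe_nonneg ?_
      have := hf.dist_le_mul q.1 q.1.2 q.2 q.2.2
      rwa [dist_eq_norm, dist_eq_norm] at this⟩ (⟨x, hx⟩, ⟨x', hx'⟩)
  have h2 : 0 ≤ ⨆ x : Γ, ‖f x‖ := Real.iSup_nonneg fun q => norm_nonneg _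
  rw [lipNorm]
  linarith

end

namespace PatchDecomposition

variable {Γ : Set E3} {ι : Type*} (G : PatchDecomposition Γ ι)

theorem chart_mem {i : ι} {u : E2} (hu : u ∈ G.dom i) : G.chart i u ∈ Γ := by
  obtain ⟨V, _, hV⟩ := G.isOpen_patch i
  have : G.chart i u ∈ G.chart i '' G.dom i := mem_image_of_mem _ hu
  rw [hV] at this
  exact this.2

theorem exists_mem_dom (hΓ : Γ.Nonempty) : ∃ i, ∃ u, u ∈ G.dom i := by
  obtain ⟨x, hx⟩ := hΓ
  rw [← G.cover, mem_iUnion] at hx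
  obtain ⟨i, hi⟩ := hx
  obtain ⟨_, u, hu, _⟩ := closure_nonempty_iff.1 ⟨x, hi⟩
  exact ⟨i, u, hu⟩

theorem exists_lipschitz_const [Fintype ι] :
    ∃ L : ℝ≥0, ∀ i, LipschitzOnWith L (G.chart i) (G.dom i) := by
  choose K hK using fun i => (G.biLipschitz i).1
  exact ⟨Finset.univ.sup K, fun i => (hK i).weaken (Finset.le_sup (Finset.mem_univ i))⟩

theorem exists_antilipschitz_const [Fintype ι] :
    ∃ L : ℝ≥0, ∀ i, ∀ u ∈ G.dom i, ∀ u' ∈ G.dom i,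
      ‖u - u'‖ ≤ L * ‖G.chart i u - G.chart i u'‖ := by
  choose K hK using fun i => (G.biLipschitz i).2
  refine ⟨Finset.univ.sup K, fun i u hu u' hu' => ?_⟩
  have := hK i u hu u' hu'
  rw [dist_eq_norm, dist_eq_norm] at this
  refine this.trans ?_
  gcongr
  exact Finset.le_sup (Finset.mem_univ i)

end PatchDecomposition

theorem BiLipschitzOn.exists_lower {X Y : Type*} [SeminormedAddCommGroup X]
    [SeminormedAddCommGroup Y] {f : X → Y} {s : Set X} (hf : BiLipschitzOn f s) :
    ∃ c > 0, ∀ x ∈ s, ∀ x' ∈ s, c * ‖x - x'‖ ≤ ‖f x - f x'‖ := by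
  obtain ⟨K, hK⟩ := hf.2
  refine ⟨1 / (K + 1), by positivity, fun x hx x' hx' => ?_⟩
  have := hK x hx x' hx'
  rw [dist_eq_norm, dist_eq_norm] at this
  rw [div_mul_eq_mul_div, one_mul, div_le_iff₀ (by positivity)]
  nlinarith [norm_nonneg (f x - f x')]

theorem BiLipschitzOn.comp_chart {Γ : Set E3} {ι : Type*} (G : PatchDecomposition Γ ι)
    {r : E3 → E3} (hr : BiLipschitzOn r Γ) (i : ι) :
    BiLipschitzOn (r ∘ G.chart i) (G.dom i) := by
  obtain ⟨⟨K, hK⟩, K', hK'⟩ := hr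
  obtain ⟨⟨L, hL⟩, L', hL'⟩ := G.biLipschitz i
  refine ⟨⟨K * L, hK.comp hL fun u hu => G.chart_mem hu⟩, L' * K', fun u hu u' hu' => ?_⟩
  calc dist u u' ≤ L' * dist (G.chart i u) (G.chart i u') := hL' u hu u' hu'
    _ ≤ L' * (K' * dist (r (G.chart i u)) (r (G.chart i u'))) := by
        gcongr; exact hK' _ (G.chart_mem hu) _ (G.chart_mem hu')
    _ = _ := by push_cast; rw [mul_assoc]; rfl

/-! ### Bi-Lipschitz estimates, uniformly in the parameter -/

/-- Termwise differentiation at a single point, for series of Lipschitz functions. -/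
theorem hasFDerivAt_tsum_of_lipschitz {f : ℕ → E2 → E3} {D : ℕ → E2 →L[ℝ] E3} {u : E2}
    {s : Set E2} (hs : s ∈ 𝓝 u) {B : ℕ → ℝ} (hB : Summable B)
    (hf : ∀ j, ∀ u' ∈ s, ‖f j u' - f j u‖ ≤ B j * ‖u' - u‖) (hD : ∀ j, HasFDerivAt (f j) (D j) u)
    (hDB : ∀ j, ‖D j‖ ≤ B j) (hsum : ∀ u' ∈ s, Summable fun j => f j u') :
    HasFDerivAt (fun u' => ∑' j, f j u') (∑' j, D j) u := by
  have hDs : Summable D := Summable.of_norm_bounded hB hDB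
  rw [hasFDerivAt_iff_tendsto]
  have hlim : Tendsto (fun u' => ∑' j, ‖u' - u‖⁻¹ * ‖f j u' - f j u - D j (u' - u)‖) (𝓝 u)
      (𝓝 (∑' _ : ℕ, (0 : ℝ))) := by
    refine tendsto_tsum_of_dominated_convergence (bound := fun j => 2 * B j) (hB.mul_left 2)
      (fun j => hasFDerivAt_iff_tendsto.1 (hD j)) ?_
    filter_upwards [hs] with u' hu' j
    rw [Real.norm_of_nonneg (by positivity)]
    rcases eq_or_ne u' u with rfl | hne
    · have : 0 ≤ B j := (norm_nonneg _).trans (hDB j)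
      simp; positivity
    · have hpos : 0 < ‖u' - u‖ := norm_pos_iff.2 (sub_ne_zero.2 hne)
      rw [inv_mul_le_iff₀ hpos]
      have h1 := hf j u' hu'
      have h2 : ‖D j (u' - u)‖ ≤ B j * ‖u' - u‖ :=
        ((D j).le_opNorm _).trans (by gcongr; exact hDB j)
      have h3 := norm_sub_le (f j u' - f j u) (D j (u' - u))
      linarith
  rw [tsum_zero] at hlim
  refine squeeze_zero' (Eventually.of_forall fun u' => by positivity) ?_ hlim
  filter_upwards [hs] with u' hu'
  have hDv : Summable fun j => D j (u' - u) := hDs.mapL (ContinuousLinearMap.apply ℝ E3 (u' - u))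
  have e : (∑' j, f j u') - (∑' j, f j u) - (∑' j, D j) (u' - u)
      = ∑' j, (f j u' - f j u - D j (u' - u)) := by
    rw [((hsum u' hu').sub (hsum u (mem_of_mem_nhds hs))).tsum_sub hDv,
      (hsum u' hu').tsum_sub (hsum u (mem_of_mem_nhds hs))]
    congr 1
    exact (ContinuousLinearMap.apply ℝ E3 (u' - u)).map_tsum hDs
  have hns : Summable fun j => ‖f j u' - f j u - D j (u' - u)‖ := by
    refine Summable.of_nonneg_of_le (fun j => norm_nonneg _) (fun j => ?_)
      (hB.mul_right (2 * ‖u' - u‖))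
    have h1 := hf j u' hu'
    have h2 : ‖D j (u' - u)‖ ≤ B j * ‖u' - u‖ :=
      ((D j).le_opNorm _).trans (by gcongr; exact hDB j)
    have h3 := norm_sub_le (f j u' - f j u) (D j (u' - u))
    linarith
  rw [e, tsum_mul_left]
  gcongr
  exact norm_tsum_le_tsum_norm hns

section

variable {Γ : Set E3} {φ₀ : E3 → E3} {φ : ℕ → E3 → E3} {p : ℝ}

theorem AffineParametric.norm_le (h : AffineParametric Γ φ₀ φ p) (hΓ : IsCompact Γ) (j : ℕ)
    {x : E3} (hx : x ∈ Γ) : ‖φ j x‖ ≤ normSeq Γ φ j := by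
  obtain ⟨K, hK⟩ := h.lipschitz j
  exact norm_le_lipNorm hΓ hK hx

theorem AffineParametric.norm_sub_le (h : AffineParametric Γ φ₀ φ p) (j : ℕ)
    {x x' : E3} (hx : x ∈ Γ) (hx' : x' ∈ Γ) : ‖φ j x - φ j x'‖ ≤ ‖x - x'‖ * normSeq Γ φ j := by
  obtain ⟨K, hK⟩ := h.lipschitz j
  rw [mul_comm]
  exact norm_sub_le_lipNorm hK hx hx'

theorem AffineParametric.summable_normSeq (h : AffineParametric Γ φ₀ φ p)
    (hb : ∀ j, 0 < normSeq Γ φ j) : Summable (normSeq Γ φ) := by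
  have hlim := h.summable.tendsto_atTop_zero
  have hev := hlim.eventually_lt_const (show (0 : ℝ) < 1 from one_pos)
  refine Summable.of_norm_bounded_eventually_nat h.summable ?_
  filter_upwards [hev] with j hj
  have hb1 : normSeq Γ φ j ≤ 1 := by
    by_contra! hlt
    exact absurd hj (not_lt.2 (Real.one_le_rpow hlt.le h.p_pos.le))
  rw [Real.norm_of_nonneg (hb j).le]
  calc normSeq Γ φ j = normSeq Γ φ j ^ (1 : ℝ) := (Real.rpow_one _).symm
    _ ≤ _ := Real.rpow_le_rpow_of_exponent_ge (hb j) hb1 h.p_lt_one.le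

variable (h : AffineParametric Γ φ₀ φ p) (hΓ : IsCompact Γ) (hb : ∀ j, 0 < normSeq Γ φ j)

include h hΓ hb

theorem AffineParametric.transfC_real {y : ℕ → ℝ} (hy : y ∈ paramDomain) {x : E3} (hx : x ∈ Γ) :
    transfC φ₀ φ (toComplexParam y) x = toC3 (transf φ₀ φ y x) :=
  affineC_real hb (h.summable_normSeq hb) (K := 1)
    (fun j => by rw [one_mul]; exact h.norm_le hΓ j hx) hy

omit hb in
theorem AffineParametric.transfC_sub {z : ℕ → ℂ} (hz : Summable fun j => ‖z j‖ * normSeq Γ φ j)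
    {x x' : E3} (hx : x ∈ Γ) (hx' : x' ∈ Γ) : transfC φ₀ φ z x - transfC φ₀ φ z x'
      = affineC (φ₀ x - φ₀ x') (fun j => φ j x - φ j x') z :=
  affineC_sub (K := 1) (fun j => by rw [one_mul]; exact h.norm_le hΓ j hx)
    (fun j => by rw [one_mul]; exact h.norm_le hΓ j hx') hz

/-- The bi-Lipschitz constants of the boundary transformations are uniform, by compactness of the
parameter domain. -/
theorem AffineParametric.exists_lower_const :
    ∃ c > 0, ∀ y ∈ paramDomain, ∀ x ∈ Γ, ∀ x' ∈ Γ,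
      c * ‖x - x'‖ ≤ ‖transf φ₀ φ y x - transf φ₀ φ y x'‖ := by
  have hbs := h.summable_normSeq hb
  have hvar : ∀ y ∈ paramDomain, ∀ y' ∈ paramDomain, ∀ x ∈ Γ, ∀ x' ∈ Γ,
      ‖(transf φ₀ φ y x - transf φ₀ φ y x') - (transf φ₀ φ y' x - transf φ₀ φ y' x')‖
        ≤ (∑' j, |y' j - y j| * normSeq Γ φ j) * ‖x - x'‖ := by
    intro y hy y' hy' x hx x' hx'
    have hs : ∀ {y x}, y ∈ paramDomain → x ∈ Γ → Summable fun j => y j • φ j x := fun hy hx =>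
      summable_real_smul hb hbs (K := 1) (fun j => by rw [one_mul]; exact h.norm_le hΓ j hx) hy
    have e : (transf φ₀ φ y x - transf φ₀ φ y x') - (transf φ₀ φ y' x - transf φ₀ φ y' x')
        = ∑' j, (y j - y' j) • (φ j x - φ j x') := by
      have e1 : ∀ j, (y j - y' j) • (φ j x - φ j x')
          = (y j • φ j x - y j • φ j x') - (y' j • φ j x - y' j • φ j x') := fun j => by
        rw [sub_smul, smul_sub, smul_sub]
      simp_rw [e1]
      rw [((hs hy hx).sub (hs hy hx')).tsum_sub ((hs hy' hx).sub (hs hy' hx')),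
        (hs hy hx).tsum_sub (hs hy hx'), (hs hy' hx).tsum_sub (hs hy' hx')]
      simp only [transf]
      abel
    have hsum : Summable fun j => |y' j - y j| * normSeq Γ φ j := by
      refine Summable.of_nonneg_of_le (fun j => mul_nonneg (abs_nonneg _) (hb j).le) (fun j => ?_)
        (hbs.mul_left 2)
      refine mul_le_mul_of_nonneg_right ?_ (hb j).le
      have h1 := hy j; have h2 := hy' j
      rw [abs_le]; constructor <;> linarith [h1.1, h1.2, h2.1, h2.2]
    rw [e, ← tsum_mul_right]
    refine tsum_of_norm_bounded (hsum.mul_right _).hasSum fun j => ?_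
    rw [norm_smul, Real.norm_eq_abs, abs_sub_comm, mul_assoc]
    gcongr
    rw [mul_comm]
    exact h.norm_sub_le j hx hx'
  have key := KernelPoint.isCompact_paramDomain.induction_on
    (p := fun S : Set (ℕ → ℝ) => ∃ c > 0, ∀ y ∈ S, y ∈ paramDomain → ∀ x ∈ Γ, ∀ x' ∈ Γ,
      c * ‖x - x'‖ ≤ ‖transf φ₀ φ y x - transf φ₀ φ y x'‖)
    ⟨1, one_pos, by simp⟩
    (fun S T hST ⟨c, hc, hT⟩ => ⟨c, hc, fun y hy => hT y (hST hy)⟩)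
    (fun S T ⟨c, hc, hS⟩ ⟨c', hc', hT⟩ => ⟨min c c', lt_min hc hc', fun y hy hyp x hx x' hx' => by
      rcases hy with hy | hy
      · refine le_trans ?_ (hS y hy hyp x hx x' hx')
        gcongr
        exact min_le_left _ _
      · refine le_trans ?_ (hT y hy hyp x hx x' hx')
        gcongr
        exact min_le_right _ _⟩)
    (fun y hy => by
      obtain ⟨c, hc, hyc⟩ := (h.biLipschitz y hy).exists_lower
      have hcont : ContinuousOn (fun y' : ℕ → ℝ => ∑' j, |y' j - y j| * normSeq Γ φ j)
          paramDomain := by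
        refine continuousOn_tsum (u := fun j => 2 * normSeq Γ φ j) (fun j => ?_)
          (hbs.mul_left 2) fun j y' hy' => ?_
        · exact Continuous.continuousOn (by fun_prop)
        · rw [Real.norm_of_nonneg (mul_nonneg (abs_nonneg _) (hb j).le)]
          refine mul_le_mul_of_nonneg_right ?_ (hb j).le
          have h1 := hy j; have h2 := hy' j
          rw [abs_le]; constructor <;> linarith [h1.1, h1.2, h2.1, h2.2]
      have hlim := (hcont y hy).tendsto
      simp only [sub_self, abs_zero, zero_mul, tsum_zero] at hlim
      refine ⟨_, hlim.eventually_lt_const (half_pos hc), c / 2, half_pos hc,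
        fun y' hy' hyp x hx x' hx' => ?_⟩
      have h1 := hyc x hx x' hx'
      have h2 := hvar y hy y' hyp x hx x' hx'
      have h3 : (∑' j, |y' j - y j| * normSeq Γ φ j) * ‖x - x'‖ ≤ c / 2 * ‖x - x'‖ :=
        mul_le_mul_of_nonneg_right (le_of_lt hy') (norm_nonneg _)
      have h4 := norm_sub_norm_le (transf φ₀ φ y x - transf φ₀ φ y x')
        (transf φ₀ φ y' x - transf φ₀ φ y' x')
      linarith)
  obtain ⟨c, hc, hk⟩ := key
  exact ⟨c, hc, fun y hy => hk y hy hy⟩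

/-- For parameters close to the real parameter domain, differences of complexified boundary points
stay in the domain of the kernel and are bounded below. -/
theorem AffineParametric.transfC_sub_mem {c : ℝ} (hc0 : 0 < c)
    (hc : ∀ y ∈ paramDomain, ∀ x ∈ Γ, ∀ x' ∈ Γ,
      c * ‖x - x'‖ ≤ ‖transf φ₀ φ y x - transf φ₀ φ y x'‖)
    {z : ℕ → ℂ} (hz : z ∈ paramNbhd (normSeq Γ φ) (c / 4)) {x x' : E3} (hx : x ∈ Γ)
    (hx' : x' ∈ Γ) (hne : x ≠ x') :
    transfC φ₀ φ z x - transfC φ₀ φ z x' ∈ kernelDomain ∧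
      c / 2 * ‖x - x'‖ ≤ ‖transfC φ₀ φ z x - transfC φ₀ φ z x'‖ := by
  have hbs := h.summable_normSeq hb
  obtain ⟨y, hy, hyz⟩ := exists_real_near hb hbs hz
  have h1 := hyz (φ₀ x - φ₀ x') (fun j => φ j x - φ j x') ‖x - x'‖ (norm_nonneg _)
    (fun j => h.norm_sub_le j hx hx')
  rw [← h.transfC_sub hΓ (summable_norm_mul hbs hb hz) hx hx',
    ← h.transfC_sub hΓ (summable_of_param hb hbs hy) hx hx', h.transfC_real hΓ hb hy hx,
    h.transfC_real hΓ hb hy hx', ← toC3_sub] at h1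
  have h2 := hc y hy x hx x' hx'
  set ξ := transf φ₀ φ y x - transf φ₀ φ y x' with hξ
  set δ := transfC φ₀ φ z x - transfC φ₀ φ z x' - toC3 ξ with hδ
  have e : transfC φ₀ φ z x - transfC φ₀ φ z x' = toC3 ξ + δ := by rw [hδ]; abel
  have hpos : 0 < ‖x - x'‖ := norm_pos_iff.2 (sub_ne_zero.2 hne)
  have hξ0 : ξ ≠ 0 := by
    rw [← norm_pos_iff]
    exact lt_of_lt_of_le (by positivity) h2
  rw [e]
  refine ⟨toC3_add_mem_kernelDomain hξ0 (h1.trans (by linarith)), ?_⟩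
  have h3 := _root_.norm_sub_le (toC3 ξ + δ) δ
  rw [add_sub_cancel_right, norm_toC3] at h3
  have := mul_pos hc0 hpos
  linarith

end

/-! ### The complexified surface density -/

section

variable {Γ : Set E3} {ι : Type*} (G : PatchDecomposition Γ ι) (φ₀ : E3 → E3) (φ : ℕ → E3 → E3)

/-- All the functions of the expansion, in local coordinates, are differentiable at `u`. -/
def IsRegularPoint (i : ι) (u : E2) : Prop :=
  u ∈ G.dom i ∧ DifferentiableAt ℝ (φ₀ ∘ G.chart i) u ∧
    ∀ j, DifferentiableAt ℝ (φ j ∘ G.chart i) u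

/-- The complexified tangent vectors of the transformed boundary in local coordinates. -/
noncomputable def tangentC (i : ι) (u : E2) (k : Fin 2) (z : ℕ → ℂ) : C3 :=
  affineC (fderiv ℝ (φ₀ ∘ G.chart i) u (EuclideanSpace.single k 1))
    (fun j => fderiv ℝ (φ j ∘ G.chart i) u (EuclideanSpace.single k 1)) z

/-- The holomorphic continuation, in the parameter, of the surface density: the principal square
root of the bilinear Gram determinant. -/
noncomputable def densityC (i : ι) (u : E2) (z : ℕ → ℂ) : ℂ :=
  gramC (tangentC G φ₀ φ i u 0 z) (tangentC G φ₀ φ i u 1 z) ^ ((1 / 2 : ℝ) : ℂ)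

variable {G φ₀ φ} {p : ℝ} (h : AffineParametric Γ φ₀ φ p) (hΓ : IsCompact Γ)
  (hb : ∀ j, 0 < normSeq Γ φ j) {L : ℝ≥0} (hL : ∀ i, LipschitzOnWith L (G.chart i) (G.dom i))

include h in
theorem ae_isRegularPoint (i : ι) :
    ∀ᵐ u ∂volume.restrict (G.dom i), IsRegularPoint G φ₀ φ i u := by
  have hm : MeasurableSet (G.dom i) := (G.isOpen_dom i).measurableSet
  have hd : ∀ {f : E3 → E3}, (∃ K : ℝ≥0, LipschitzOnWith K f Γ) →
      ∀ᵐ u ∂volume.restrict (G.dom i), DifferentiableAt ℝ (f ∘ G.chart i) u := by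
    rintro f ⟨K, hK⟩
    obtain ⟨K', hK'⟩ := (G.biLipschitz i).1
    filter_upwards [(hK.comp hK' fun u hu => G.chart_mem hu).ae_differentiableWithinAt hm,
      ae_restrict_mem hm] with u hu hmem
    exact hu.differentiableAt ((G.isOpen_dom i).mem_nhds hmem)
  filter_upwards [ae_restrict_mem hm, hd h.lipschitz_zero,
    ae_all_iff.2 fun j => hd (h.lipschitz j)] with u h1 h2 h3
  exact ⟨h1, h2, h3⟩

include h hL in
theorem norm_fderiv_comp_le {i : ι} {u : E2} (hu : IsRegularPoint G φ₀ φ i u) (j : ℕ) :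
    ‖fderiv ℝ (φ j ∘ G.chart i) u‖ ≤ L * normSeq Γ φ j := by
  have hnn : 0 ≤ normSeq Γ φ j := by
    rw [normSeq, lipNorm]
    exact add_nonneg (Real.iSup_nonneg fun _ => norm_nonneg _)
      (Real.iSup_nonneg fun _ => by positivity)
  refine (hu.2.2 j).hasFDerivAt.le_of_lip' (by positivity) ?_
  filter_upwards [(G.isOpen_dom i).mem_nhds hu.1] with u' hu'
  refine (h.norm_sub_le j (G.chart_mem hu') (G.chart_mem hu.1)).trans ?_
  have := (hL i).norm_sub_le hu' hu.1
  calc ‖G.chart i u' - G.chart i u‖ * normSeq Γ φ j ≤ L * ‖u' - u‖ * normSeq Γ φ j := by gcongr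
    _ = _ := by ring

include h hL in
theorem norm_fderiv_single_le {i : ι} {u : E2} (hu : IsRegularPoint G φ₀ φ i u) (k : Fin 2)
    (j : ℕ) :
    ‖fderiv ℝ (φ j ∘ G.chart i) u (EuclideanSpace.single k 1)‖ ≤ L * normSeq Γ φ j := by
  refine ((fderiv ℝ (φ j ∘ G.chart i) u).le_opNorm _).trans ?_
  rw [PiLp.norm_single, norm_one, mul_one]
  exact norm_fderiv_comp_le h hL hu j

include h hΓ hb hL in
theorem hasFDerivAt_transf_comp {i : ι} {u : E2} (hu : IsRegularPoint G φ₀ φ i u) {y : ℕ → ℝ}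
    (hy : y ∈ paramDomain) :
    HasFDerivAt (transf φ₀ φ y ∘ G.chart i) (fderiv ℝ (φ₀ ∘ G.chart i) u
      + ∑' j, y j • fderiv ℝ (φ j ∘ G.chart i) u) u := by
  have hbs := h.summable_normSeq hb
  refine hu.2.1.hasFDerivAt.add (hasFDerivAt_tsum_of_lipschitz
    (f := fun j u' => y j • φ j (G.chart i u')) (s := G.dom i)
    ((G.isOpen_dom i).mem_nhds hu.1) (B := fun j => L * normSeq Γ φ j) (hbs.mul_left _)
    (fun j u' hu' => ?_) (fun j => (hu.2.2 j).hasFDerivAt.const_smul (y j)) (fun j => ?_)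
    (fun u' hu' => summable_real_smul hb hbs (K := 1) (fun j => ?_) hy))
  · rw [← smul_sub, norm_smul, Real.norm_eq_abs]
    have h1 := h.norm_sub_le j (G.chart_mem hu') (G.chart_mem hu.1)
    have h2 := (hL i).norm_sub_le hu' hu.1
    calc |y j| * ‖φ j (G.chart i u') - φ j (G.chart i u)‖
        ≤ 1 * (L * ‖u' - u‖ * normSeq Γ φ j) := by
          have := (hb j).le
          refine mul_le_mul (abs_le_one_of_mem hy j) (h1.trans ?_) (norm_nonneg _) zero_le_one
          gcongr
      _ = _ := by ring
  · rw [norm_smul, Real.norm_eq_abs]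
    calc _ ≤ 1 * (L * normSeq Γ φ j) := by
          refine mul_le_mul (abs_le_one_of_mem hy j) (norm_fderiv_comp_le h hL hu j)
            (norm_nonneg _) zero_le_one
      _ = _ := one_mul _
  · rw [one_mul]; exact h.norm_le hΓ j (G.chart_mem hu')

include h hΓ hb hL in
theorem tangentC_real {i : ι} {u : E2} (hu : IsRegularPoint G φ₀ φ i u) (k : Fin 2) {y : ℕ → ℝ}
    (hy : y ∈ paramDomain) : tangentC G φ₀ φ i u k (toComplexParam y)
      = toC3 (fderiv ℝ (transf φ₀ φ y ∘ G.chart i) u (EuclideanSpace.single k 1)) := by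
  have hbs := h.summable_normSeq hb
  rw [tangentC, affineC_real hb hbs (norm_fderiv_single_le h hL hu k) hy,
    (hasFDerivAt_transf_comp h hΓ hb hL hu hy).fderiv]
  congr 2
  have hs : Summable fun j => y j • fderiv ℝ (φ j ∘ G.chart i) u :=
    summable_real_smul hb hbs (norm_fderiv_comp_le h hL hu) hy
  exact ((ContinuousLinearMap.apply ℝ E3 (EuclideanSpace.single k 1)).map_tsum hs).symm

include h hΓ hb hL in
theorem gramC_tangentC_real {i : ι} {u : E2} (hu : IsRegularPoint G φ₀ φ i u) {y : ℕ → ℝ}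
    (hy : y ∈ paramDomain) : gramC (tangentC G φ₀ φ i u 0 (toComplexParam y))
      (tangentC G φ₀ φ i u 1 (toComplexParam y)) = (gramDet (transf φ₀ φ y ∘ G.chart i) u : ℂ) := by
  rw [tangentC_real h hΓ hb hL hu 0 hy, tangentC_real h hΓ hb hL hu 1 hy, gramC_toC3, gramDet_eq]

include h hΓ hb hL in
theorem densityC_real {i : ι} {u : E2} (hu : IsRegularPoint G φ₀ φ i u) {y : ℕ → ℝ}
    (hy : y ∈ paramDomain) (h0 : 0 ≤ gramDet (transf φ₀ φ y ∘ G.chart i) u) :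
    densityC G φ₀ φ i u (toComplexParam y) = (√(gramDet (transf φ₀ φ y ∘ G.chart i) u) : ℂ) := by
  rw [densityC, gramC_tangentC_real h hΓ hb hL hu hy, ← Complex.ofReal_cpow h0,
    ← Real.sqrt_eq_rpow]

include h hΓ hb hL in
/-- For parameters in a suitable neighbourhood of the real parameter domain the complexified Gram
determinant has positive real part, and it is bounded. -/
theorem exists_gramC_bounds {c : ℝ} (hc0 : 0 < c)
    (hc : ∀ i, ∀ y ∈ paramDomain, ∀ u ∈ G.dom i, ∀ u' ∈ G.dom i, c * ‖u - u'‖ ≤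
      ‖transf φ₀ φ y (G.chart i u) - transf φ₀ φ y (G.chart i u')‖) :
    ∃ η > 0, ∃ M : ℝ, ∀ i u, IsRegularPoint G φ₀ φ i u → ∀ z ∈ paramNbhd (normSeq Γ φ) η,
      0 < (gramC (tangentC G φ₀ φ i u 0 z) (tangentC G φ₀ φ i u 1 z)).re ∧
      ‖gramC (tangentC G φ₀ φ i u 0 z) (tangentC G φ₀ φ i u 1 z)‖ ≤ M := by
  have hbs := h.summable_normSeq hb
  obtain ⟨K₀, hK₀⟩ := h.lipschitz_zero
  set B := ∑' j, normSeq Γ φ j with hB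
  have hB0 : 0 ≤ B := tsum_nonneg fun j => (hb j).le
  set Λ : ℝ := K₀ * L + L * B + 1 with hΛ
  have hΛ1 : 1 ≤ Λ := by rw [hΛ]; have : (0 : ℝ) ≤ K₀ * L + L * B := by positivity
                         linarith
  -- a perturbation of the tangent vectors by at most `θ` changes the Gram determinant by at most
  -- half of its lower bound `c ^ 4`
  set θ : ℝ := min 1 (c ^ 4 / (60 * Λ ^ 3)) with hθ
  have hθ0 : 0 < θ := by positivity
  refine ⟨θ / (L + 1), by positivity, 30 * Λ ^ 3 * θ + Λ ^ 4, fun i u hu z hz => ?_⟩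
  obtain ⟨y, hy, hyz⟩ := exists_real_near hb hbs hz
  set v : Fin 2 → E3 := fun k =>
    fderiv ℝ (transf φ₀ φ y ∘ G.chart i) u (EuclideanSpace.single k 1) with hv
  set δ : Fin 2 → C3 := fun k => tangentC G φ₀ φ i u k z - toC3 (v k) with hδ
  have hδθ : ∀ k, ‖δ k‖ ≤ θ := by
    intro k
    have h1 := hyz (fderiv ℝ (φ₀ ∘ G.chart i) u (EuclideanSpace.single k 1)) _ L L.coe_nonneg
      (norm_fderiv_single_le h hL hu k)
    have e := tangentC_real h hΓ hb hL hu k hy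
    simp only [hδ, hv]
    rw [← e]
    refine h1.trans ?_
    rw [mul_div_assoc', div_le_iff₀ (by positivity)]
    nlinarith
  have hlip : ‖fderiv ℝ (transf φ₀ φ y ∘ G.chart i) u‖ ≤ Λ := by
    rw [(hasFDerivAt_transf_comp h hΓ hb hL hu hy).fderiv]
    have h1 : ‖fderiv ℝ (φ₀ ∘ G.chart i) u‖ ≤ K₀ * L := by
      have := hu.2.1.hasFDerivAt.le_of_lipschitzOn ((G.isOpen_dom i).mem_nhds hu.1)
        (hK₀.comp (hL i) fun u hu => G.chart_mem hu)
      exact_mod_cast this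
    have h2 : ‖∑' j, y j • fderiv ℝ (φ j ∘ G.chart i) u‖ ≤ L * B := by
      refine tsum_of_norm_bounded (hbs.hasSum.mul_left (L : ℝ)) fun j => ?_
      rw [norm_smul, Real.norm_eq_abs]
      calc _ ≤ 1 * (L * normSeq Γ φ j) := mul_le_mul (abs_le_one_of_mem hy j)
            (norm_fderiv_comp_le h hL hu j) (norm_nonneg _) zero_le_one
        _ = _ := one_mul _
    refine (norm_add_le _ _).trans ?_
    linarith
  have hvΛ : ∀ k, ‖v k‖ ≤ Λ := by
    intro k
    refine ((fderiv ℝ (transf φ₀ φ y ∘ G.chart i) u).le_opNorm _).trans ?_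
    rw [PiLp.norm_single, norm_one, mul_one]
    exact hlip
  have hgram : c ^ 4 ≤ gramR (v 0) (v 1) := by
    rw [hv, ← gramDet_eq]
    have hbl := (h.biLipschitz y hy).comp_chart G i
    obtain ⟨K, hK⟩ := hbl.1
    exact (gramDet_bounds (G.isOpen_dom i) hu.1
      (hasFDerivAt_transf_comp h hΓ hb hL hu hy).differentiableAt hc0 (hc i y hy) hK).1
  have hpert := norm_gramC_add_sub_le (hvΛ 0) (hvΛ 1) (hδθ 0) (hδθ 1)
    ((min_le_left _ _).trans hΛ1)
  have e : ∀ k, toC3 (v k) + δ k = tangentC G φ₀ φ i u k z := fun k => by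
    simp only [hδ]; abel
  rw [e, e] at hpert
  have hsmall : 30 * Λ ^ 3 * θ ≤ c ^ 4 / 2 := by
    have : θ ≤ c ^ 4 / (60 * Λ ^ 3) := min_le_right _ _
    calc 30 * Λ ^ 3 * θ ≤ 30 * Λ ^ 3 * (c ^ 4 / (60 * Λ ^ 3)) := by gcongr
      _ = _ := by field_simp; norm_num
  constructor
  · have h1 := (Complex.abs_re_le_norm _).trans hpert
    rw [Complex.sub_re, Complex.ofReal_re] at h1
    have h2 := (abs_le.1 h1).1
    have : 0 < c ^ 4 := by positivity
    linarith
  · have h1 := norm_sub_norm_le (gramC (tangentC G φ₀ φ i u 0 z) (tangentC G φ₀ φ i u 1 z))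
      (gramR (v 0) (v 1) : ℝ)
    have h2 : ‖((gramR (v 0) (v 1) : ℝ) : ℂ)‖ ≤ Λ ^ 4 := by
      rw [Complex.norm_real, Real.norm_of_nonneg (le_trans (by positivity) hgram)]
      exact gramR_le (hvΛ 0) (hvΛ 1)
    linarith

theorem norm_cpow_half_le {ζ : ℂ} {M : ℝ} (h : ‖ζ‖ ≤ M) :
    ‖ζ ^ ((1 / 2 : ℝ) : ℂ)‖ ≤ M ^ (1 / 2 : ℝ) := by
  rw [Complex.norm_cpow_real]
  exact Real.rpow_le_rpow (norm_nonneg _) h (by norm_num)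

include h hL hb in
theorem differentiableAt_densityC {i : ι} {u : E2} (hu : IsRegularPoint G φ₀ φ i u) {η : ℝ}
    {z : ℕ → ℂ} (hz : z ∈ paramNbhd (normSeq Γ φ) η)
    (hre : 0 < (gramC (tangentC G φ₀ φ i u 0 z) (tangentC G φ₀ φ i u 1 z)).re) (j : ℕ) :
    DifferentiableAt ℂ (fun w => densityC G φ₀ φ i u (update z j w)) (z j) := by
  have hs := summable_norm_mul (h.summable_normSeq hb) hb hz
  have hT : ∀ k, (fun w => tangentC G φ₀ φ i u k (update z j w)) = fun w =>
      tangentC G φ₀ φ i u k z + (w - z j) •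
        toC3 (fderiv ℝ (φ j ∘ G.chart i) u (EuclideanSpace.single k 1)) := fun k =>
    funext fun w => affineC_update (norm_fderiv_single_le h hL hu k) hs j w
  have hTd : ∀ k, Differentiable ℂ fun w => tangentC G φ₀ φ i u k (update z j w) := fun k => by
    rw [hT k]; fun_prop
  refine DifferentiableAt.cpow_const (f := fun w => gramC
    (tangentC G φ₀ φ i u 0 (update z j w)) (tangentC G φ₀ φ i u 1 (update z j w))) ?_ ?_
  · exact (((differentiable_dotC (hTd 0) (hTd 0)).mul (differentiable_dotC (hTd 1) (hTd 1))).sub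
      ((differentiable_dotC (hTd 0) (hTd 1)).mul (differentiable_dotC (hTd 0) (hTd 1)))) _
  · rw [update_eq_self]
    exact Or.inl hre

theorem continuous_gramC : Continuous fun q : C3 × C3 => gramC q.1 q.2 := by
  unfold gramC
  have h1 := continuous_dotC.comp ((continuous_fst (X := C3) (Y := C3)).prodMk continuous_fst)
  have h2 := continuous_dotC.comp ((continuous_snd (X := C3) (Y := C3)).prodMk continuous_snd)
  exact (h1.mul h2).sub (continuous_dotC.mul continuous_dotC)

include h hL hb in
theorem continuousOn_densityC {i : ι} {u : E2} (hu : IsRegularPoint G φ₀ φ i u)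
    (hre : ∀ y ∈ paramDomain, 0 < (gramC (tangentC G φ₀ φ i u 0 (toComplexParam y))
      (tangentC G φ₀ φ i u 1 (toComplexParam y))).re) :
    ContinuousOn (fun y => densityC G φ₀ φ i u (toComplexParam y)) paramDomain := by
  have hT : ∀ k, ContinuousOn (fun y => tangentC G φ₀ φ i u k (toComplexParam y)) paramDomain :=
    fun k => continuousOn_affineC (h.summable_normSeq hb) (norm_fderiv_single_le h hL hu k)
  exact (continuous_gramC.comp_continuousOn ((hT 0).prodMk (hT 1))).cpow_const
    fun y hy => Complex.mem_slitPlane_iff.2 (Or.inl (hre y hy))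

end

/-! ### Surface measures -/

/-- A bi-Lipschitz map has a left inverse that is defined and Lipschitz on the whole space. -/
theorem BiLipschitzOn.exists_leftInverse {X Y : Type*} [NormedAddCommGroup X] [NormedSpace ℝ X]
    [FiniteDimensional ℝ X] [PseudoMetricSpace Y] {f : X → Y} {s : Set X}
    (hf : BiLipschitzOn f s) :
    ∃ (K : ℝ≥0) (g : Y → X), LipschitzWith K g ∧ ∀ x ∈ s, g (f x) = x := by
  obtain ⟨K, hK⟩ := hf.2
  have hinj : InjOn f s := fun x hx x' hx' e => by
    have := hK x hx x' hx'
    rw [e, dist_self, mul_zero] at this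
    exact dist_le_zero.1 this
  have hl : LipschitzOnWith K (Function.invFunOn f s) (f '' s) := by
    refine LipschitzOnWith.of_dist_le_mul ?_
    rintro _ ⟨x, hx, rfl⟩ _ ⟨x', hx', rfl⟩
    rw [hinj.leftInvOn_invFunOn hx, hinj.leftInvOn_invFunOn hx']
    exact hK x hx x' hx'
  obtain ⟨g, hg, he⟩ := hl.extend_finite_dimension
  refine ⟨_, g, hg, fun x hx => ?_⟩
  rw [← he (mem_image_of_mem f hx), hinj.leftInvOn_invFunOn hx]

/-- Functions on the image of an injective parametrization are integrable if they are so in the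
parametrization, and then their integrals agree; no measurability of the function itself is
presupposed. -/
theorem integrable_map_of_leftInverse {P E : Type*} [MeasurableSpace P] [MeasurableSpace E]
    [MeasurableSingletonClass E] [MeasurableEq E] {μ : Measure P} {X : P → E} {g : E → P}
    (hX : AEMeasurable X μ) (hg : Measurable g) (hgX : ∀ᵐ q ∂μ, g (X q) = q) {h : E → ℂ}
    (hi : Integrable (fun q => h (X q)) μ) :
    Integrable h (μ.map X) ∧ ∫ x, h x ∂μ.map X = ∫ q, h (X q) ∂μ := by
  have hmap : (μ.map X).map g = μ := by
    rw [AEMeasurable.map_map_of_aemeasurable hg.aemeasurable hX]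
    calc μ.map (g ∘ X) = μ.map id := Measure.map_congr hgX
      _ = μ := Measure.map_id
  have hq : Measure.QuasiMeasurePreserving g (μ.map X) μ :=
    ⟨hg, by rw [hmap]⟩
  have h1 : ∀ᵐ x ∂μ.map X, hX.mk X (g x) = x := by
    rw [ae_map_iff (p := fun x => hX.mk X (g x) = x) hX
      (measurableSet_eq_fun (hX.measurable_mk.comp hg) measurable_id)]
    filter_upwards [hgX, hX.ae_eq_mk] with q hq1 hq2
    rw [hq1, ← hq2]
  have h2 : ∀ᵐ x ∂μ.map X, X (g x) = x := by
    filter_upwards [h1, hq.ae hX.ae_eq_mk] with x h1 h2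
    rw [h2, h1]
  have hm : AEStronglyMeasurable h (μ.map X) := by
    refine (hi.aestronglyMeasurable.comp_quasiMeasurePreserving hq).congr ?_
    filter_upwards [h2] with x hx
    simp [hx]
  exact ⟨(integrable_map_measure hm hX).2 hi, integral_map hX hm⟩

namespace PatchDecomposition

variable {Γ : Set E3} {ι : Type*} (G : PatchDecomposition Γ ι) {r : E3 → E3}

theorem measurableSet_dom (i : ι) : MeasurableSet (G.dom i) := (G.isOpen_dom i).measurableSet

theorem aemeasurable_comp_chart (hr : BiLipschitzOn r Γ) (i : ι) :
    AEMeasurable (r ∘ G.chart i) (volume.restrict (G.dom i)) := by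
  obtain ⟨K, hK⟩ := (hr.comp_chart G i).1
  exact hK.continuousOn.aemeasurable (G.measurableSet_dom i)

theorem biLipschitzOn_id : BiLipschitzOn (id : E3 → E3) Γ :=
  ⟨⟨1, LipschitzWith.id.lipschitzOnWith⟩, 1, fun x _ x' _ => by simp⟩

theorem aemeasurable_chart (i : ι) : AEMeasurable (G.chart i) (volume.restrict (G.dom i)) :=
  G.aemeasurable_comp_chart biLipschitzOn_id i

theorem measurable_gramDet (f : E2 → E3) : Measurable (gramDet f) := by
  have h : ∀ k : Fin 2, Measurable fun u => fderiv ℝ f u (EuclideanSpace.single k 1) := fun k =>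
    measurable_fderiv_apply_const ℝ f _
  have e : gramDet f = fun u => gramR (fderiv ℝ f u (EuclideanSpace.single 0 1))
      (fderiv ℝ f u (EuclideanSpace.single 1 1)) := funext fun u => gramDet_eq f u
  rw [e]
  unfold gramR
  fun_prop

/-- The density of the surface measure of `r '' Γ` in local coordinates. -/
noncomputable def surfaceDensity (r : E3 → E3) (i : ι) (u : E2) : ℝ≥0∞ :=
  ENNReal.ofReal √(gramDet (r ∘ G.chart i) u)

theorem measurable_surfaceDensity (i : ι) : Measurable (G.surfaceDensity r i) :=
  (measurable_gramDet _).sqrt.ennreal_ofReal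

variable [Fintype ι]

theorem exists_surfaceDensity_bounds (hr : BiLipschitzOn r Γ) :
    ∃ c Λ : ℝ≥0, c ≠ 0 ∧ ∀ i, ∀ᵐ u ∂volume.restrict (G.dom i),
      (c : ℝ≥0∞) ≤ G.surfaceDensity r i u ∧ G.surfaceDensity r i u ≤ Λ := by
  have key : ∀ i, ∃ c Λ : ℝ, 0 < c ∧ ∀ᵐ u ∂volume.restrict (G.dom i),
      c ≤ √(gramDet (r ∘ G.chart i) u) ∧ √(gramDet (r ∘ G.chart i) u) ≤ Λ := by
    intro i
    have hri := hr.comp_chart G i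
    obtain ⟨c, hc0, hc⟩ := hri.exists_lower
    obtain ⟨K, hK⟩ := hri.1
    refine ⟨√(c ^ 4), √((K : ℝ) ^ 4), by positivity, ?_⟩
    filter_upwards [hK.ae_differentiableWithinAt (G.measurableSet_dom i),
      ae_restrict_mem (G.measurableSet_dom i)] with u hu hmem
    have h := gramDet_bounds (G.isOpen_dom i) hmem
      (hu.differentiableAt ((G.isOpen_dom i).mem_nhds hmem)) hc0 hc hK
    exact ⟨Real.sqrt_le_sqrt h.1, Real.sqrt_le_sqrt h.2⟩
  choose c Λ hc0 h using key
  obtain hι | hι := isEmpty_or_nonempty ι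
  · exact ⟨1, 1, one_ne_zero, fun i => isEmptyElim i⟩
  refine ⟨(Finset.univ.inf' Finset.univ_nonempty c).toNNReal,
    (Finset.univ.sup' Finset.univ_nonempty Λ).toNNReal, ?_, fun i => ?_⟩
  · rw [Ne, Real.toNNReal_eq_zero, not_le, Finset.lt_inf'_iff]
    exact fun i _ => hc0 i
  · filter_upwards [h i] with u hu
    exact ⟨ENNReal.ofReal_le_ofReal ((Finset.inf'_le _ (Finset.mem_univ i)).trans hu.1),
      ENNReal.ofReal_le_ofReal (hu.2.trans (Finset.le_sup' _ (Finset.mem_univ i)))⟩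

/-- The image of the Lebesgue measures of the patches, without the surface density. -/
noncomputable def flatMeasure (r : E3 → E3) : Measure E3 :=
  ∑ i, Measure.map (r ∘ G.chart i) (volume.restrict (G.dom i))

theorem surfaceMeasure_eq :
    G.surfaceMeasure r = ∑ i, Measure.map (r ∘ G.chart i)
      ((volume.restrict (G.dom i)).withDensity (G.surfaceDensity r i)) := rfl

omit [Fintype ι] in
theorem aemeasurable_comp_chart_withDensity (hr : BiLipschitzOn r Γ) (i : ι) :
    AEMeasurable (r ∘ G.chart i)
      ((volume.restrict (G.dom i)).withDensity (G.surfaceDensity r i)) :=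
  (G.aemeasurable_comp_chart hr i).mono_ac (withDensity_absolutelyContinuous _ _)

theorem exists_surfaceMeasure_le (hr : BiLipschitzOn r Γ) :
    ∃ C : ℝ≥0, G.surfaceMeasure r ≤ C • G.flatMeasure r := by
  obtain ⟨c, Λ, -, h⟩ := G.exists_surfaceDensity_bounds hr
  refine ⟨Λ, ?_⟩
  rw [surfaceMeasure_eq, flatMeasure, Finset.smul_sum]
  refine Finset.sum_le_sum fun i _ => ?_
  have hm := G.aemeasurable_comp_chart hr i
  rw [← Measure.map_smul]
  refine Measure.map_mono_of_aemeasurable ?_ (hm.mono_ac (Measure.smul_absolutelyContinuous))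
  calc (volume.restrict (G.dom i)).withDensity (G.surfaceDensity r i)
      ≤ (volume.restrict (G.dom i)).withDensity fun _ => (Λ : ℝ≥0∞) :=
        withDensity_mono (by filter_upwards [h i] with u hu using hu.2)
    _ = _ := by rw [withDensity_const]; rfl

theorem exists_flatMeasure_le (hr : BiLipschitzOn r Γ) :
    ∃ C : ℝ≥0, G.flatMeasure r ≤ C • G.surfaceMeasure r := by
  obtain ⟨c, Λ, hc0, h⟩ := G.exists_surfaceDensity_bounds hr
  refine ⟨c⁻¹, ?_⟩
  rw [surfaceMeasure_eq, flatMeasure, Finset.smul_sum]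
  refine Finset.sum_le_sum fun i _ => ?_
  have hm := G.aemeasurable_comp_chart_withDensity hr i
  rw [← Measure.map_smul]
  refine Measure.map_mono_of_aemeasurable ?_ (hm.mono_ac (Measure.smul_absolutelyContinuous))
  have h1 : c • volume.restrict (G.dom i)
      ≤ (volume.restrict (G.dom i)).withDensity (G.surfaceDensity r i) :=
    calc c • volume.restrict (G.dom i)
        = (volume.restrict (G.dom i)).withDensity fun _ => (c : ℝ≥0∞) := by
          rw [withDensity_const]; rfl
      _ ≤ _ := withDensity_mono (by filter_upwards [h i] with u hu using hu.1)
  calc volume.restrict (G.dom i) = c⁻¹ • (c • volume.restrict (G.dom i)) := by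
        rw [smul_smul, inv_mul_cancel₀ hc0, one_smul]
    _ ≤ _ := by gcongr

/-- Surface measures of bi-Lipschitz images of the same surface correspond to each other, up to
constants. -/
theorem exists_map_surfaceMeasure_le {r' t : E3 → E3} (hr : BiLipschitzOn r Γ)
    (hr' : BiLipschitzOn r' Γ) (ht : Measurable t) (h : ∀ x ∈ Γ, t (r x) = r' x) :
    ∃ C : ℝ≥0, (G.surfaceMeasure r).map t ≤ C • G.surfaceMeasure r' := by
  obtain ⟨C, hC⟩ := G.exists_surfaceMeasure_le hr
  obtain ⟨C', hC'⟩ := G.exists_flatMeasure_le hr'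
  have e : (G.flatMeasure r).map t = G.flatMeasure r' := by
    rw [flatMeasure, flatMeasure, ← Measure.mapₗ_apply_of_measurable ht, map_sum]
    refine Finset.sum_congr rfl fun i _ => ?_
    rw [Measure.mapₗ_apply_of_measurable ht, AEMeasurable.map_map_of_aemeasurable ht.aemeasurable
      (G.aemeasurable_comp_chart hr i)]
    refine Measure.map_congr ?_
    filter_upwards [ae_restrict_mem (G.measurableSet_dom i)] with u hu
    exact h _ (G.chart_mem hu)
  refine ⟨C * C', ?_⟩
  calc (G.surfaceMeasure r).map t ≤ (C • G.flatMeasure r).map t := Measure.map_mono hC ht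
    _ = C • G.flatMeasure r' := by rw [Measure.map_smul, e]
    _ ≤ C • (C' • G.surfaceMeasure r') := by gcongr
    _ = _ := by rw [smul_smul]

theorem exists_map_chart_le (i : ι) :
    ∃ C : ℝ≥0, (volume.restrict (G.dom i)).map (G.chart i) ≤ C • G.surfaceMeasure id := by
  obtain ⟨C, hC⟩ := G.exists_flatMeasure_le biLipschitzOn_id
  refine ⟨C, le_trans ?_ hC⟩
  exact Finset.single_le_sum
    (f := fun i => Measure.map (id ∘ G.chart i) (volume.restrict (G.dom i)))
    (fun _ _ => Measure.zero_le _) (Finset.mem_univ i)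

omit [Fintype ι] in
theorem volume_dom_lt_top (hΓ : IsCompact Γ) (i : ι) : volume (G.dom i) < ∞ := by
  obtain ⟨K, g, hg, hgc⟩ := (G.biLipschitz i).exists_leftInverse
  have hsub : G.dom i ⊆ g '' Γ := fun u hu => ⟨_, G.chart_mem hu, hgc u hu⟩
  exact (measure_mono hsub).trans_lt (hΓ.image hg.continuous).measure_lt_top

theorem isFiniteMeasure_surfaceMeasure (hΓ : IsCompact Γ) (hr : BiLipschitzOn r Γ) :
    IsFiniteMeasure (G.surfaceMeasure r) := by
  obtain ⟨C, hC⟩ := G.exists_surfaceMeasure_le hr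
  have : IsFiniteMeasure (G.flatMeasure r) := by
    have : ∀ i, IsFiniteMeasure (volume.restrict (G.dom i)) := fun i =>
      ⟨by rw [Measure.restrict_apply_univ]; exact G.volume_dom_lt_top hΓ i⟩
    unfold flatMeasure
    infer_instance
  exact isFiniteMeasure_of_le _ hC

theorem ae_mem_image (hΓ : IsCompact Γ) (hr : BiLipschitzOn r Γ) :
    ∀ᵐ x ∂G.surfaceMeasure r, x ∈ r '' Γ := by
  obtain ⟨C, hC⟩ := G.exists_surfaceMeasure_le hr
  obtain ⟨K, hK⟩ := hr.1
  have hm : MeasurableSet (r '' Γ) := (hΓ.image_of_continuousOn hK.continuousOn).measurableSet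
  have h0 : G.flatMeasure r (r '' Γ)ᶜ = 0 := by
    rw [flatMeasure, Measure.finsetSum_apply, Finset.sum_eq_zero fun i _ => ?_]
    rw [← mem_ae_iff, mem_ae_map_iff (G.aemeasurable_comp_chart hr i) hm]
    filter_upwards [ae_restrict_mem (G.measurableSet_dom i)] with u hu
    exact ⟨_, G.chart_mem hu, rfl⟩
  have h1 := hC (r '' Γ)ᶜ
  rw [Measure.smul_apply, h0, smul_zero] at h1
  exact nonpos_iff_eq_zero.1 h1

/-- Integration over the surface `r '' Γ`, in local coordinates. -/
theorem integral_surfaceMeasure (hr : BiLipschitzOn r Γ) {h : E3 → ℂ}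
    (hi : ∀ i, IntegrableOn (fun u => (√(gramDet (r ∘ G.chart i) u) : ℂ) * h (r (G.chart i u)))
      (G.dom i)) :
    Integrable h (G.surfaceMeasure r) ∧ ∫ x, h x ∂G.surfaceMeasure r
      = ∑ i, ∫ u in G.dom i, (√(gramDet (r ∘ G.chart i) u) : ℂ) * h (r (G.chart i u)) := by
  have key : ∀ i, Integrable h (Measure.map (r ∘ G.chart i)
      ((volume.restrict (G.dom i)).withDensity (G.surfaceDensity r i))) ∧
      ∫ x, h x ∂(Measure.map (r ∘ G.chart i)
      ((volume.restrict (G.dom i)).withDensity (G.surfaceDensity r i)))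
      = ∫ u in G.dom i, (√(gramDet (r ∘ G.chart i) u) : ℂ) * h (r (G.chart i u)) := by
    intro i
    obtain ⟨K, g, hg, hgc⟩ := (hr.comp_chart G i).exists_leftInverse
    have hd : ∀ u, (G.surfaceDensity r i u).toReal • h (r (G.chart i u))
        = (√(gramDet (r ∘ G.chart i) u) : ℂ) * h (r (G.chart i u)) := fun u => by
      rw [surfaceDensity, ENNReal.toReal_ofReal (Real.sqrt_nonneg _), Complex.real_smul]
    have hfin : ∀ᵐ u ∂volume.restrict (G.dom i), G.surfaceDensity r i u < ∞ :=
      Eventually.of_forall fun u => ENNReal.ofReal_lt_top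
    have hint : Integrable (fun u => h ((r ∘ G.chart i) u))
        ((volume.restrict (G.dom i)).withDensity (G.surfaceDensity r i)) := by
      rw [integrable_withDensity_iff_integrable_smul' (G.measurable_surfaceDensity i) hfin]
      simp only [Function.comp_apply, hd]
      exact hi i
    have h1 := integrable_map_of_leftInverse (G.aemeasurable_comp_chart_withDensity hr i)
      hg.continuous.measurable (withDensity_absolutelyContinuous _ _ (by
        filter_upwards [ae_restrict_mem (G.measurableSet_dom i)] with u hu using hgc u hu)) hint
    refine ⟨h1.1, h1.2.trans ?_⟩
    rw [integral_withDensity_eq_integral_toReal_smul (G.measurable_surfaceDensity i) hfin]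
    simp only [Function.comp_apply, hd]
  rw [surfaceMeasure_eq]
  refine ⟨integrable_finsetSum_measure.2 fun i _ => (key i).1, ?_⟩
  rw [integral_finsetSum_measure fun i _ => (key i).1]
  exact Finset.sum_congr rfl fun i _ => (key i).2

end PatchDecomposition

/-! ### Weakly singular weights on the surface -/

theorem exists_lintegral_norm_rpow_le {s : Set E2} (hs : volume s < ∞) {ν : ℝ} (hν0 : 0 ≤ ν)
    (hν : ν < 2) :
    ∃ S : ℝ≥0, ∀ w : E2, ∫⁻ u in s, ENNReal.ofReal (‖w - u‖ ^ (-ν)) ≤ S := by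
  set I : E2 → ℝ≥0∞ := (ball 0 1).indicator fun u => ENNReal.ofReal (‖u‖ ^ (-ν)) with hI
  have hfin : ∫⁻ u, I u < ∞ := by
    rw [hI, lintegral_indicator measurableSet_ball]
    have h : IntegrableOn (fun u : E2 => ‖u‖ ^ (-ν)) (ball 0 1) := by
      rw [integrableOn_fun_norm_addHaar volume (f := fun t : ℝ => t ^ (-ν))]
      have h1 : IntegrableOn (fun t : ℝ => t ^ (1 - ν)) (Ioo 0 1) :=
        ((intervalIntegrable_iff_integrableOn_Ioo_of_le zero_le_one).1
          (intervalIntegral.intervalIntegrable_rpow' (by linarith)))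
      refine h1.congr_fun (fun t ht => ?_) measurableSet_Ioo
      have hd : Module.finrank ℝ E2 - 1 = 1 := by simp
      simp only [hd, pow_one, smul_eq_mul]
      rw [sub_eq_add_neg, Real.rpow_add ht.1, Real.rpow_one]
    have h2 := h.2
    rw [hasFiniteIntegral_iff_norm] at h2
    refine lt_of_le_of_lt (lintegral_mono fun u => ?_) h2
    exact ENNReal.ofReal_le_ofReal (le_abs_self _)
  lift (∫⁻ u, I u) + volume s to ℝ≥0 using (ENNReal.add_lt_top.2 ⟨hfin, hs⟩).ne with S hS
  refine ⟨S, fun w => ?_⟩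
  have hle : ∀ u, ENNReal.ofReal (‖w - u‖ ^ (-ν)) ≤ I (w - u) + 1 := by
    intro u
    by_cases hu : w - u ∈ ball (0 : E2) 1
    · rw [hI, indicator_of_mem hu]
      exact le_self_add
    · rw [hI, indicator_of_notMem hu, zero_add, ← ENNReal.ofReal_one]
      refine ENNReal.ofReal_le_ofReal (Real.rpow_le_one_of_one_le_of_nonpos ?_ (by linarith))
      simpa using hu
  calc ∫⁻ u in s, ENNReal.ofReal (‖w - u‖ ^ (-ν)) ≤ ∫⁻ u in s, (I (w - u) + 1) :=
        lintegral_mono fun u => hle u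
    _ = (∫⁻ u in s, I (w - u)) + ∫⁻ _ in s, 1 := lintegral_add_right _ measurable_const
    _ ≤ (∫⁻ u, I (w - u)) + volume s := by
        refine add_le_add (setLIntegral_le_lintegral _ _) (le_of_eq ?_)
        simp
    _ = S := by rw [lintegral_sub_left_eq_self I w, hS]

namespace PatchDecomposition

variable {Γ : Set E3} {ι : Type*} [Fintype ι] (G : PatchDecomposition Γ ι)

omit [Fintype ι] in
theorem exists_lintegral_chart_le (hΓ : IsCompact Γ) (i : ι) {ν : ℝ} (hν0 : 0 ≤ ν) (hν : ν < 2) :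
    ∃ S : ℝ≥0, ∀ x : E3, ∫⁻ u in G.dom i, ENNReal.ofReal (‖x - G.chart i u‖ ^ (-ν)) ≤ S := by
  obtain ⟨K, g, hg, hgc⟩ := (G.biLipschitz i).exists_leftInverse
  obtain ⟨S, hS⟩ := exists_lintegral_norm_rpow_le (G.volume_dom_lt_top hΓ i) hν0 hν
  refine ⟨((K : ℝ) + 1).toNNReal ^ ν * S, fun x => ?_⟩
  set L : ℝ := K + 1 with hL
  have hL0 : 0 < L := by positivity
  have hlip : ∀ u ∈ G.dom i, ‖g x - u‖ ≤ L * ‖x - G.chart i u‖ := fun u hu => by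
    have h1 := hg.norm_sub_le x (G.chart i u)
    rw [hgc u hu] at h1
    refine h1.trans (mul_le_mul_of_nonneg_right ?_ (norm_nonneg _))
    rw [hL]; linarith
  have hne : ∀ᵐ u ∂volume.restrict (G.dom i), u ≠ g x := by
    simp [ae_iff]
  calc ∫⁻ u in G.dom i, ENNReal.ofReal (‖x - G.chart i u‖ ^ (-ν))
      ≤ ∫⁻ u in G.dom i, ENNReal.ofReal (L ^ ν) * ENNReal.ofReal (‖g x - u‖ ^ (-ν)) := by
        refine lintegral_mono_ae ?_
        filter_upwards [hne, ae_restrict_mem (G.measurableSet_dom i)] with u hu hmem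
        rw [← ENNReal.ofReal_mul (by positivity)]
        refine ENNReal.ofReal_le_ofReal ?_
        have hp : 0 < ‖g x - u‖ := norm_pos_iff.2 (sub_ne_zero.2 (Ne.symm hu))
        have hq : ‖g x - u‖ / L ≤ ‖x - G.chart i u‖ := by
          rw [div_le_iff₀ hL0, mul_comm]
          exact hlip u hmem
        calc ‖x - G.chart i u‖ ^ (-ν) ≤ (‖g x - u‖ / L) ^ (-ν) :=
              Real.rpow_le_rpow_of_nonpos (by positivity) hq (by linarith)
          _ = L ^ ν * ‖g x - u‖ ^ (-ν) := by
              rw [Real.div_rpow hp.le hL0.le, Real.rpow_neg hL0.le, div_inv_eq_mul, mul_comm]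
    _ = ENNReal.ofReal (L ^ ν) * ∫⁻ u in G.dom i, ENNReal.ofReal (‖g x - u‖ ^ (-ν)) :=
        lintegral_const_mul' _ _ ENNReal.ofReal_ne_top
    _ ≤ ENNReal.ofReal (L ^ ν) * S := by gcongr; exact hS _
    _ = _ := by
        rw [ENNReal.coe_mul, ENNReal.coe_rpow_of_nonneg _ hν0, ← ENNReal.ofReal_rpow_of_pos hL0]
        rfl

theorem exists_schurWeight (hΓ : IsCompact Γ) {ν : ℝ} (hν0 : 0 ≤ ν) (hν : ν < 2) :
    ∃ S : ℝ≥0, ∀ i, SchurWeight (G.surfaceMeasure id) (volume.restrict (G.dom i))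
      (fun x u => ‖x - G.chart i u‖ ^ (-ν)) S := by
  choose S hS using fun i => G.exists_lintegral_chart_le hΓ i hν0 hν
  obtain ⟨C, hC⟩ := G.exists_surfaceMeasure_le biLipschitzOn_id
  have hSle : ∀ i, (S i : ℝ≥0∞) ≤ ∑ j, (S j : ℝ≥0∞) := fun i =>
    Finset.single_le_sum (f := fun j => (S j : ℝ≥0∞)) (fun _ _ => zero_le) (Finset.mem_univ i)
  refine ⟨(1 + C) * ∑ i, S i, fun i => ⟨?_, ?_, ?_⟩⟩
  · have h1 : AEMeasurable (fun q : E3 × E2 => G.chart i q.2)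
        ((G.surfaceMeasure id).prod (volume.restrict (G.dom i))) :=
      (G.aemeasurable_chart i).comp_snd
    exact ((measurable_fst.aemeasurable.sub h1).norm).pow_const _
  · refine Eventually.of_forall fun x => (hS i x).trans ((hSle i).trans ?_)
    push_cast
    exact le_mul_of_one_le_left zero_le le_self_add
  · refine Eventually.of_forall fun u => ?_
    have hm : Measurable fun x : E3 => ENNReal.ofReal (‖x - G.chart i u‖ ^ (-ν)) := by fun_prop
    calc ∫⁻ x, ENNReal.ofReal (‖x - G.chart i u‖ ^ (-ν)) ∂G.surfaceMeasure id
        ≤ ∫⁻ x, ENNReal.ofReal (‖x - G.chart i u‖ ^ (-ν)) ∂(C • G.flatMeasure id) :=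
          lintegral_mono' hC le_rfl
      _ = C * ∑ j, ∫⁻ u' in G.dom j, ENNReal.ofReal (‖G.chart i u - G.chart j u'‖ ^ (-ν)) := by
          rw [lintegral_smul_measure, flatMeasure, lintegral_finsetSum_measure]
          congr 1
          refine Finset.sum_congr rfl fun j _ => ?_
          rw [lintegral_map' hm.aemeasurable (G.aemeasurable_comp_chart biLipschitzOn_id j)]
          simp only [Function.comp_apply, id, norm_sub_rev]
      _ ≤ C * ∑ j, (S j : ℝ≥0∞) := by
          gcongr with j
          exact hS j _
      _ ≤ _ := by
          push_cast
          gcongr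
          exact le_add_self

/-- The pullback along a bi-Lipschitz transformation of the surface is an isomorphism of the
`L²`-spaces. The second part describes the inverse through a left inverse `s` of `r`. -/
theorem exists_isPullback (hΓ : IsCompact Γ) {r : E3 → E3} (hr : BiLipschitzOn r Γ) :
    ∃ (T : Lp ℂ 2 (G.surfaceMeasure r) ≃L[ℂ] Lp ℂ 2 (G.surfaceMeasure id)) (s : E3 → E3),
      IsPullback (G.surfaceMeasure r) (G.surfaceMeasure id) r T ∧
      (∀ x ∈ Γ, s (r x) = x) ∧
      Measure.QuasiMeasurePreserving s (G.surfaceMeasure r) (G.surfaceMeasure id) ∧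
      ∀ f, T.symm f =ᵐ[G.surfaceMeasure r] fun x => f (s x) := by
  obtain ⟨K, s, hs, hsr⟩ := hr.exists_leftInverse
  obtain ⟨K', hK'⟩ := hr.1
  obtain ⟨r', hr', hrr'⟩ := hK'.extend_finite_dimension
  have hmem : ∀ᵐ x ∂G.surfaceMeasure id, x ∈ Γ := by
    simpa using G.ae_mem_image hΓ biLipschitzOn_id
  have hreq : r =ᵐ[G.surfaceMeasure id] r' := by
    filter_upwards [hmem] with x hx using hrr' hx
  obtain ⟨C, hC⟩ := G.exists_map_surfaceMeasure_le biLipschitzOn_id hr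
    hr'.continuous.measurable fun x hx => (hrr' hx).symm
  obtain ⟨C', hC'⟩ := G.exists_map_surfaceMeasure_le hr biLipschitzOn_id
    hs.continuous.measurable hsr
  have hqr : Measure.QuasiMeasurePreserving r' (G.surfaceMeasure id) (G.surfaceMeasure r) :=
    ⟨hr'.continuous.measurable,
      (Measure.absolutelyContinuous_of_le hC).trans Measure.smul_absolutelyContinuous⟩
  have hqs : Measure.QuasiMeasurePreserving s (G.surfaceMeasure r) (G.surfaceMeasure id) :=
    ⟨hs.continuous.measurable,
      (Measure.absolutelyContinuous_of_le hC').trans Measure.smul_absolutelyContinuous⟩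
  obtain ⟨T, hT⟩ := exists_pullback hqr.measurable.aemeasurable hC
  obtain ⟨T', hT'⟩ := exists_pullback hqs.measurable.aemeasurable hC'
  have hleft : ∀ f, T' (T f) = f := fun f => by
    refine Lp.ext ?_
    filter_upwards [hT' (T f), hqs.ae (hT f), G.ae_mem_image hΓ hr] with x h1 h2 h3
    obtain ⟨x, hx, rfl⟩ := h3
    rw [h1, h2, hsr x hx, ← hrr' hx]
  have hright : ∀ f, T (T' f) = f := fun f => by
    refine Lp.ext ?_
    filter_upwards [hT (T' f), hqr.ae (hT' f), hmem] with x h1 h2 h3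
    rw [h1, h2, ← hrr' h3, hsr x h3]
  refine ⟨ContinuousLinearEquiv.equivOfInverse T T' hleft hright, s, fun f => ?_, hsr, hqs, hT'⟩
  filter_upwards [hT f, hreq] with x h1 h2
  rw [ContinuousLinearEquiv.equivOfInverse_apply, h1, h2]

end PatchDecomposition

/-! ### Measurability of the pulled-back kernels -/

/-- Functions that are measurable in the first variable and continuous in the second one may be
composed with measurable maps in the second variable. -/
theorem aemeasurable_caratheodory {E P X : Type*} [MeasurableSpace E] [MeasurableSpace P]
    [MetricSpace X] [SecondCountableTopology X] [MeasurableSpace X] [BorelSpace X]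
    {σ : Measure E} {μ : Measure P} [SFinite μ] {U : Set X} (hU : MeasurableSet U)
    {f : P → X → ℂ}
    (hf : ∀ ζ ∈ U, AEMeasurable (fun q => f q ζ) μ) (hc : ∀ᵐ q ∂μ, ContinuousOn (f q) U)
    {Z : E × P → X} (hZ : AEMeasurable Z (σ.prod μ)) (hZU : ∀ᵐ p ∂σ.prod μ, Z p ∈ U) :
    AEMeasurable (fun p : E × P => f p.2 (Z p)) (σ.prod μ) := by
  classical
  obtain hne | ⟨⟨ζ₀, hζ₀⟩⟩ := isEmpty_or_nonempty U
  · have : σ.prod μ = 0 := by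
      rw [← ae_eq_bot, ← eventually_false_iff_eq_bot]
      filter_upwards [hZU] with p hp using hne.elim ⟨_, hp⟩
    rw [this]
    exact aemeasurable_zero_measure
  have : Nonempty U := ⟨⟨ζ₀, hζ₀⟩⟩
  -- off a null set, `f` is continuous in `ζ` and measurable in `q` for a dense sequence of `ζ`
  have hgood : ∀ᵐ q ∂μ, ContinuousOn (f q) U ∧
      ∀ n, f q (TopologicalSpace.denseSeq U n)
        = (hf _ (TopologicalSpace.denseSeq U n).2).mk _ q :=
    hc.and (ae_all_iff.2 fun n => (hf _ (TopologicalSpace.denseSeq U n).2).ae_eq_mk)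
  obtain ⟨N, hsub, hN, hN0⟩ := exists_measurable_superset_of_null (ae_iff.1 hgood)
  have hgoodN : ∀ q ∉ N, ContinuousOn (f q) U ∧
      ∀ n, f q (TopologicalSpace.denseSeq U n)
        = (hf _ (TopologicalSpace.denseSeq U n).2).mk _ q := fun q hq => by
    by_contra hcon
    exact hq (hsub hcon)
  set f' : U → P → ℂ := fun ζ q => if q ∈ N then 0 else f q ζ with hf'
  have hcont : ∀ q, Continuous fun ζ => f' ζ q := by
    intro q
    by_cases hq : q ∈ N
    · simp only [hf', hq, if_true]
      exact continuous_const
    · simp only [hf', hq, if_false]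
      exact continuousOn_iff_continuous_domRestrict.1 (hgoodN q hq).1
  have hmeas : ∀ ζ, Measurable (f' ζ) := by
    have hdense : ∀ n, Measurable (f' (TopologicalSpace.denseSeq U n)) := fun n => by
      have e : f' (TopologicalSpace.denseSeq U n) = fun q => if q ∈ N then 0 else
          (hf _ (TopologicalSpace.denseSeq U n).2).mk _ q := by
        funext q
        by_cases hq : q ∈ N
        · simp [hf', hq]
        · simp only [hf', hq, if_false]
          exact (hgoodN q hq).2 n
      rw [e]
      exact Measurable.ite hN measurable_const
        (hf _ (TopologicalSpace.denseSeq U n).2).measurable_mk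
    intro ζ
    obtain ⟨v, hv, hlim⟩ := mem_closure_iff_seq_limit.1
      ((TopologicalSpace.denseRange_denseSeq U).closure_range ▸ mem_univ ζ)
    refine measurable_of_tendsto_metrizable (f := fun n => f' (v n)) (fun n => ?_)
      (tendsto_pi_nhds.2 fun q => ((hcont q).tendsto ζ).comp hlim)
    obtain ⟨m, hm⟩ := hv n
    rw [← hm]
    exact hdense m
  have hjoint : Measurable (uncurry f') := measurable_uncurry_of_continuous_of_measurable hcont hmeas
  set Z' : E × P → X := fun p => if hZ.mk Z p ∈ U then hZ.mk Z p else ζ₀ with hZ'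
  have hZ'U : ∀ p, Z' p ∈ U := fun p => by
    by_cases h : hZ.mk Z p ∈ U <;> simp [hZ', h, hζ₀]
  have hZ'm : Measurable fun p => (⟨Z' p, hZ'U p⟩ : U) :=
    (Measurable.ite (hZ.measurable_mk hU) hZ.measurable_mk measurable_const).subtype_mk
  refine ((hjoint.comp (hZ'm.prodMk measurable_snd)).aemeasurable).congr ?_
  have hq : ∀ᵐ p ∂σ.prod μ, p.2 ∉ N :=
    Measure.quasiMeasurePreserving_snd.ae (measure_eq_zero_iff_ae_notMem.1 hN0)
  filter_upwards [hq, hZU, hZ.ae_eq_mk] with p h1 h2 h3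
  have h4 : hZ.mk Z p ∈ U := h3 ▸ h2
  have h5 : Z' p = Z p := by rw [hZ']; simp only [h4, if_true]; exact h3.symm
  simp [uncurry, hf', h1, h5]

section

variable {E : Type*} [MeasurableSpace E] {μ : Measure E}

theorem aemeasurable_affineC {v₀ : E → E3} {v : ℕ → E → E3} (hv₀ : AEMeasurable v₀ μ)
    (hv : ∀ j, AEMeasurable (v j) μ) {b : ℕ → ℝ} {K : ℝ} (hvb : ∀ᵐ q ∂μ, ∀ j, ‖v j q‖ ≤ K * b j)
    {z : ℕ → ℂ} (hz : Summable fun j => ‖z j‖ * b j) :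
    AEMeasurable (fun q => affineC (v₀ q) (fun j => v j q) z) μ := by
  refine (continuous_toC3.measurable.comp_aemeasurable hv₀).add ?_
  refine aemeasurable_of_tendsto_metrizable_ae'
    (f := fun n q => ∑ j ∈ Finset.range n, z j • toC3 (v j q)) (fun n => ?_) ?_
  · refine Finset.aemeasurable_fun_sum _ fun j _ => ?_
    exact (continuous_toC3.measurable.comp_aemeasurable (hv j)).const_smul (z j)
  · filter_upwards [hvb] with q hq
    exact (summable_affine hq hz).hasSum.tendsto_sum_nat

end

section

variable {Γ : Set E3} {ι : Type*} {G : PatchDecomposition Γ ι} {φ₀ : E3 → E3} {φ : ℕ → E3 → E3}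
  {p : ℝ} (h : AffineParametric Γ φ₀ φ p) {L : ℝ≥0}
  (hL : ∀ i, LipschitzOnWith L (G.chart i) (G.dom i))

include h hL in
theorem aemeasurable_densityC (i : ι) {z : ℕ → ℂ} (hz : Summable fun j => ‖z j‖ * normSeq Γ φ j) :
    AEMeasurable (fun u => densityC G φ₀ φ i u z) (volume.restrict (G.dom i)) := by
  have hT : ∀ k, AEMeasurable (fun u => tangentC G φ₀ φ i u k z) (volume.restrict (G.dom i)) :=
    fun k => by
    refine aemeasurable_affineC (K := L) (measurable_fderiv_apply_const ℝ _ _).aemeasurable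
      (fun j => (measurable_fderiv_apply_const ℝ _ _).aemeasurable) ?_ hz
    filter_upwards [ae_isRegularPoint h i] with u hu
    exact fun j => norm_fderiv_single_le h hL hu k j
  exact (continuous_gramC.measurable.comp_aemeasurable ((hT 0).prodMk (hT 1))).pow_const _

include h in
theorem continuousOn_transfC (hΓ : IsCompact Γ) {z : ℕ → ℂ}
    (hz : Summable fun j => ‖z j‖ * normSeq Γ φ j) : ContinuousOn (transfC φ₀ φ z) Γ := by
  obtain ⟨K, hK⟩ := h.lipschitz_zero
  refine (continuous_toC3.comp_continuousOn hK.continuousOn).add ?_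
  refine continuousOn_tsum (fun j => ?_) hz fun j x hx => ?_
  · obtain ⟨K, hK⟩ := h.lipschitz j
    exact (continuous_toC3.comp_continuousOn hK.continuousOn).const_smul (z j)
  · rw [norm_smul, norm_toC3]
    exact mul_le_mul_of_nonneg_left (h.norm_le hΓ j hx) (norm_nonneg _)

variable [Fintype ι]

include h in
theorem aemeasurable_transfC_sub (hΓ : IsCompact Γ) (i : ι) {z : ℕ → ℂ}
    (hz : Summable fun j => ‖z j‖ * normSeq Γ φ j) :
    AEMeasurable (fun q : E3 × E2 => transfC φ₀ φ z q.1 - transfC φ₀ φ z (G.chart i q.2))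
      ((G.surfaceMeasure id).prod (volume.restrict (G.dom i))) := by
  have hc := continuousOn_transfC h hΓ hz
  have := G.isFiniteMeasure_surfaceMeasure hΓ PatchDecomposition.biLipschitzOn_id
  have hmem : ∀ᵐ x ∂G.surfaceMeasure id, x ∈ Γ := by
    simpa using G.ae_mem_image hΓ PatchDecomposition.biLipschitzOn_id
  have h1 : AEMeasurable (transfC φ₀ φ z) (G.surfaceMeasure id) := by
    rw [← Measure.restrict_eq_self_of_ae_mem hmem]
    exact hc.aemeasurable hΓ.measurableSet
  have h2 : AEMeasurable (fun u => transfC φ₀ φ z (G.chart i u)) (volume.restrict (G.dom i)) :=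
    (hc.comp (G.biLipschitz i).1.choose_spec.continuousOn
      fun u hu => G.chart_mem hu).aemeasurable (G.measurableSet_dom i)
  exact h1.comp_fst.sub h2.comp_snd

/-- Almost every pair of a boundary point and a parameter of a patch is off the diagonal, and the
parameter is a regular point. -/
theorem ae_offDiagonal (hΓ : IsCompact Γ) (h : AffineParametric Γ φ₀ φ p) (i : ι) :
    ∀ᵐ q ∂(G.surfaceMeasure id).prod (volume.restrict (G.dom i)),
      q.1 ∈ Γ ∧ IsRegularPoint G φ₀ φ i q.2 ∧ q.1 ≠ G.chart i q.2 := by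
  have := G.isFiniteMeasure_surfaceMeasure hΓ PatchDecomposition.biLipschitzOn_id
  have hmem : ∀ᵐ x ∂G.surfaceMeasure id, x ∈ Γ := by
    simpa using G.ae_mem_image hΓ PatchDecomposition.biLipschitzOn_id
  obtain ⟨K, g, hg, hgc⟩ := (G.biLipschitz i).exists_leftInverse
  have hdiag : ∀ᵐ q ∂(G.surfaceMeasure id).prod (volume.restrict (G.dom i)), q.2 ≠ g q.1 := by
    refine (Measure.ae_prod_iff_ae_ae ?_).2 (Eventually.of_forall fun x => ?_)
    · exact (measurableSet_eq_fun measurable_snd (hg.continuous.measurable.comp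
        measurable_fst)).compl
    · simp [ae_iff]
  filter_upwards [hdiag, Measure.quasiMeasurePreserving_fst.ae hmem,
    Measure.quasiMeasurePreserving_snd.ae (ae_isRegularPoint h i)] with q h1 h2 h3
  exact ⟨h2, h3, fun e => h1 (by rw [e, hgc _ h3.1])⟩

end

/-! ### The pulled-back kernels -/

section

variable {Γ : Set E3} {ι : Type*} (G : PatchDecomposition Γ ι) (φ₀ : E3 → E3) (φ : ℕ → E3 → E3)

/-- The kernel of the transported operator with respect to the Lebesgue measure on the patch `i`,
including the surface density, at the complex parameter `z`. -/
noncomputable def patchKernel (ε : ℝ) (aC : (ℕ → ℝ) → ι → (ℕ → ℂ) → E2 → C3 → ℂ) (i : ι) (x : E3)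
    (u : E2) : (ℕ → ℂ) → ℂ :=
  kernelValue (normSeq Γ φ) ε (fun ρ z ζ => aC ρ i z u ζ)
    (fun z => transfC φ₀ φ z x - transfC φ₀ φ z (G.chart i u)) (densityC G φ₀ φ i u)

variable {G φ₀ φ} {p ε : ℝ} {a : (ℕ → ℝ) → E3 → C3 → ℂ}
  {aC : (ℕ → ℝ) → ι → (ℕ → ℂ) → E2 → C3 → ℂ} (h : AffineParametric Γ φ₀ φ p) (hΓ : IsCompact Γ)
  (hb : ∀ j, 0 < normSeq Γ φ j) (ha : SingularKernelAssumption G φ₀ φ p ε a aC) {L : ℝ≥0}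
  (hL : ∀ i, LipschitzOnWith L (G.chart i) (G.dom i))

include h hΓ hb ha hL in
theorem kernelPoint_of_ne {c : ℝ} (hc0 : 0 < c)
    (hc : ∀ y ∈ paramDomain, ∀ x ∈ Γ, ∀ x' ∈ Γ,
      c * ‖x - x'‖ ≤ ‖transf φ₀ φ y x - transf φ₀ φ y x'‖) {η : ℝ} (hη0 : 0 < η) (hη : η ≤ c / 4)
    {i : ι} {u : E2} (hu : IsRegularPoint G φ₀ φ i u)
    (hre : ∀ z ∈ paramNbhd (normSeq Γ φ) η,
      0 < (gramC (tangentC G φ₀ φ i u 0 z) (tangentC G φ₀ φ i u 1 z)).re)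
    {x : E3} (hx : x ∈ Γ) (hne : x ≠ G.chart i u) :
    KernelPoint (normSeq Γ φ) ε η (fun y ζ => a y (transf φ₀ φ y (G.chart i u)) ζ)
      (fun ρ z ζ => aC ρ i z u ζ)
      (fun z => transfC φ₀ φ z x - transfC φ₀ φ z (G.chart i u)) (densityC G φ₀ φ i u) := by
  have hx' := G.chart_mem hu.1
  have hbs := h.summable_normSeq hb
  have hv : ∀ {x}, x ∈ Γ → ∀ j, ‖φ j x‖ ≤ 1 * normSeq Γ φ j := fun hx j => by
    rw [one_mul]; exact h.norm_le hΓ j hx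
  refine ⟨fun ρ hρ ζ hζ => ?_, ha.continuous_param i u hu.1, fun ρ hρ z hz =>
    ha.holomorphic_snd ρ hρ i z hz u hu.1, fun z hz => ?_, fun z hz j => ?_, ?_, ?_,
    fun z hz j => ?_, ?_⟩
  · obtain ⟨-, -, -, -, -, Cε, hC⟩ := ha.holomorphic_param i u hu.1 ζ hζ
    exact (hC ρ hρ).1
  · exact (h.transfC_sub_mem hΓ hb hc0 hc (paramNbhd_mono hη hz) hx hx' hne).1
  · have hs := summable_norm_mul hbs hb hz
    refine ⟨toC3 (φ j x) - toC3 (φ j (G.chart i u)), fun w => ?_⟩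
    rw [transfC_eq, transfC_eq, transfC_eq, transfC_eq, affineC_update (hv hx) hs,
      affineC_update (hv hx') hs, smul_sub]
    abel
  · have hpos : 0 < ‖x - G.chart i u‖ := norm_pos_iff.2 (sub_ne_zero.2 hne)
    refine ⟨c * ‖x - G.chart i u‖ / 4, by positivity, fun y hy ζ hζ => ?_⟩
    rw [h.transfC_real hΓ hb hy hx, h.transfC_real hΓ hb hy hx', ← toC3_sub, mem_closedBall,
      dist_eq_norm] at hζ
    have h1 := hc y hy x hx _ hx'
    have h2 := toC3_add_mem_kernelDomain (v := transf φ₀ φ y x - transf φ₀ φ y (G.chart i u))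
      (δ := ζ - toC3 (transf φ₀ φ y x - transf φ₀ φ y (G.chart i u)))
      (norm_pos_iff.1 (lt_of_lt_of_le (by positivity) h1)) (hζ.trans (by linarith))
    rwa [add_sub_cancel] at h2
  · exact (continuousOn_affineC hbs (hv hx)).sub (continuousOn_affineC hbs (hv hx'))
  · exact differentiableAt_densityC h hb hL hu hz (hre z hz) j
  · exact continuousOn_densityC h hb hL hu fun y hy =>
      hre _ (mem_paramNbhd_of_real hη0 (toComplexParam_mem_unitSegment hy))

variable [Fintype ι]

include h hΓ hb ha hL in
theorem aestronglyMeasurable_patchKernel (hε : 0 < ε) {c : ℝ} (hc0 : 0 < c)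
    (hc : ∀ y ∈ paramDomain, ∀ x ∈ Γ, ∀ x' ∈ Γ,
      c * ‖x - x'‖ ≤ ‖transf φ₀ φ y x - transf φ₀ φ y x'‖) {η : ℝ} (hη : η ≤ c / 4)
    (hηε : η ≤ ε / 2) {z : ℕ → ℂ} (hz : z ∈ paramNbhd (normSeq Γ φ) η) (i : ι) :
    AEStronglyMeasurable (uncurry fun x u => patchKernel G φ₀ φ ε aC i x u z)
      ((G.surfaceMeasure id).prod (volume.restrict (G.dom i))) := by
  have hs := summable_norm_mul (h.summable_normSeq hb) hb hz
  have hρ := admissible_canonicalRadius hb hε (paramNbhd_mono hηε hz)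
  have hzρ : z ∈ polyTube (canonicalRadius (normSeq Γ φ) ε z) := fun j =>
    (infDist_lt_canonicalRadius hb hε z j).le
  refine AEMeasurable.aestronglyMeasurable ?_
  refine AEMeasurable.mul (f := fun q : E3 × E2 => aC (canonicalRadius (normSeq Γ φ) ε z) i z q.2
      (transfC φ₀ φ z q.1 - transfC φ₀ φ z (G.chart i q.2)))
    (g := fun q : E3 × E2 => densityC G φ₀ φ i q.2 z) ?_ ?_
  · refine aemeasurable_caratheodory isOpen_kernelDomain.measurableSet
      (f := fun u ζ => aC (canonicalRadius (normSeq Γ φ) ε z) i z u ζ)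
      (ha.aemeasurable _ hρ i z hzρ) ?_ (aemeasurable_transfC_sub h hΓ i hs) ?_
    · filter_upwards [ae_restrict_mem (G.measurableSet_dom i)] with u hu
      exact (ha.holomorphic_snd _ hρ i z hzρ u hu).continuousOn
    · filter_upwards [ae_offDiagonal hΓ h i] with q hq
      exact (h.transfC_sub_mem hΓ hb hc0 hc (paramNbhd_mono hη hz) hq.1
        (G.chart_mem hq.2.1.1) hq.2.2).1
  · exact (aemeasurable_densityC h hL i hs).comp_snd

include h hΓ hb ha in
/-- The pulled-back kernels are holomorphic on a common neighbourhood of the real parameter domain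
and bounded by a common weak singularity. -/
theorem exists_holomorphic_patchKernel (hε : 0 < ε) :
    ∃ η > 0, η ≤ ε ∧ ∃ C ν : ℝ, 0 ≤ C ∧ 0 ≤ ν ∧ ν < 2 ∧
      (∀ i, ∀ z ∈ paramNbhd (normSeq Γ φ) η,
        AEStronglyMeasurable (uncurry fun x u => patchKernel G φ₀ φ ε aC i x u z)
          ((G.surfaceMeasure id).prod (volume.restrict (G.dom i)))) ∧
      ∀ i, ∀ x ∈ Γ, ∀ u, IsRegularPoint G φ₀ φ i u → x ≠ G.chart i u →
        IsFinitelyHolomorphic (normSeq Γ φ) η (C * ‖x - G.chart i u‖ ^ (-ν))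
          (patchKernel G φ₀ φ ε aC i x u) ∧
        ∀ y ∈ paramDomain, patchKernel G φ₀ φ ε aC i x u (toComplexParam y)
          = a y (transf φ₀ φ y (G.chart i u))
              (toC3 (transf φ₀ φ y x - transf φ₀ φ y (G.chart i u)))
            * (√(gramDet (transf φ₀ φ y ∘ G.chart i) u) : ℂ) := by
  obtain ⟨L, hL⟩ := G.exists_lipschitz_const
  obtain ⟨L', hL'⟩ := G.exists_antilipschitz_const
  obtain ⟨c, hc0, hc⟩ := h.exists_lower_const hΓ hb
  have hcpos : 0 < c / ((L' : ℝ) + 1) := by positivity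
  have hc' : ∀ i, ∀ y ∈ paramDomain, ∀ u ∈ G.dom i, ∀ u' ∈ G.dom i,
      c / ((L' : ℝ) + 1) * ‖u - u'‖
        ≤ ‖transf φ₀ φ y (G.chart i u) - transf φ₀ φ y (G.chart i u')‖ := by
    intro i y hy u hu u' hu'
    refine le_trans ?_ (hc y hy _ (G.chart_mem hu) _ (G.chart_mem hu'))
    rw [div_mul_eq_mul_div, div_le_iff₀ (by positivity), mul_assoc]
    refine mul_le_mul_of_nonneg_left ((hL' i u hu u' hu').trans ?_) hc0.le
    rw [mul_comm]
    exact mul_le_mul_of_nonneg_left (by linarith) (norm_nonneg _)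
  obtain ⟨η₁, hη₁, M, hM⟩ := exists_gramC_bounds h hΓ hb hL hcpos hc'
  obtain ⟨R, hR⟩ := hΓ.isBounded.exists_norm_le
  set η := min η₁ (min (c / 4) (ε / 2)) with hη
  have hη0 : 0 < η := lt_min hη₁ (lt_min (by positivity) (by positivity))
  have hηc : η ≤ c / 4 := (min_le_right _ _).trans (min_le_left _ _)
  have hηε : η ≤ ε / 2 := (min_le_right _ _).trans (min_le_right _ _)
  have hηη : η ≤ η₁ := min_le_left _ _
  have hK : ∀ {i x u}, x ∈ Γ → IsRegularPoint G φ₀ φ i u → x ≠ G.chart i u → _ :=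
    fun {i x u} hx hu hne => kernelPoint_of_ne h hΓ hb ha hL hc0 hc hη0 hηc hu
      (fun z hz => (hM i u hu z (paramNbhd_mono hηη hz)).1) hx hne
  -- the bounds that belong to the single radii, in terms of the distance on the reference surface
  obtain ⟨η', hη'0, hη'le, C, ν, hC0, hν0, hν, hbound⟩ :=
    exists_uniform_singular_bound
      (Q := {q : ι × E3 × E2 // q.2.1 ∈ Γ ∧ IsRegularPoint G φ₀ φ q.1 q.2.2 ∧
        q.2.1 ≠ G.chart q.1 q.2.2}) hb hε
      (κ := fun q => patchKernel G φ₀ φ ε aC q.1.1 q.1.2.1 q.1.2.2)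
      (d := fun q => ‖q.1.2.1 - G.chart q.1.1 q.1.2.2‖) (d₀ := R + R)
      (fun q => norm_pos_iff.2 (sub_ne_zero.2 q.2.2.2))
      (fun q => (_root_.norm_sub_le _ _).trans
        (add_le_add (hR _ q.2.1) (hR _ (G.chart_mem q.2.2.1.1)))) hη0 (by
      intro ρ hρ
      obtain ⟨C, ν, hC, hν0, hν, hle⟩ := ha.bound ρ hρ
      refine ⟨C * (c / 2) ^ (-ν) * M ^ (1 / 2 : ℝ), ν, hν0, hν, ?_⟩
      rintro ⟨⟨i, x, u⟩, hx, hu, hne⟩ z hz hr hzρ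
      have hpos : 0 < ‖x - G.chart i u‖ := norm_pos_iff.2 (sub_ne_zero.2 hne)
      obtain ⟨hmem, hlow⟩ := h.transfC_sub_mem hΓ hb hc0 hc (paramNbhd_mono hηc hz) hx
        (G.chart_mem hu.1) hne
      have h1 := hle i z (fun j => (hzρ j).le) u hu.1 x hx hne hmem
      have h2 : ‖densityC G φ₀ φ i u z‖ ≤ M ^ (1 / 2 : ℝ) :=
        norm_cpow_half_le (hM i u hu z (paramNbhd_mono hηη hz)).2
      rw [patchKernel, (hK hx hu hne).kernelValue_eq hb hε hηε hz hr hρ hzρ, norm_mul]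
      have hZ : 0 < ‖transfC φ₀ φ z x - transfC φ₀ φ z (G.chart i u)‖ :=
        lt_of_lt_of_le (by positivity) hlow
      calc _ ≤ C / ‖transfC φ₀ φ z x - transfC φ₀ φ z (G.chart i u)‖ ^ ν * M ^ (1 / 2 : ℝ) :=
            mul_le_mul h1 h2 (norm_nonneg _) (by positivity)
        _ ≤ C * (c / 2 * ‖x - G.chart i u‖) ^ (-ν) * M ^ (1 / 2 : ℝ) := by
            refine mul_le_mul_of_nonneg_right ?_ ((norm_nonneg _).trans h2)
            rw [div_eq_mul_inv, ← Real.rpow_neg hZ.le]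
            exact mul_le_mul_of_nonneg_left
              (Real.rpow_le_rpow_of_nonpos (by positivity) hlow (by linarith)) hC.le
        _ = _ := by
            rw [Real.mul_rpow (by positivity) hpos.le]
            ring)
  refine ⟨η', hη'0, hη'le.trans (hηε.trans (by linarith)), C, ν, hC0, hν0, hν,
    fun i z hz => aestronglyMeasurable_patchKernel h hΓ hb ha hL hε hc0 hc hηc hηε
      (paramNbhd_mono hη'le hz) i, fun i x hx u hu hne => ⟨?_, fun y hy => ?_⟩⟩
  · exact (hK hx hu hne).isFinitelyHolomorphic hb hε hη0 hηε hη'le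
      fun z hz hr => hbound ⟨⟨i, x, u⟩, hx, hu, hne⟩ z hz hr
  · rw [patchKernel, (hK hx hu hne).kernelValue_real hb hε hη0 hy, h.transfC_real hΓ hb hy hx,
      h.transfC_real hΓ hb hy (G.chart_mem hu.1), ← toC3_sub, densityC_real h hΓ hb hL hu hy]
    have h1 := (hM i u hu _ (mem_paramNbhd_of_real hη₁ (toComplexParam_mem_unitSegment hy))).1
    rw [gramC_tangentC_real h hΓ hb hL hu hy, Complex.ofReal_re] at h1
    exact h1.le

end

/-! ### Operators with holomorphic kernels -/

section

variable {E P : Type*} [MeasurableSpace E] [MeasurableSpace P] {σ : Measure E} {μ : Measure P}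
  [SFinite σ] [SFinite μ] {m : E → P → ℝ} {S C : ℝ≥0} (hm : SchurWeight σ μ m S) {b : ℕ → ℝ}
  (hb : ∀ j, 0 < b j) (hbs : Summable b) {η : ℝ} (hη : 0 < η) {κ : E → P → (ℕ → ℂ) → ℂ}
  (hκ : ∀ᵐ q ∂σ.prod μ, IsFinitelyHolomorphic b η (C * m q.1 q.2) (κ q.1 q.2))
  (hmeas : ∀ z ∈ paramNbhd b η, AEStronglyMeasurable (uncurry fun x q => κ x q z) (σ.prod μ))

omit [SFinite σ] [SFinite μ] in
include hb hbs hη hκ hmeas in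
theorem aestronglyMeasurable_truncLimit {z : ℕ → ℂ} (hz : z ∈ paramNbhd b (η / 2)) :
    AEStronglyMeasurable (uncurry fun x q => truncLimit (κ x q) z) (σ.prod μ) := by
  refine aestronglyMeasurable_of_tendsto_ae atTop
    (fun N => hmeas _ (truncate_mem_paramNbhd hb (paramNbhd_mono (by linarith) hz) N)) ?_
  filter_upwards [hκ] with q hq
  exact hq.tendsto_truncLimit hb hbs hη hz

omit [SFinite σ] [SFinite μ] in
include hb hbs hη hκ in
theorem ae_norm_truncLimit_le {z : ℕ → ℂ} (hz : z ∈ paramNbhd b (η / 2)) :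
    ∀ᵐ q ∂σ.prod μ, ‖truncLimit (κ q.1 q.2) z‖ ≤ C * m q.1 q.2 := by
  filter_upwards [hκ] with q hq
  exact hq.norm_truncLimit_le hb hbs hη hz

include hm hb hbs hη hκ hmeas

theorem isKernelOperator_truncLimit {z : ℕ → ℂ} (hz : z ∈ paramNbhd b (η / 2)) :
    IsKernelOperator σ μ (fun x q => truncLimit (κ x q) z)
      (kernelOperator σ μ fun x q => truncLimit (κ x q) z) :=
  hm.isKernelOperator (aestronglyMeasurable_truncLimit hb hbs hη hκ hmeas hz)
    (ae_norm_truncLimit_le hb hbs hη hκ hz)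

theorem norm_kernelOperator_truncLimit_le {z : ℕ → ℂ} (hz : z ∈ paramNbhd b (η / 2)) :
    ‖kernelOperator σ μ fun x q => truncLimit (κ x q) z‖ ≤ C * S :=
  hm.norm_le (aestronglyMeasurable_truncLimit hb hbs hη hκ hmeas hz)
    (ae_norm_truncLimit_le hb hbs hη hκ hz)
    (isKernelOperator_truncLimit hm hb hbs hη hκ hmeas hz)

theorem differentiableAt_kernelOperator_truncLimit {z : ℕ → ℂ} (hz : z ∈ paramNbhd b (η / 2))
    (j : ℕ) :
    DifferentiableAt ℂ
      (fun w => kernelOperator σ μ fun x q => truncLimit (κ x q) (update z j w)) (z j) := by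
  obtain ⟨r, hr, hball⟩ := Metric.isOpen_iff.1 (isOpen_slice hb hz j) (z j)
    (by simpa using hz)
  refine hm.differentiableAt_kernelOperator (c := C)
    (k := fun w x q => truncLimit (κ x q) (update z j w)) hr
    (fun w hw => aestronglyMeasurable_truncLimit hb hbs hη hκ hmeas (hball hw)) ?_
  filter_upwards [hκ] with q hq
  refine ⟨fun w hw => ?_, fun w hw => hq.norm_truncLimit_le hb hbs hη (hball hw)⟩
  have h := hq.differentiableAt_truncLimit hb hbs hη (hball hw) j
  simp only [Function.update_idem, Function.update_self] at h
  exact h.differentiableWithinAt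

theorem norm_kernelOperator_truncLimit_sub_le {y y' : ℕ → ℝ} (hy : y ∈ paramDomain)
    (hy' : y' ∈ paramDomain) :
    ‖(kernelOperator σ μ fun x q => truncLimit (κ x q) (toComplexParam y))
      - kernelOperator σ μ fun x q => truncLimit (κ x q) (toComplexParam y')‖
      ≤ 8 * C / η * (∑' j, b j * |y j - y' j|) * S := by
  have hr : ∀ {y}, y ∈ paramDomain → toComplexParam y ∈ paramNbhd b (η / 2) := fun hy =>
    mem_paramNbhd_of_real (by linarith) (toComplexParam_mem_unitSegment hy)
  have hnn : 0 ≤ 8 * C / η * ∑' j, b j * |y j - y' j| :=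
    mul_nonneg (by positivity) (tsum_nonneg fun j => mul_nonneg (hb j).le (abs_nonneg _))
  have h := hm.norm_kernelOperator_sub_le (c := C)
    (c' := (8 * C / η * ∑' j, b j * |y j - y' j|).toNNReal)
    (aestronglyMeasurable_truncLimit hb hbs hη hκ hmeas (hr hy))
    (aestronglyMeasurable_truncLimit hb hbs hη hκ hmeas (hr hy'))
    (ae_norm_truncLimit_le hb hbs hη hκ (hr hy)) (ae_norm_truncLimit_le hb hbs hη hκ (hr hy')) (by
      filter_upwards [hκ] with q hq
      rw [hq.truncLimit_eq_of_real hb hbs hη hy, hq.truncLimit_eq_of_real hb hbs hη hy',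
        Real.coe_toNNReal _ hnn]
      refine (hq.norm_sub_le_of_real hb hbs hη hy hy').trans (le_of_eq ?_)
      ring)
  rwa [Real.coe_toNNReal _ hnn] at h

end

theorem continuousOn_tsum_abs_sub {b : ℕ → ℝ} (hb : ∀ j, 0 < b j) (hbs : Summable b) (y₀ : ℕ → ℝ)
    (hy₀ : y₀ ∈ paramDomain) :
    ContinuousOn (fun y : ℕ → ℝ => ∑' j, b j * |y j - y₀ j|) paramDomain := by
  refine continuousOn_tsum (u := fun j => b j * 2) (fun j => by fun_prop) (hbs.mul_right 2)
    fun j y hy => ?_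
  rw [Real.norm_of_nonneg (mul_nonneg (hb j).le (abs_nonneg _))]
  refine mul_le_mul_of_nonneg_left ?_ (hb j).le
  have h1 := hy j
  have h2 := hy₀ j
  rw [abs_le]
  constructor <;> linarith [h1.1, h1.2, h2.1, h2.2]

/-! ### Bernstein ellipses and tubes -/

theorem bernsteinEllipse_subset_tube {s : ℝ} : bernsteinEllipse s ⊆ tube s := by
  rintro _ ⟨w, hw1, hws, rfl⟩
  have h0 : 0 < ‖w‖ := by linarith
  have hw0 : w ≠ 0 := norm_pos_iff.1 h0
  set e : ℂ := w / ‖w‖ with he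
  have hne : ‖e‖ = 1 := by
    rw [he, norm_div, Complex.norm_real, norm_norm, div_self h0.ne']
  have hnC : (‖w‖ : ℂ) ≠ 0 := Complex.ofReal_ne_zero.2 h0.ne'
  have hei : e⁻¹ = starRingEnd ℂ e := Complex.inv_eq_conj hne
  have hmem : ((e.re : ℝ) : ℂ) ∈ unitSegment :=
    ⟨e.re, abs_le.1 ((Complex.abs_re_le_norm e).trans hne.le), rfl⟩
  have hre : ((e.re : ℝ) : ℂ) = (e + e⁻¹) / 2 := by
    rw [hei, Complex.add_conj]
    push_cast
    ring
  rw [mem_tube_iff]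
  refine (infDist_le_dist_of_mem hmem).trans ?_
  have hw : w = ‖w‖ * e := by rw [he]; field_simp
  have he0 : e ≠ 0 := by rw [← norm_pos_iff, hne]; exact one_pos
  have e1 : (w + w⁻¹) / 2 - ((e.re : ℝ) : ℂ)
      = (((‖w‖ - 1) / 2 : ℝ) : ℂ) * e + (((‖w‖⁻¹ - 1) / 2 : ℝ) : ℂ) * e⁻¹ := by
    rw [hre]
    nth_rewrite 1 2 [hw]
    rw [mul_inv]
    push_cast
    ring
  rw [dist_eq_norm, e1]
  refine (norm_add_le _ _).trans ?_
  rw [norm_mul, norm_mul, norm_inv, hne, Complex.norm_real, Complex.norm_real, inv_one, mul_one,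
    mul_one, Real.norm_of_nonneg (by linarith), Real.norm_eq_abs, abs_of_nonpos
      (by have := inv_le_one_of_one_le₀ hw1; linarith)]
  -- `1 - 1 / t ≤ t - 1` for `t ≥ 1`
  have h3 : 2 - ‖w‖ ≤ ‖w‖⁻¹ := by
    rw [← mul_le_mul_iff_of_pos_right h0, inv_mul_cancel₀ h0.ne']
    nlinarith [sq_nonneg (‖w‖ - 1)]
  linarith

theorem polyEllipse_subset_polyTube {ρ : ℕ → ℝ} : polyEllipse ρ ⊆ polyTube ρ := fun _ hz j =>
  bernsteinEllipse_subset_tube (hz j)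

theorem polyTube_subset_paramNbhd {b : ℕ → ℝ} (hb : ∀ j, 0 < b j) {ε η : ℝ} (hεη : ε < η)
    {ρ : ℕ → ℝ} (hρ : Admissible b ε ρ) : polyTube ρ ⊆ paramNbhd b η := by
  intro z hz
  have hle : ∀ j, infDist (z j) unitSegment * b j ≤ (ρ j - 1) * b j := fun j =>
    mul_le_mul_of_nonneg_right (mem_tube_iff.1 (hz j)) (hb j).le
  have hs : Summable fun j => infDist (z j) unitSegment * b j :=
    Summable.of_nonneg_of_le (fun j => mul_nonneg infDist_nonneg (hb j).le) hle hρ.2.1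
  exact ⟨hs, ((hs.tsum_le_tsum hle hρ.2.1).trans hρ.2.2).trans_lt hεη⟩

/-! ### The transported boundary integral operators -/

theorem SingularKernelAssumption.normSeq_pos {Γ : Set E3} {ι : Type*} {G : PatchDecomposition Γ ι}
    {φ₀ : E3 → E3} {φ : ℕ → E3 → E3} {p ε : ℝ} {a : (ℕ → ℝ) → E3 → C3 → ℂ}
    {aC : (ℕ → ℝ) → ι → (ℕ → ℂ) → E2 → C3 → ℂ} (ha : SingularKernelAssumption G φ₀ φ p ε a aC)
    (hΓ : Γ.Nonempty) (j : ℕ) : 0 < normSeq Γ φ j := by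
  obtain ⟨i, u, hu⟩ := G.exists_mem_dom hΓ
  have hζ : toC3 (EuclideanSpace.single 0 1) ∈ kernelDomain :=
    toC3_mem_kernelDomain (by simp)
  exact (ha.holomorphic_param i u hu _ hζ).2.2.1 j

section

variable {X Y Z : Type*} [NormedAddCommGroup X] [NormedSpace ℂ X] [NormedAddCommGroup Y]
  [NormedSpace ℂ Y] [NormedAddCommGroup Z] [NormedSpace ℂ Z]

theorem differentiableAt_comp_const {K : ℂ → Y →L[ℂ] Z} {w : ℂ} (hK : DifferentiableAt ℂ K w)
    (P : X →L[ℂ] Y) : DifferentiableAt ℂ (fun w => K w ∘L P) w :=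
  hK.clm_comp (differentiableAt_const _)

theorem tendsto_comp_const {α : Type*} {l : Filter α} {K : α → Y →L[ℂ] Z} {K₀ : Y →L[ℂ] Z}
    (hK : Tendsto K l (𝓝 K₀)) (P : X →L[ℂ] Y) : Tendsto (fun a => K a ∘L P) l (𝓝 (K₀ ∘L P)) :=
  ((ContinuousLinearMap.compL ℂ X Y Z).flip P).continuous.continuousAt.tendsto.comp hK

end

section

variable {Γ : Set E3} {ι : Type*} [Fintype ι] (G : PatchDecomposition Γ ι)

/-- Composition of a function on the surface with the chart of a patch, as an operator between
`L²`-spaces. -/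
noncomputable def chartPullback (i : ι) :
    Lp ℂ 2 (G.surfaceMeasure id) →L[ℂ] Lp ℂ 2 (volume.restrict (G.dom i)) :=
  (exists_pullback (G.aemeasurable_chart i) (G.exists_map_chart_le i).choose_spec).choose

theorem chartPullback_ae (i : ι) (f : Lp ℂ 2 (G.surfaceMeasure id)) :
    chartPullback G i f =ᵐ[volume.restrict (G.dom i)] fun u => f (G.chart i u) :=
  (exists_pullback (G.aemeasurable_chart i) (G.exists_map_chart_le i).choose_spec).choose_spec f

/-- The operator on `L²(Γ)` whose kernels on the patches are the limits of the values of `κ` at the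
truncations of `z`. -/
noncomputable def surfaceOperator (κ : ι → E3 → E2 → (ℕ → ℂ) → ℂ) (z : ℕ → ℂ) :
    Lp ℂ 2 (G.surfaceMeasure id) →L[ℂ] Lp ℂ 2 (G.surfaceMeasure id) :=
  ∑ i, (kernelOperator (G.surfaceMeasure id) (volume.restrict (G.dom i))
    fun x u => truncLimit (κ i x u) z) ∘L chartPullback G i

variable {G}

/-- An operator on `L²(Γ)` that is given in the charts by the pulled-back kernel is the transport
of the boundary integral operator on the transformed surface. -/
theorem isTransportedOperator_of_kernel (hΓ : IsCompact Γ) {r : E3 → E3} (hr : BiLipschitzOn r Γ)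
    {k : E3 → C3 → ℂ} {κ : ι → E3 → E2 → ℂ}
    {K : ∀ i, Lp ℂ 2 (volume.restrict (G.dom i)) →L[ℂ] Lp ℂ 2 (G.surfaceMeasure id)}
    (hK : ∀ i, IsKernelOperator (G.surfaceMeasure id) (volume.restrict (G.dom i)) (κ i) (K i))
    (hκ : ∀ i, ∀ᵐ q ∂(G.surfaceMeasure id).prod (volume.restrict (G.dom i)),
      κ i q.1 q.2 = k (r (G.chart i q.2)) (toC3 (r q.1 - r (G.chart i q.2)))
        * (√(gramDet (r ∘ G.chart i) q.2) : ℂ)) :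
    IsTransportedOperator G r k (∑ i, K i ∘L chartPullback G i) := by
  have := G.isFiniteMeasure_surfaceMeasure hΓ PatchDecomposition.biLipschitzOn_id
  obtain ⟨T, s, hT, hsr, hs, hTs⟩ := G.exists_isPullback hΓ hr
  set B := ∑ i, K i ∘L chartPullback G i with hB
  refine ⟨T, T.symm.toContinuousLinearMap ∘L B ∘L T.toContinuousLinearMap, hT, fun f => ?_,
    fun f => by simp⟩
  have hsum : B (T f) =ᵐ[G.surfaceMeasure id] fun x => ∑ i, K i (chartPullback G i (T f)) x := by
    have e : B (T f) = ∑ i, K i (chartPullback G i (T f)) := by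
      simp [hB]
    rw [e]
    filter_upwards [Lp.coeFn_finsetSum Finset.univ fun i => K i (chartPullback G i (T f))] with x hx
    rw [hx, Finset.sum_apply]
  have hfun : ∀ i, ∀ᵐ u ∂volume.restrict (G.dom i),
      chartPullback G i (T f) u = f (r (G.chart i u)) := by
    intro i
    obtain ⟨C, hC⟩ := G.exists_map_chart_le i
    have h1 : ∀ᵐ u ∂volume.restrict (G.dom i), T f (G.chart i u) = f (r (G.chart i u)) :=
      ae_of_ae_map (G.aemeasurable_chart i)
        (((Measure.absolutelyContinuous_of_le hC).trans Measure.smul_absolutelyContinuous).ae_le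
          (hT f))
    filter_upwards [chartPullback_ae G i (T f), h1] with u h1 h2
    rw [h1, h2]
  -- the claim at the points of the reference surface
  have key : ∀ᵐ x ∂G.surfaceMeasure id,
      Integrable (fun y => k y (toC3 (r x - y)) * f y) (G.surfaceMeasure r) ∧
        B (T f) x = ∫ y, k y (toC3 (r x - y)) * f y ∂G.surfaceMeasure r := by
    filter_upwards [hsum, ae_all_iff.2 fun i => hK i (chartPullback G i (T f)),
      ae_all_iff.2 fun i => Measure.ae_ae_of_ae_prod (hκ i)] with x h1 h2 h3
    have he : ∀ i, (fun u => κ i x u * chartPullback G i (T f) u)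
        =ᵐ[volume.restrict (G.dom i)] fun u => (√(gramDet (r ∘ G.chart i) u) : ℂ) *
          (k (r (G.chart i u)) (toC3 (r x - r (G.chart i u))) * f (r (G.chart i u))) := fun i => by
      filter_upwards [h3 i, hfun i] with u h4 h5
      rw [h4, h5]
      ring
    obtain ⟨h6, h7⟩ := G.integral_surfaceMeasure hr
      (h := fun y => k y (toC3 (r x - y)) * f y) fun i => (h2 i).1.congr (he i)
    refine ⟨h6, ?_⟩
    rw [h7, h1]
    exact Finset.sum_congr rfl fun i _ => (h2 i).2.trans (integral_congr_ae (he i))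
  filter_upwards [hs.ae key, hTs (B (T f)), G.ae_mem_image hΓ hr] with x h1 h2 h3
  obtain ⟨x, hx, rfl⟩ := h3
  rw [hsr x hx] at h1 h2
  exact ⟨h1.1, h2.trans h1.2⟩

variable {m : ι → E3 → E2 → ℝ} {S C : ℝ≥0} {b : ℕ → ℝ} {η : ℝ} {κ : ι → E3 → E2 → (ℕ → ℂ) → ℂ}
  [IsFiniteMeasure (G.surfaceMeasure id)]
  (hm : ∀ i, SchurWeight (G.surfaceMeasure id) (volume.restrict (G.dom i)) (m i) S)
  (hb : ∀ j, 0 < b j) (hbs : Summable b) (hη : 0 < η)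
  (hκ : ∀ i, ∀ᵐ q ∂(G.surfaceMeasure id).prod (volume.restrict (G.dom i)),
    IsFinitelyHolomorphic b η (C * m i q.1 q.2) (κ i q.1 q.2))
  (hmeas : ∀ i, ∀ z ∈ paramNbhd b η, AEStronglyMeasurable (uncurry fun x u => κ i x u z)
    ((G.surfaceMeasure id).prod (volume.restrict (G.dom i))))

include hm hb hbs hη hκ hmeas

theorem norm_surfaceOperator_le {z : ℕ → ℂ} (hz : z ∈ paramNbhd b (η / 2)) :
    ‖surfaceOperator G κ z‖ ≤ ∑ i, C * S * ‖chartPullback G i‖ := by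
  refine (norm_sum_le _ _).trans (Finset.sum_le_sum fun i _ => ?_)
  refine (ContinuousLinearMap.opNorm_comp_le _ _).trans ?_
  gcongr
  exact norm_kernelOperator_truncLimit_le (hm i) hb hbs hη (hκ i) (hmeas i) hz

theorem differentiableAt_surfaceOperator {z : ℕ → ℂ} (hz : z ∈ paramNbhd b (η / 2)) (j : ℕ) :
    DifferentiableAt ℂ (fun w => surfaceOperator G κ (update z j w)) (z j) := by
  refine DifferentiableAt.fun_sum fun i _ => ?_
  exact differentiableAt_comp_const
    (differentiableAt_kernelOperator_truncLimit (hm i) hb hbs hη (hκ i) (hmeas i) hz j)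
    (chartPullback G i)

theorem continuousOn_surfaceOperator :
    ContinuousOn (fun y => surfaceOperator G κ (toComplexParam y)) paramDomain := by
  intro y₀ hy₀
  refine tendsto_finsetSum _ fun i _ => ?_
  refine tendsto_comp_const ?_ (chartPullback G i)
  rw [tendsto_iff_norm_sub_tendsto_zero]
  have hlim := ((((continuousOn_tsum_abs_sub hb hbs y₀ hy₀) y₀ hy₀).const_mul
    (8 * C / η)).mul_const (S : ℝ))
  simp only [ContinuousWithinAt, sub_self, abs_zero, mul_zero, tsum_zero, zero_mul] at hlim
  refine squeeze_zero' (Eventually.of_forall fun _ => norm_nonneg _) ?_ hlim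
  filter_upwards [self_mem_nhdsWithin] with y hy
  exact norm_kernelOperator_truncLimit_sub_le (hm i) hb hbs hη (hκ i) (hmeas i) hy hy₀

end

end ShapeHolomorphy

theorem mainTheorem1 {Ω : Set E3} (hΩ : IsBoundedLipschitzDomain Ω)
    {ι : Type*} [Fintype ι] (G : PatchDecomposition (frontier Ω) ι)
    (φ₀ : E3 → E3) (φ : ℕ → E3 → E3) (p : ℝ) (hφ : AffineParametric (frontier Ω) φ₀ φ p)
    (a : (ℕ → ℝ) → E3 → C3 → ℂ) (aC : (ℕ → ℝ) → ι → (ℕ → ℂ) → E2 → C3 → ℂ)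
    (ε : ℝ) (hε : 0 < ε) (ha : SingularKernelAssumption G φ₀ φ p ε a aC) :
    ∃ A : (ℕ → ℝ) →
        (Lp ℂ 2 (G.surfaceMeasure id) →L[ℂ] Lp ℂ 2 (G.surfaceMeasure id)),
      (∀ y ∈ paramDomain, IsTransportedOperator G (transf φ₀ φ y) (a y) (A y)) ∧
      (∃ ε' : ℝ, 0 < ε' ∧ ε' ≤ ε ∧ BPEHolomorphic (normSeq (frontier Ω) φ) p ε' A) ∧
      ContinuousOn A paramDomain := by
  have hΓ := hΩ.isCompact_frontier
  have hb := ha.normSeq_pos hΩ.nonempty_frontier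
  have hbs := hφ.summable_normSeq hb
  have := G.isFiniteMeasure_surfaceMeasure hΓ PatchDecomposition.biLipschitzOn_id
  obtain ⟨η, hη, hηε, C, ν, hC, hν0, hν, hmeas, hker⟩ :=
    exists_holomorphic_patchKernel hφ hΓ hb ha hε
  obtain ⟨S, hS⟩ := G.exists_schurWeight hΓ hν0 hν
  lift C to ℝ≥0 using hC
  set κ := patchKernel G φ₀ φ ε aC with hκ
  have hfin : ∀ i, ∀ᵐ q ∂(G.surfaceMeasure id).prod (volume.restrict (G.dom i)),
      IsFinitelyHolomorphic (normSeq (frontier Ω) φ) η (C * ‖q.1 - G.chart i q.2‖ ^ (-ν))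
        (κ i q.1 q.2) := fun i => by
    filter_upwards [ae_offDiagonal hΓ hφ i] with q hq
    exact (hker i q.1 hq.1 q.2 hq.2.1 hq.2.2).1
  have hreal : ∀ {y}, y ∈ paramDomain →
      toComplexParam y ∈ paramNbhd (normSeq (frontier Ω) φ) (η / 2) := fun hy =>
    mem_paramNbhd_of_real (by linarith) (toComplexParam_mem_unitSegment hy)
  have hbound : ∀ z ∈ paramNbhd (normSeq (frontier Ω) φ) (η / 2),
      ‖surfaceOperator G κ z‖ ≤ ∑ i, C * S * ‖chartPullback G i‖ := fun z hz =>
    norm_surfaceOperator_le hS hb hbs hη hfin hmeas hz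
  -- `η / 4` is small enough for the closed admissible polytubes to lie in the open `paramNbhd b (η / 2)`
  refine ⟨fun y => surfaceOperator G κ (toComplexParam y), fun y hy => ?_,
    ⟨η / 4, by linarith, by linarith, fun _ z => surfaceOperator G κ z,
      ⟨hφ.p_pos, hφ.p_lt_one⟩, by linarith, hb, hφ.summable,
      ⟨_, fun y hy => hbound _ (hreal hy)⟩, _, fun ρ hρ => ⟨⟨fun _ _ => rfl, fun z hz j w hw => ?_⟩,
        fun z hz => hbound z (polyTube_subset_paramNbhd hb (by linarith) hρ
          (polyEllipse_subset_polyTube hz))⟩⟩,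
    continuousOn_surfaceOperator hS hb hbs hη hfin hmeas⟩
  · refine isTransportedOperator_of_kernel hΓ (hφ.biLipschitz y hy) (fun i =>
      isKernelOperator_truncLimit (hS i) hb hbs hη (hfin i) (hmeas i) (hreal hy)) fun i => ?_
    filter_upwards [ae_offDiagonal hΓ hφ i] with q hq
    obtain ⟨h1, h2⟩ := hker i q.1 hq.1 q.2 hq.2.1 hq.2.2
    rw [h1.truncLimit_eq_of_real hb hbs hη hy, h2 y hy]
  · have hzw : Function.update z j w ∈ polyTube ρ := fun l => by
      obtain rfl | hl := eq_or_ne l j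
      · simpa using hw
      · simpa [hl] using hz l
    have h := differentiableAt_surfaceOperator hS hb hbs hη hfin hmeas
      (polyTube_subset_paramNbhd hb (by linarith) hρ hzw) j
    simp only [Function.update_idem, Function.update_self] at h
    exact h.differentiableWithinAt
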